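/- Let $R$ be a commutative ring. All graded objects are graded by the non-negative integers, and tensor products are over $R$. **Modules.** $\mathcal M$ is the category of positively graded $R$-modules $N$ (so $N_0=0$). $N$ is *of finite type* if every $N_n$ is finitely generated. For a module $M$ let $M[n]$ be the graded module equal to $M$ in degree $n$ and zero in all other degrees. $\mathcal S\subset\mathcal M$ is the full subcategory of the $N$ such that for every maximal ideal $\mathfrak m$ of $R$ the graded $R_{\mathfrak m}$-module $N_{\mathfrak m}$ is isomorphic to $0$ or to $(R_{\mathfrak m}/\mathfrak a_{\mathfrak m})[n]$ for some ideal $\mathfrak a\subset\mathfrak m$ and some $n$, where $n$ is even if $\operatorname{char}(R_{\mathfrak m}/\mathfrak a_{\mathfrak m})\ne 2$. $\mathcal S^{ft}\subset\mathcal S$ consists of the objects of finite type. $\mathcal F$ is the full subcategory of $\mathcal M$ of the objects isomorphic to one of $0,R[1],R[2],\dots$ if $\operatorname{char}R=2$, and to one of $0,R[2],R[4],\dots$ otherwise. **Coalgebras.** $\mathcal C$ is the category of connected graded coalgebras (coassociative, counital, with the counit $C_0\to R$ bijective), and ${}^{co}\mathcal C\subset\mathcal C$ is the full subcategory of the graded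 cocommutative ones. The functor $C:\mathcal M\to\mathcal C$ sends $N$ to $R[0]\oplus N$ with $\Delta(1)=1\otimes1$ and $\Delta(x)=x\otimes1+1\otimes x$ for $x\in N$. **Cogroups.** $\mathcal A$ is the category of connected graded associative unital $R$-algebras (with the unit $R\to A_0$ bijective), $*$ is its categorical coproduct, $\mathcal A_{CM}$ is the category of comonoids in $\mathcal A$ with respect to $*$, and $\mathcal A_{CG}\subset\mathcal A_{CM}$ is the full subcategory of cogroups, i.e. of comonoids which have an inverse. The functor $T_{CM}:\mathcal C\to\mathcal A_{CM}$ sends $C$ to the tensor algebra $T(\overline C)$ on $\overline C=\bigoplus_{n>0}C_n$, with comultiplication $T(\overline C)\to T(\overline C)*T(\overline C)$ given by $x\mapsto x'+x''+\sum_i y_i'z_i''$ for $x\in\overline C$ with $\Delta x=x\otimes1+1\otimes x+\sum_i y_i\otimes z_i$, $y_i,z_i\in\overline C$; here $'$ and $''$ denote the two inclusions. The following are full subcategories of $\mathcal A_{CG}$: - $\mathcal A_{CG}^{co}$: the underlying algebra is graded commutative, $ab=(-1)^{pq}ba$ for $a\in A_p$, $b\in A_q$; - $\mathcal A_{CG}^{co\,ft}$: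 moreover every $A_n$ is a finitely generated $R$-module; - $\mathcal A_{coCG}$: the cogroup is cocommutative, i.e. its comultiplication $A\to A*A$ is invariant under the interchange of the two factors; - ${}^{co}\mathcal A_{CG}$: the underlying coalgebra of $A$, with comultiplication $A\to A*A\to A\otimes A$ (where $a'\mapsto a\otimes1$, $a''\mapsto1\otimes a$, and $A\otimes A$ has the usual signed multiplication), is graded cocommutative; - $\mathcal A_{coCG}^{co}$: the objects lying in both $\mathcal A_{CG}^{co}$ and $\mathcal A_{coCG}$. **Corollary 1.7.** (1) $T_{CM}$ takes values in $\mathcal A_{CG}$, $C$ takes values in ${}^{co}\mathcal C$, the inclusions $\mathcal A_{CG}^{co\,ft}\subset\mathcal A_{coCG}^{co}\subset\mathcal A_{coCG}\subset{}^{co}\mathcal A_{CG}\subset\mathcal A_{CG}$ hold, and $T_{CM}\circ C$ and $T_{CM}$ restrict to the vertical functors of the diagram $$\begin{array}{ccccccccc} \mathcal S^{ft}&\hookrightarrow&\mathcal S&\hookrightarrow&\mathcal M&\xrightarrow{\ C\ }&{}^{co}\mathcal C&\hookrightarrow&\mathcal C\\ {\scriptstyle T_{CM}\circ C}\downarrow\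 &&{\scriptstyle T_{CM}\circ C}\downarrow\ &&{\scriptstyle T_{CM}\circ C}\downarrow\ &&{\scriptstyle T_{CM}}\downarrow\ &&{\scriptstyle T_{CM}}\downarrow\ \\ \mathcal A_{CG}^{co\,ft}&\hookrightarrow&\mathcal A_{coCG}^{co}&\hookrightarrow&\mathcal A_{coCG}&\hookrightarrow&{}^{co}\mathcal A_{CG}&\hookrightarrow&\mathcal A_{CG}. \end{array}$$ (2) The diagram commutes up to natural isomorphism, and all of its functors are fully faithful. (3) The vertical functors with sources $\mathcal S^{ft}$, $\mathcal M$, ${}^{co}\mathcal C$ and $\mathcal C$ (all of them except the one with source $\mathcal S$) are equivalences of categories. (4) If $R$ is a field, then $\mathcal F=\mathcal S^{ft}=\mathcal S$ and $\mathcal A_{CG}^{co\,ft}=\mathcal A_{coCG}^{co}=\mathcal A_{CG}^{co}$. -/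

import Mathlib

open CategoryTheory TensorProduct

universe u

noncomputable section

namespace CogroupAlg

/-! ## Gradings of algebras determined by the degrees of generators

For an algebra `P` with an algebra homomorphism `δ : P → P[X]`, the elements of degree `n` are
those with `δ x = x Xⁿ`. If such elements generate `P`, this is a grading of `P`. -/

section Weight

variable {R : Type u} [CommRing R] {P : Type u} [Ring P] [Algebra R P]

/-- The elements of degree `n`: those `x` with `δ x = x Xⁿ`. -/
def piece (δ : P →ₐ[R] Polynomial P) (n : ℕ) : Submodule R P where
  carrier := {x | δ x = Polynomial.monomial n x}
  add_mem' {x y} hx hy := by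
    simp only [Set.mem_ofPred_eq] at *
    rw [map_add, hx, hy, map_add]
  zero_mem' := by simp
  smul_mem' r x hx := by
    simp only [Set.mem_ofPred_eq] at *
    rw [map_smul, hx, Polynomial.smul_monomial]

theorem mem_piece {δ : P →ₐ[R] Polynomial P} {n : ℕ} {x : P} :
    x ∈ piece δ n ↔ δ x = Polynomial.monomial n x := Iff.rfl

instance (δ : P →ₐ[R] Polynomial P) : SetLike.GradedMonoid (piece δ) where
  one_mem := by
    rw [mem_piece, map_one, Polynomial.monomial_zero_one]
  mul_mem i j x y hx hy := by
    rw [mem_piece] at *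
    rw [map_mul, hx, hy, Polynomial.monomial_mul_monomial]

/-- If homogeneous elements generate `P`, then every coefficient of `δ x` is homogeneous, and
they add up to `x`. -/
theorem coeff_mem_piece (δ : P →ₐ[R] Polynomial P) (s : Set P)
    (hs : Algebra.adjoin R s = ⊤) (hd : ∀ y ∈ s, ∃ n, y ∈ piece δ n) (x : P) :
    (∀ n, (δ x).coeff n ∈ piece δ n) ∧ (δ x).eval 1 = x := by
  have hx : x ∈ Algebra.adjoin R s := by rw [hs]; trivial
  induction hx using Algebra.adjoin_induction with
  | mem y hy =>
    obtain ⟨n, hn⟩ := hd y hy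
    rw [mem_piece.1 hn]
    refine ⟨fun k => ?_, by simp⟩
    rw [Polynomial.coeff_monomial]
    split_ifs with h
    · exact h ▸ hn
    · exact zero_mem _
  | algebraMap r =>
    rw [AlgHom.commutes, Polynomial.algebraMap_apply]
    refine ⟨fun k => ?_, by simp⟩
    rw [Polynomial.coeff_C]
    split_ifs with h
    · rw [h, mem_piece, AlgHom.commutes, Polynomial.algebraMap_apply, Polynomial.monomial_zero_left]
    · exact zero_mem _
  | add x y _ _ hx hy =>
    rw [map_add]
    refine ⟨fun k => ?_, by rw [Polynomial.eval_add, hx.2, hy.2]⟩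
    rw [Polynomial.coeff_add]
    exact add_mem (hx.1 k) (hy.1 k)
  | mul x y _ _ hx hy =>
    rw [map_mul]
    refine ⟨fun k => ?_, ?_⟩
    · rw [Polynomial.coeff_mul]
      refine sum_mem fun p hp => ?_
      rw [← Finset.HasAntidiagonal.mem_antidiagonal.1 hp]
      exact SetLike.mul_mem_graded (hx.1 _) (hy.1 _)
    · have := Polynomial.eval₂_mul_noncomm (p := δ x) (q := δ y) (RingHom.id P) (1 : P)
        (fun k => Commute.one_right _)
      exact this.trans (congrArg₂ (· * ·) hx.2 hy.2)

theorem coeff_coe_piece (δ : P →ₐ[R] Polynomial P) (f : DirectSum ℕ fun n => piece δ n) (n : ℕ) :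
    (δ (DirectSum.coeAddMonoidHom (piece δ) f)).coeff n = f n := by
  classical
  induction f using DirectSum.induction_on with
  | zero => simp
  | of i x =>
    rw [DirectSum.coeAddMonoidHom_of, mem_piece.1 x.2, Polynomial.coeff_monomial,
      DirectSum.coe_of_apply]
    split_ifs <;> rfl
  | add f g hf hg => rw [map_add, map_add, Polynomial.coeff_add, hf, hg]; rfl

/-- The grading of an algebra generated by homogeneous elements. -/
@[reducible]
def pieceGraded (δ : P →ₐ[R] Polynomial P) (s : Set P)
    (hs : Algebra.adjoin R s = ⊤) (hd : ∀ y ∈ s, ∃ n, y ∈ piece δ n) :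
    GradedAlgebra (piece δ) where
  toDecomposition := DirectSum.IsInternal.chooseDecomposition (piece δ) (by
    constructor
    · intro f g h
      ext n
      rw [← coeff_coe_piece, h, coeff_coe_piece]
    · intro x
      have hx := coeff_mem_piece δ s hs hd x
      refine ⟨∑ n ∈ (δ x).support, DirectSum.of (fun n => piece δ n) n ⟨_, hx.1 n⟩, ?_⟩
      refine Eq.trans ?_ (Polynomial.eval_eq_sum.symm.trans hx.2)
      rw [map_sum, Polynomial.sum_def]
      exact Finset.sum_congr rfl fun n _ => by rw [DirectSum.coeAddMonoidHom_of]; simp)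

/-- Such an algebra is connected if the generators of degree zero are scalars. -/
theorem piece_zero_scalar (δ : P →ₐ[R] Polynomial P) (s : Set P)
    (hs : Algebra.adjoin R s = ⊤)
    (hd : ∀ y ∈ s, ∃ n, y ∈ piece δ n ∧ (n = 0 → ∃ r, algebraMap R P r = y))
    (x : P) (hx : x ∈ piece δ 0) : ∃ r, algebraMap R P r = x := by
  have key : ∀ x : P, (δ x).coeff 0 ∈ (⊥ : Subalgebra R P) := by
    intro x
    have hx : x ∈ Algebra.adjoin R s := by rw [hs]; trivial
    induction hx using Algebra.adjoin_induction with
    | mem y hy =>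
      obtain ⟨n, hn, h0⟩ := hd y hy
      rw [mem_piece.1 hn, Polynomial.coeff_monomial]
      split_ifs with h
      · obtain ⟨r, rfl⟩ := h0 h
        exact Subalgebra.algebraMap_mem _ r
      · exact zero_mem _
    | algebraMap r =>
      rw [AlgHom.commutes, Polynomial.algebraMap_apply, Polynomial.coeff_C_zero]
      exact Subalgebra.algebraMap_mem _ r
    | add x y _ _ hx hy => rw [map_add, Polynomial.coeff_add]; exact add_mem hx hy
    | mul x y _ _ hx hy => rw [map_mul, Polynomial.mul_coeff_zero]; exact mul_mem hx hy
  have := key x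
  rw [mem_piece.1 hx, Polynomial.coeff_monomial, if_pos rfl] at this
  exact Algebra.mem_bot.1 this

/-- An algebra homomorphism which preserves the degrees of generators is graded. -/
theorem map_mem_of_gen (δ : P →ₐ[R] Polynomial P) (s : Set P)
    (hs : Algebra.adjoin R s = ⊤) {Q : Type u} [Ring Q] [Algebra R Q]
    (𝒬 : ℕ → Submodule R Q) [SetLike.GradedMonoid 𝒬] (f : P →ₐ[R] Q)
    (hd : ∀ y ∈ s, ∃ n, y ∈ piece δ n ∧ f y ∈ 𝒬 n)
    (n : ℕ) (x : P) (hx : x ∈ piece δ n) : f x ∈ 𝒬 n := by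
  have key : ∀ (x : P) (n : ℕ), f ((δ x).coeff n) ∈ 𝒬 n := by
    intro x
    have hx : x ∈ Algebra.adjoin R s := by rw [hs]; trivial
    induction hx using Algebra.adjoin_induction with
    | mem y hy =>
      intro k
      obtain ⟨n, hn, h0⟩ := hd y hy
      rw [mem_piece.1 hn, Polynomial.coeff_monomial]
      split_ifs with h
      · exact h ▸ h0
      · rw [map_zero]; exact zero_mem _
    | algebraMap r =>
      intro k
      rw [AlgHom.commutes, Polynomial.algebraMap_apply, Polynomial.coeff_C]
      split_ifs with h
      · rw [h, AlgHom.commutes, Algebra.algebraMap_eq_smul_one]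
        exact Submodule.smul_mem _ _ SetLike.GradedOne.one_mem
      · rw [map_zero]; exact zero_mem _
    | add x y _ _ hx hy =>
      intro k
      rw [map_add, Polynomial.coeff_add, map_add]; exact add_mem (hx k) (hy k)
    | mul x y _ _ hx hy =>
      intro k
      rw [map_mul, Polynomial.coeff_mul, map_sum]
      refine sum_mem fun p hp => ?_
      rw [← Finset.HasAntidiagonal.mem_antidiagonal.1 hp, map_mul]
      exact SetLike.mul_mem_graded (hx _) (hy _)
  have := key x n
  rwa [mem_piece.1 hx, Polynomial.coeff_monomial, if_pos rfl] at this

/-- For a graded module `M` and a linear map `g : M → P`, the map `x ↦ ∑ₙ g(xₙ) Xⁿ`. -/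
def weighted {M : Type u} [AddCommGroup M] [Module R M] (ℳ : ℕ → Submodule R M)
    [DirectSum.Decomposition ℳ] (g : M →ₗ[R] P) : M →ₗ[R] Polynomial P :=
  (DirectSum.toModule R ℕ (Polynomial P) fun n =>
    ((Polynomial.monomial n : P →ₗ[P] Polynomial P).restrictScalars R) ∘ₗ g ∘ₗ (ℳ n).subtype) ∘ₗ
    (DirectSum.decomposeLinearEquiv ℳ).toLinearMap

theorem weighted_of_mem {M : Type u} [AddCommGroup M] [Module R M] (ℳ : ℕ → Submodule R M)
    [DirectSum.Decomposition ℳ] (g : M →ₗ[R] P) {n : ℕ} {x : M} (hx : x ∈ ℳ n) :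
    weighted ℳ g x = Polynomial.monomial n (g x) := by
  lift x to ℳ n using hx
  simp [weighted]

end Weight

/-! ## Connected graded algebras -/

/-- A connected graded algebra over `R`: an associative unital `ℕ`-graded algebra whose unit map
`R → A₀` is bijective. -/
structure ConnAlg (R : Type u) [CommRing R] where
  carrier : Type u
  [ring : Ring carrier]
  [algebra : Algebra R carrier]
  grading : ℕ → Submodule R carrier
  [graded : GradedAlgebra grading]
  algebraMap_injective : Function.Injective (algebraMap R carrier)
  exists_scalar : ∀ x ∈ grading 0, ∃ r : R, algebraMap R carrier r = x

attribute [instance] ConnAlg.ring ConnAlg.algebra ConnAlg.graded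

namespace ConnAlg

variable {R : Type u} [CommRing R]

/-- A homomorphism of graded algebras. -/
@[ext]
structure Hom (A B : ConnAlg R) where
  toAlgHom : A.carrier →ₐ[R] B.carrier
  map_mem : ∀ (n : ℕ) (x : A.carrier), x ∈ A.grading n → toAlgHom x ∈ B.grading n

/-- The category of connected graded algebras. -/
instance : Category (ConnAlg R) where
  Hom := Hom
  id A := ⟨AlgHom.id R A.carrier, fun _ _ h => h⟩
  comp f g := ⟨g.toAlgHom.comp f.toAlgHom, fun n x h => g.map_mem n _ (f.map_mem n x h)⟩

@[ext]
theorem hom_ext {A B : ConnAlg R} {f g : A ⟶ B} (h : f.toAlgHom = g.toAlgHom) : f = g :=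
  Hom.ext h

@[simp] theorem id_toAlgHom (A : ConnAlg R) : Hom.toAlgHom (𝟙 A) = AlgHom.id R A.carrier := rfl

@[simp] theorem comp_toAlgHom {A B C : ConnAlg R} (f : A ⟶ B) (g : B ⟶ C) :
    Hom.toAlgHom (f ≫ g) = g.toAlgHom.comp f.toAlgHom := rfl

theorem exists_aug (A : ConnAlg R) (x : A.carrier) :
    ∃ r : R, algebraMap R A.carrier r = (GradedRing.projZeroRingHom A.grading x : A.carrier) :=
  A.exists_scalar _ (SetLike.coe_mem (DirectSum.decompose A.grading x 0))

/-- The augmentation: the projection onto the degree-zero part, which is `R`. -/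
def aug (A : ConnAlg R) : A.carrier →ₐ[R] R where
  toFun x := (A.exists_aug x).choose
  map_one' := A.algebraMap_injective (by
    rw [(A.exists_aug 1).choose_spec, map_one, map_one])
  map_mul' x y := A.algebraMap_injective (by
    rw [(A.exists_aug _).choose_spec, map_mul, map_mul, (A.exists_aug x).choose_spec,
      (A.exists_aug y).choose_spec])
  map_zero' := A.algebraMap_injective (by
    rw [(A.exists_aug 0).choose_spec, map_zero, map_zero])
  map_add' x y := A.algebraMap_injective (by
    rw [(A.exists_aug _).choose_spec, map_add, map_add, (A.exists_aug x).choose_spec,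
      (A.exists_aug y).choose_spec])
  commutes' r := A.algebraMap_injective (by
    rw [(A.exists_aug _).choose_spec, Algebra.algebraMap_self_apply]
    have : algebraMap R A.carrier r ∈ A.grading 0 := SetLike.algebraMap_mem_graded _ r
    exact DirectSum.decompose_of_mem_same _ this)

theorem algebraMap_aug (A : ConnAlg R) (x : A.carrier) :
    algebraMap R A.carrier (A.aug x) = (DirectSum.decompose A.grading x 0 : A.carrier) :=
  (A.exists_aug x).choose_spec

theorem aug_of_mem (A : ConnAlg R) {n : ℕ} (hn : n ≠ 0) {x : A.carrier} (hx : x ∈ A.grading n) :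
    A.aug x = 0 :=
  A.algebraMap_injective (by
    rw [algebraMap_aug, map_zero, DirectSum.decompose_of_mem_ne _ hx hn])

theorem aug_comp {A B : ConnAlg R} (f : A ⟶ B) : B.aug.comp f.toAlgHom = A.aug := by
  ext x
  induction x using DirectSum.Decomposition.inductionOn A.grading with
  | zero => simp
  | @homogeneous i m =>
    by_cases h : i = 0
    · subst h
      obtain ⟨r, hr⟩ := A.exists_scalar _ m.2
      rw [← hr, AlgHom.commutes, AlgHom.commutes]
    · rw [A.aug_of_mem h m.2]
      exact B.aug_of_mem h (f.map_mem _ _ m.2)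
  | add a b ha hb => rw [map_add, map_add, ha, hb]

/-- The algebra `R`, concentrated in degree zero. -/
def unit (R : Type u) [CommRing R] : ConnAlg R where
  carrier := R
  grading n := if n = 0 then ⊤ else ⊥
  graded :=
    { one_mem := by simp
      mul_mem := fun i j x y hx hy => by
        by_cases hi : i = 0
        · by_cases hj : j = 0
          · simp [hi, hj]
          · simp only [hj, if_false, Submodule.mem_bot] at hy
            simp [hy]
        · simp only [hi, if_false, Submodule.mem_bot] at hx
          simp [hx]
      toDecomposition := DirectSum.Decomposition.ofLinearMap _
        (DirectSum.lof R ℕ (fun n => ((if n = 0 then ⊤ else ⊥ : Submodule R R))) 0 ∘ₗ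
          LinearMap.codRestrict _ LinearMap.id (fun x => by simp))
        (by ext; simp)
        (by
          ext i ⟨x, hx⟩ : 2
          by_cases hi : i = 0
          · subst hi
            simp [LinearMap.codRestrict]
          · simp only [hi, if_false, Submodule.mem_bot] at hx
            subst hx
            have : (⟨0, hx⟩ : ((if i = 0 then ⊤ else ⊥ : Submodule R R))) = 0 := rfl
            rw [this, map_zero, map_zero]) }
  algebraMap_injective _ _ h := h
  exists_scalar x _ := ⟨x, rfl⟩

/-- The counit `A → R`. -/
def toUnit (A : ConnAlg R) : A ⟶ unit R where
  toAlgHom := A.aug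
  map_mem n x hx := by
    by_cases h : n = 0
    · subst h
      exact Submodule.mem_top (x := A.aug x)
    · have h0 : A.aug x = 0 := A.aug_of_mem h hx
      have h1 : A.aug x ∈ (if n = 0 then ⊤ else ⊥ : Submodule R R) := by rw [h0]; exact zero_mem _
      exact h1

/-- The unit `R → B`. -/
def fromUnit (B : ConnAlg R) : unit R ⟶ B where
  toAlgHom := Algebra.ofId R B.carrier
  map_mem n x hx := by
    by_cases h : n = 0
    · subst h
      exact SetLike.algebraMap_mem_graded _ _
    · have h1 : x ∈ (if n = 0 then ⊤ else ⊥ : Submodule R R) := hx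
      rw [if_neg h] at h1
      have h2 (y : R) (hy : y = 0) : Algebra.ofId R B.carrier y ∈ B.grading n := by
        rw [hy, map_zero]; exact zero_mem _
      exact h2 x ((Submodule.mem_bot R).1 h1)

/-- The algebra `R` is a zero object: initial (the empty coproduct) and terminal. -/
theorem isZero_unit : Limits.IsZero (unit R) where
  unique_to B := ⟨⟨⟨fromUnit B⟩, fun f => by
    have h := @Subsingleton.elim (R →ₐ[R] B.carrier) _ f.toAlgHom (Algebra.ofId R B.carrier)
    exact hom_ext h⟩⟩
  unique_from A := ⟨⟨⟨toUnit A⟩, fun f => by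
    have h (g : A ⟶ unit R) : (unit R).aug.comp g.toAlgHom = A.aug := aug_comp g
    have h' : (unit R).aug = AlgHom.id R R := by ext
    have := (h f).trans (h (toUnit A)).symm
    rw [h'] at this
    ext x
    exact DFunLike.congr_fun this x⟩⟩

/-- The zero morphism `A → R → B`. -/
def triv (A B : ConnAlg R) : A ⟶ B := toUnit A ≫ fromUnit B

/-! ### The categorical coproduct -/

/-- The relations which make the two inclusions of `A` and `B` in `T(A × B)` multiplicative. -/
inductive CoprodRel (A B : ConnAlg R) :
    TensorAlgebra R (A.carrier × B.carrier) → TensorAlgebra R (A.carrier × B.carrier) → Prop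
  | inl_one : CoprodRel A B (TensorAlgebra.ι R (1, 0)) 1
  | inl_mul (a a' : A.carrier) : CoprodRel A B (TensorAlgebra.ι R (a * a', 0))
      (TensorAlgebra.ι R (a, 0) * TensorAlgebra.ι R (a', 0))
  | inr_one : CoprodRel A B (TensorAlgebra.ι R (0, 1)) 1
  | inr_mul (b b' : B.carrier) : CoprodRel A B (TensorAlgebra.ι R (0, b * b'))
      (TensorAlgebra.ι R (0, b) * TensorAlgebra.ι R (0, b'))

/-- The free product of the algebras `A` and `B`. -/
def FreeProd (A B : ConnAlg R) : Type u := RingQuot (CoprodRel A B)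

instance (A B : ConnAlg R) : Ring (FreeProd A B) := inferInstanceAs (Ring (RingQuot _))

instance (A B : ConnAlg R) : Algebra R (FreeProd A B) :=
  inferInstanceAs (Algebra R (RingQuot (CoprodRel A B)))

namespace FreeProd

variable (A B : ConnAlg R)

/-- The quotient map from the tensor algebra. -/
def mk : TensorAlgebra R (A.carrier × B.carrier) →ₐ[R] FreeProd A B :=
  RingQuot.mkAlgHom R (CoprodRel A B)

/-- The first inclusion. -/
def inl : A.carrier →ₐ[R] FreeProd A B :=
  AlgHom.ofLinearMap
    ((mk A B).toLinearMap ∘ₗ TensorAlgebra.ι R ∘ₗ LinearMap.inl R A.carrier B.carrier)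
    ((RingQuot.mkAlgHom_rel R CoprodRel.inl_one).trans (map_one (mk A B)))
    (fun a a' => (RingQuot.mkAlgHom_rel R (CoprodRel.inl_mul a a')).trans (map_mul (mk A B) _ _))

/-- The second inclusion. -/
def inr : B.carrier →ₐ[R] FreeProd A B :=
  AlgHom.ofLinearMap
    ((mk A B).toLinearMap ∘ₗ TensorAlgebra.ι R ∘ₗ LinearMap.inr R A.carrier B.carrier)
    ((RingQuot.mkAlgHom_rel R CoprodRel.inr_one).trans (map_one (mk A B)))
    (fun a a' => (RingQuot.mkAlgHom_rel R (CoprodRel.inr_mul a a')).trans (map_mul (mk A B) _ _))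

variable {A B} {Q : Type u} [Ring Q] [Algebra R Q]

/-- The universal property: the homomorphism given by `f` on `A` and by `g` on `B`. -/
def lift (f : A.carrier →ₐ[R] Q) (g : B.carrier →ₐ[R] Q) : FreeProd A B →ₐ[R] Q :=
  RingQuot.liftAlgHom R ⟨TensorAlgebra.lift R (f.toLinearMap.coprod g.toLinearMap), by
    intro x y h
    induction h <;> simp⟩

@[simp]
theorem lift_inl (f : A.carrier →ₐ[R] Q) (g : B.carrier →ₐ[R] Q) (a : A.carrier) :
    lift f g (inl A B a) = f a := by
  refine (RingQuot.liftAlgHom_mkAlgHom_apply R _ _ _).trans ?_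
  simp

@[simp]
theorem lift_inr (f : A.carrier →ₐ[R] Q) (g : B.carrier →ₐ[R] Q) (b : B.carrier) :
    lift f g (inr A B b) = g b := by
  refine (RingQuot.liftAlgHom_mkAlgHom_apply R _ _ _).trans ?_
  simp

theorem algHom_ext {f g : FreeProd A B →ₐ[R] Q} (h₁ : ∀ a, f (inl A B a) = g (inl A B a))
    (h₂ : ∀ b, f (inr A B b) = g (inr A B b)) : f = g := by
  refine RingQuot.ringQuot_ext' _ _ _ (TensorAlgebra.hom_ext (LinearMap.prod_ext ?_ ?_))
  · ext a; exact h₁ a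
  · ext b; exact h₂ b

/-- The degree homomorphism of a graded algebra followed by a homomorphism. -/
def weightHom {P : Type u} [Ring P] [Algebra R P] (A : ConnAlg R) (g : A.carrier →ₐ[R] P) :
    A.carrier →ₐ[R] Polynomial P :=
  AlgHom.ofLinearMap (weighted A.grading g.toLinearMap)
    (by
      rw [weighted_of_mem _ _ (SetLike.GradedOne.one_mem : (1 : A.carrier) ∈ A.grading 0)]
      simp)
    (by
      intro x y
      induction x using DirectSum.Decomposition.inductionOn A.grading with
      | zero => simp
      | add a b ha hb => rw [add_mul, map_add, ha, hb, map_add, add_mul]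
      | @homogeneous i a =>
        induction y using DirectSum.Decomposition.inductionOn A.grading with
        | zero => simp
        | add a b ha hb => rw [mul_add, map_add, ha, hb, map_add, mul_add]
        | @homogeneous j b =>
          rw [weighted_of_mem _ _ a.2, weighted_of_mem _ _ b.2,
            weighted_of_mem _ _ (SetLike.mul_mem_graded a.2 b.2),
            Polynomial.monomial_mul_monomial]
          simp)

variable (A B)

/-- The homomorphism which defines the degree: `a ↦ a Xⁿ` for `a` of degree `n` in `A` or `B`. -/
def deg : FreeProd A B →ₐ[R] Polynomial (FreeProd A B) :=
  lift (weightHom A (inl A B)) (weightHom B (inr A B))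

variable {A B}

theorem inl_mem {n : ℕ} {a : A.carrier} (ha : a ∈ A.grading n) :
    inl A B a ∈ piece (deg A B) n := by
  rw [mem_piece, deg, lift_inl]
  exact weighted_of_mem _ _ ha

theorem inr_mem {n : ℕ} {b : B.carrier} (hb : b ∈ B.grading n) :
    inr A B b ∈ piece (deg A B) n := by
  rw [mem_piece, deg, lift_inr]
  exact weighted_of_mem _ _ hb

variable (A B)

/-- The homogeneous elements of the two factors. -/
def gens : Set (FreeProd A B) :=
  {x | ∃ n, (∃ a ∈ A.grading n, inl A B a = x) ∨ (∃ b ∈ B.grading n, inr A B b = x)}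

theorem adjoin_gens : Algebra.adjoin R (gens A B) = ⊤ := by
  set S := Algebra.adjoin R (gens A B)
  have hl (a : A.carrier) : inl A B a ∈ S := by
    induction a using DirectSum.Decomposition.inductionOn A.grading with
    | zero => rw [map_zero]; exact zero_mem _
    | @homogeneous i m => exact Algebra.subset_adjoin ⟨i, Or.inl ⟨m, m.2, rfl⟩⟩
    | add a b ha hb => rw [map_add]; exact add_mem ha hb
  have hr (a : B.carrier) : inr A B a ∈ S := by
    induction a using DirectSum.Decomposition.inductionOn B.grading with
    | zero => rw [map_zero]; exact zero_mem _
    | @homogeneous i m => exact Algebra.subset_adjoin ⟨i, Or.inr ⟨m, m.2, rfl⟩⟩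
    | add a b ha hb => rw [map_add]; exact add_mem ha hb
  have h : S.val.comp (lift ((inl A B).codRestrict S hl) ((inr A B).codRestrict S hr)) =
      AlgHom.id R _ := algHom_ext (fun a => by simp) (fun b => by simp)
  rw [eq_top_iff]
  intro x _
  have := DFunLike.congr_fun h x
  rw [AlgHom.id_apply] at this
  rw [← this]
  exact Subtype.property _

end FreeProd

/-- The coproduct `A ∗ B` of connected graded algebras: the free product, graded so that the
degrees of the elements of `A` and of `B` are kept. -/
def coprod (A B : ConnAlg R) : ConnAlg R where
  carrier := FreeProd A B
  grading := piece (FreeProd.deg A B)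
  graded := pieceGraded _ (FreeProd.gens A B) (FreeProd.adjoin_gens A B) (by
    rintro _ ⟨n, ⟨a, ha, rfl⟩ | ⟨b, hb, rfl⟩⟩
    exacts [⟨n, FreeProd.inl_mem ha⟩, ⟨n, FreeProd.inr_mem hb⟩])
  algebraMap_injective r r' h := by
    simpa using congrArg (FreeProd.lift A.aug B.aug) h
  exists_scalar := piece_zero_scalar _ (FreeProd.gens A B) (FreeProd.adjoin_gens A B) (by
    rintro _ ⟨n, ⟨a, ha, rfl⟩ | ⟨b, hb, rfl⟩⟩
    · refine ⟨n, FreeProd.inl_mem ha, ?_⟩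
      rintro rfl
      obtain ⟨r, rfl⟩ := A.exists_scalar a ha
      exact ⟨r, ((FreeProd.inl A B).commutes r).symm⟩
    · refine ⟨n, FreeProd.inr_mem hb, ?_⟩
      rintro rfl
      obtain ⟨r, rfl⟩ := B.exists_scalar b hb
      exact ⟨r, ((FreeProd.inr A B).commutes r).symm⟩)

/-- The first inclusion `A → A ∗ B`. -/
def inl (A B : ConnAlg R) : A ⟶ coprod A B where
  toAlgHom := FreeProd.inl A B
  map_mem _ _ h := FreeProd.inl_mem h

/-- The second inclusion `B → A ∗ B`. -/
def inr (A B : ConnAlg R) : B ⟶ coprod A B where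
  toAlgHom := FreeProd.inr A B
  map_mem _ _ h := FreeProd.inr_mem h

/-- The morphism `A ∗ B → D` given by `f` on `A` and by `g` on `B`. -/
def desc {A B D : ConnAlg R} (f : A ⟶ D) (g : B ⟶ D) : coprod A B ⟶ D where
  toAlgHom := FreeProd.lift f.toAlgHom g.toAlgHom
  map_mem := map_mem_of_gen _ (FreeProd.gens A B) (FreeProd.adjoin_gens A B) _ _ (by
    rintro _ ⟨n, ⟨a, ha, rfl⟩ | ⟨b, hb, rfl⟩⟩
    · exact ⟨n, FreeProd.inl_mem ha, by rw [FreeProd.lift_inl]; exact f.map_mem n a ha⟩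
    · exact ⟨n, FreeProd.inr_mem hb, by rw [FreeProd.lift_inr]; exact g.map_mem n b hb⟩)

@[simp]
theorem inl_desc {A B D : ConnAlg R} (f : A ⟶ D) (g : B ⟶ D) : inl A B ≫ desc f g = f := by
  ext a; exact FreeProd.lift_inl _ _ a

@[simp]
theorem inr_desc {A B D : ConnAlg R} (f : A ⟶ D) (g : B ⟶ D) : inr A B ≫ desc f g = g := by
  ext a; exact FreeProd.lift_inr _ _ a

theorem coprod_hom_ext {A B D : ConnAlg R} {f g : coprod A B ⟶ D}
    (h₁ : inl A B ≫ f = inl A B ≫ g) (h₂ : inr A B ≫ f = inr A B ≫ g) : f = g := by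
  refine hom_ext (FreeProd.algHom_ext (fun a => ?_) (fun b => ?_))
  · exact DFunLike.congr_fun (congrArg Hom.toAlgHom h₁) a
  · exact DFunLike.congr_fun (congrArg Hom.toAlgHom h₂) b

/-- `A ∗ B` is the categorical coproduct. -/
def isColimitCoprod (A B : ConnAlg R) :
    Limits.IsColimit (Limits.BinaryCofan.mk (inl A B) (inr A B)) :=
  Limits.BinaryCofan.IsColimit.mk _ (fun f g => desc f g) (fun f g => inl_desc f g)
    (fun f g => inr_desc f g)
    (fun f g _ h₁ h₂ => coprod_hom_ext (h₁.trans (inl_desc f g).symm)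
      (h₂.trans (inr_desc f g).symm))

/-- The morphism `f ∗ g`. -/
def coprodMap {A B A' B' : ConnAlg R} (f : A ⟶ A') (g : B ⟶ B') : coprod A B ⟶ coprod A' B' :=
  desc (f ≫ inl A' B') (g ≫ inr A' B')

/-- The associativity isomorphism `(A ∗ B) ∗ D → A ∗ (B ∗ D)`. -/
def coprodAssoc (A B D : ConnAlg R) : coprod (coprod A B) D ⟶ coprod A (coprod B D) :=
  desc (desc (inl A (coprod B D)) (inl B D ≫ inr A (coprod B D))) (inr B D ≫ inr A (coprod B D))

/-- The interchange of the two factors of `A ∗ A`. -/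
def coprodSwap (A : ConnAlg R) : coprod A A ⟶ coprod A A :=
  desc (inr A A) (inl A A)

/-- Graded commutativity: `a b = (-1)^{pq} b a`. -/
def IsGradedCommutative (A : ConnAlg R) : Prop :=
  ∀ (p q : ℕ) (a b : A.carrier), a ∈ A.grading p → b ∈ A.grading q →
    a * b = (-1) ^ (p * q) * (b * a)

/-- Of finite type: finitely generated in every degree. -/
def IsFiniteType (A : ConnAlg R) : Prop := ∀ n, (A.grading n).FG

end ConnAlg

/-! ## Comonoids and cogroups -/

section Swap

variable {R : Type u} [CommRing R] {M : Type u} [AddCommGroup M] [Module R M]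
  (ℳ : ℕ → Submodule R M) [DirectSum.Decomposition ℳ]

/-- The graded interchange `x ⊗ y ↦ (-1)^{pq} y ⊗ x` on `M ⊗ M`. -/
def gradedSwap : M ⊗[R] M →ₗ[R] M ⊗[R] M :=
  (TensorProduct.congr (DirectSum.decomposeLinearEquiv ℳ)
      (DirectSum.decomposeLinearEquiv ℳ)).symm.toLinearMap ∘ₗ
    (TensorProduct.gradedComm R (fun n => ℳ n) (fun n => ℳ n)).toLinearMap ∘ₗ
    (TensorProduct.congr (DirectSum.decomposeLinearEquiv ℳ)
      (DirectSum.decomposeLinearEquiv ℳ)).toLinearMap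

theorem gradedSwap_tmul {p q : ℕ} {x y : M} (hx : x ∈ ℳ p) (hy : y ∈ ℳ q) :
    gradedSwap ℳ (x ⊗ₜ y) = (-1 : ℤ) ^ (p * q) • (y ⊗ₜ[R] x) := by
  lift x to ℳ p using hx
  lift y to ℳ q using hy
  have h := TensorProduct.gradedComm_of_tmul_of R (fun n => ℳ n) (fun n => ℳ n) p q x y
  simp only [gradedSwap, LinearMap.comp_apply, LinearEquiv.coe_coe, TensorProduct.congr_tmul,
    DirectSum.decomposeLinearEquiv_apply_coe]
  rw [h]
  rcases Nat.even_or_odd (p * q) with e | e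
  · have e' : ((-1 : ℤˣ) ^ (q * p)) = 1 := by rw [mul_comm]; exact e.neg_one_pow
    rw [e', one_smul, e.neg_one_pow, one_smul]
    simp
  · have e' : ((-1 : ℤˣ) ^ (q * p)) = -1 := by rw [mul_comm]; exact e.neg_one_pow
    rw [e', e.neg_one_pow]
    simp

end Swap

/-- A comonoid in the category of connected graded algebras, with respect to the categorical
coproduct `∗`. The counit is the unique morphism to the zero object `R`. -/
structure AlgComon (R : Type u) [CommRing R] extends ConnAlg R where
  comul : toConnAlg ⟶ ConnAlg.coprod toConnAlg toConnAlg
  counit_left : comul ≫ ConnAlg.desc (ConnAlg.triv _ _) (𝟙 toConnAlg) = 𝟙 toConnAlg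
  counit_right : comul ≫ ConnAlg.desc (𝟙 toConnAlg) (ConnAlg.triv _ _) = 𝟙 toConnAlg
  coassoc : comul ≫ ConnAlg.coprodMap comul (𝟙 toConnAlg) ≫ ConnAlg.coprodAssoc _ _ _ =
    comul ≫ ConnAlg.coprodMap (𝟙 toConnAlg) comul

namespace AlgComon

variable {R : Type u} [CommRing R]

/-- A homomorphism of comonoids. -/
@[ext]
structure Hom (A B : AlgComon R) where
  hom : A.toConnAlg ⟶ B.toConnAlg
  comul_comm : A.comul ≫ ConnAlg.coprodMap hom hom = hom ≫ B.comul

/-- The category of comonoids in connected graded algebras. -/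
instance : Category (AlgComon R) where
  Hom := Hom
  id A := ⟨𝟙 A.toConnAlg, by
    rw [Category.id_comp]
    refine Eq.trans (congrArg _ ?_) (Category.comp_id _)
    exact ConnAlg.coprod_hom_ext (by simp [ConnAlg.coprodMap]) (by simp [ConnAlg.coprodMap])⟩
  comp {A B D} f g := ⟨f.hom ≫ g.hom, by
    rw [Category.assoc, ← g.comul_comm, ← Category.assoc, ← f.comul_comm, Category.assoc]
    congr 1
    refine ConnAlg.coprod_hom_ext ?_ ?_
    · simp only [ConnAlg.coprodMap, ConnAlg.inl_desc, ← Category.assoc]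
      simp only [Category.assoc, ConnAlg.inl_desc]
    · simp only [ConnAlg.coprodMap, ConnAlg.inr_desc, ← Category.assoc]
      simp only [Category.assoc, ConnAlg.inr_desc]⟩

@[ext]
theorem hom_ext {A B : AlgComon R} {f g : A ⟶ B} (h : Hom.hom f = Hom.hom g) : f = g :=
  Hom.ext h

/-- The comultiplication `A → A ∗ A → A ⊗ A` of the underlying coalgebra (and Hopf algebra) of a
comonoid `A`. Here `A ∗ A → A ⊗ A` is `a ↦ a ⊗ 1` on the first factor and `a ↦ 1 ⊗ a` on the
second one, and the multiplication of `A ⊗ A` has the usual sign. -/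
def tensorComul (A : AlgComon R) : A.carrier →ₗ[R] A.carrier ⊗[R] A.carrier :=
  (GradedTensorProduct.of R A.grading A.grading).symm.toLinearMap ∘ₗ
    ((ConnAlg.FreeProd.lift (GradedTensorProduct.includeLeft A.grading A.grading)
      (GradedTensorProduct.includeRight A.grading A.grading)).comp
        (ConnAlg.Hom.toAlgHom A.comul)).toLinearMap

variable (R)

/-- `𝒜_CG`: the comonoids which are cogroups, that is, which have an inverse. -/
def cogroup : ObjectProperty (AlgComon R) := fun A =>
  ∃ ν : A.toConnAlg ⟶ A.toConnAlg,
    A.comul ≫ ConnAlg.desc ν (𝟙 A.toConnAlg) = ConnAlg.triv _ _ ∧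
    A.comul ≫ ConnAlg.desc (𝟙 A.toConnAlg) ν = ConnAlg.triv _ _

/-- `𝒜_CG^co`: the cogroups whose underlying algebra is graded commutative. -/
def commCogroup : ObjectProperty (AlgComon R) := fun A =>
  cogroup R A ∧ A.toConnAlg.IsGradedCommutative

/-- `𝒜_CG^{co ft}`: those which are moreover of finite type. -/
def commCogroupFT : ObjectProperty (AlgComon R) := fun A =>
  commCogroup R A ∧ A.toConnAlg.IsFiniteType

/-- `𝒜_coCG`: the cocommutative cogroups. -/
def cocommCogroup : ObjectProperty (AlgComon R) := fun A =>
  cogroup R A ∧ A.comul ≫ ConnAlg.coprodSwap A.toConnAlg = A.comul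

/-- `ᶜᵒ𝒜_CG`: the cogroups whose underlying coalgebra is graded cocommutative. -/
def coalgCocommCogroup : ObjectProperty (AlgComon R) := fun A =>
  cogroup R A ∧ gradedSwap A.grading ∘ₗ A.tensorComul = A.tensorComul

/-- `𝒜_coCG^co`: the objects which lie both in `𝒜_CG^co` and in `𝒜_coCG`. -/
def commCocommCogroup : ObjectProperty (AlgComon R) := fun A =>
  commCogroup R A ∧ cocommCogroup R A

end AlgComon

/-! ## Connected graded coalgebras -/

/-- A connected graded coalgebra over `R`: a coassociative counital coalgebra with an
`ℕ`-grading which is respected by the comultiplication and the counit (`R` being concentrated in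
degree zero), such that the counit restricts to a bijection `C₀ → R`. -/
structure ConnCoalg (R : Type u) [CommRing R] where
  carrier : Type u
  [addCommGroup : AddCommGroup carrier]
  [module : Module R carrier]
  [coalgebra : Coalgebra R carrier]
  grading : ℕ → Submodule R carrier
  [decomposition : DirectSum.Decomposition grading]
  comul_mem : ∀ (n : ℕ) (x : carrier), x ∈ grading n → Coalgebra.comul (R := R) x ∈
    Submodule.span R {t | ∃ p q, p + q = n ∧ ∃ y ∈ grading p, ∃ z ∈ grading q, t = y ⊗ₜ[R] z}
  counit_eq_zero : ∀ (n : ℕ) (x : carrier), n ≠ 0 → x ∈ grading n →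
    Coalgebra.counit (R := R) x = 0
  connected : Function.Bijective fun x : grading 0 => Coalgebra.counit (R := R) (x : carrier)

attribute [instance] ConnCoalg.addCommGroup ConnCoalg.module ConnCoalg.coalgebra
  ConnCoalg.decomposition

namespace ConnCoalg

variable {R : Type u} [CommRing R]

/-- A homomorphism of graded coalgebras. -/
@[ext]
structure Hom (C D : ConnCoalg R) where
  toCoalgHom : C.carrier →ₗc[R] D.carrier
  map_mem : ∀ (n : ℕ) (x : C.carrier), x ∈ C.grading n → toCoalgHom x ∈ D.grading n

/-- The category of connected graded coalgebras. -/
instance : Category (ConnCoalg R) where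
  Hom := Hom
  id C := ⟨CoalgHom.id R C.carrier, fun _ _ h => h⟩
  comp f g := ⟨g.toCoalgHom.comp f.toCoalgHom, fun n x h => g.map_mem n _ (f.map_mem n x h)⟩

@[ext]
theorem hom_ext {C D : ConnCoalg R} {f g : C ⟶ D} (h : Hom.toCoalgHom f = Hom.toCoalgHom g) :
    f = g :=
  Hom.ext h

variable (R) in
/-- `ᶜᵒ𝒞`: the graded cocommutative objects. -/
def cocomm : ObjectProperty (ConnCoalg R) := fun C =>
  gradedSwap C.grading ∘ₗ Coalgebra.comul = (Coalgebra.comul : C.carrier →ₗ[R] _)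

variable (C : ConnCoalg R)

/-- The projection onto the degree-zero part. -/
def projZero : C.carrier →ₗ[R] C.carrier :=
  (C.grading 0).subtype ∘ₗ DirectSum.component R ℕ (fun n => C.grading n) 0 ∘ₗ
    (DirectSum.decomposeLinearEquiv C.grading).toLinearMap

theorem projZero_zero {x : C.carrier} (hx : x ∈ C.grading 0) : C.projZero x = x :=
  DirectSum.decompose_of_mem_same _ hx

theorem projZero_of_mem {n : ℕ} (hn : n ≠ 0) {x : C.carrier} (hx : x ∈ C.grading n) :
    C.projZero x = 0 :=
  DirectSum.decompose_of_mem_ne _ hx hn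

theorem projZero_mem (x : C.carrier) : C.projZero x ∈ C.grading 0 := SetLike.coe_mem _

/-- The positive part of `C`, the direct sum of the `Cₙ` with `n > 0`. -/
def pos : Submodule R C.carrier := LinearMap.ker C.projZero

/-- The projection onto the positive part. -/
def projPos : C.carrier →ₗ[R] C.pos :=
  LinearMap.codRestrict C.pos (LinearMap.id - C.projZero) fun x => by
    simp [pos, C.projZero_zero (C.projZero_mem x)]

theorem coe_projPos (x : C.carrier) : (C.projPos x : C.carrier) = x - C.projZero x := rfl

theorem projPos_coe (x : C.pos) : C.projPos x = x := by
  have h : C.projZero x = 0 := x.2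
  refine Subtype.ext ?_
  rw [coe_projPos, h, sub_zero]

theorem projPos_zero {x : C.carrier} (hx : x ∈ C.grading 0) : C.projPos x = 0 := by
  refine Subtype.ext ?_
  rw [coe_projPos, C.projZero_zero hx, sub_self, Submodule.coe_zero]

/-! ### The tensor algebra on the positive part -/

/-- The homomorphism which defines the degree on the tensor algebra: `x ↦ x Xⁿ` for `x` in the
positive part of `C` of degree `n`. -/
def tensorDeg : TensorAlgebra R C.pos →ₐ[R] Polynomial (TensorAlgebra R C.pos) :=
  TensorAlgebra.lift R (weighted C.grading (TensorAlgebra.ι R ∘ₗ C.projPos) ∘ₗ C.pos.subtype)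

/-- The homogeneous elements of the positive part of `C`. -/
def tensorGens : Set (TensorAlgebra R C.pos) :=
  {x | ∃ n, ∃ c ∈ C.grading n, TensorAlgebra.ι R (C.projPos c) = x}

theorem ι_mem {n : ℕ} {c : C.carrier} (hc : c ∈ C.grading n) :
    TensorAlgebra.ι R (C.projPos c) ∈ piece C.tensorDeg n := by
  rw [mem_piece, tensorDeg, TensorAlgebra.lift_ι_apply]
  by_cases h : n = 0
  · subst h
    simp [C.projPos_zero hc]
  · have : ((C.projPos c : C.pos) : C.carrier) = c := by
      rw [coe_projPos, C.projZero_of_mem h hc, sub_zero]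
    rw [LinearMap.comp_apply, Submodule.subtype_apply, this, weighted_of_mem _ _ hc]
    rfl

theorem adjoin_tensorGens : Algebra.adjoin R C.tensorGens = ⊤ := by
  rw [eq_top_iff, ← TensorAlgebra.adjoin_range_ι]
  refine Algebra.adjoin_le ?_
  rintro _ ⟨x, rfl⟩
  have key : ∀ c : C.carrier,
      TensorAlgebra.ι R (C.projPos c) ∈ Algebra.adjoin R C.tensorGens := by
    intro c
    induction c using DirectSum.Decomposition.inductionOn C.grading with
    | zero => rw [map_zero, map_zero]; exact zero_mem _
    | @homogeneous i m => exact Algebra.subset_adjoin ⟨i, m, m.2, rfl⟩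
    | add a b ha hb => rw [map_add, map_add]; exact add_mem ha hb
  have := key x
  rwa [projPos_coe] at this

/-- The tensor algebra on the positive part of `C`, as a connected graded algebra. -/
def tensor : ConnAlg R where
  carrier := TensorAlgebra R C.pos
  grading := piece C.tensorDeg
  graded := pieceGraded _ C.tensorGens C.adjoin_tensorGens (by
    rintro _ ⟨n, c, hc, rfl⟩
    exact ⟨n, C.ι_mem hc⟩)
  algebraMap_injective := (TensorAlgebra.algebraMap_leftInverse _).injective
  exists_scalar := piece_zero_scalar _ C.tensorGens C.adjoin_tensorGens (by
    rintro _ ⟨n, c, hc, rfl⟩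
    refine ⟨n, C.ι_mem hc, ?_⟩
    rintro rfl
    exact ⟨0, by simp [C.projPos_zero hc]⟩)

/-! ### Convolution -/

variable {C}

/-- The set `G(C, B)`: linear maps `C → B` of degree zero which are the identity of `R` in degree
zero. -/
structure IsG (B : ConnAlg R) (f : C.carrier →ₗ[R] B.carrier) : Prop where
  map_mem : ∀ (n : ℕ) (x : C.carrier), x ∈ C.grading n → f x ∈ B.grading n
  map_zero : ∀ x ∈ C.grading 0, f x = algebraMap R B.carrier (Coalgebra.counit (R := R) x)

/-- The convolution product `C → C ⊗ C → B ⊗ B → B`. -/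
def conv {B : Type u} [Ring B] [Algebra R B] (f g : C.carrier →ₗ[R] B) : C.carrier →ₗ[R] B :=
  LinearMap.mul' R B ∘ₗ TensorProduct.map f g ∘ₗ Coalgebra.comul

theorem conv_eq {B : Type u} [Ring B] [Algebra R B] (f g : C.carrier →ₗ[R] B) :
    conv f g = (WithConv.toConv f * WithConv.toConv g).ofConv := rfl

theorem conv_assoc {B : Type u} [Ring B] [Algebra R B] (f g h : C.carrier →ₗ[R] B) :
    conv (conv f g) h = conv f (conv g h) :=
  congrArg WithConv.ofConv
    (mul_assoc (WithConv.toConv f) (WithConv.toConv g) (WithConv.toConv h))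

theorem one_conv {B : Type u} [Ring B] [Algebra R B] (f : C.carrier →ₗ[R] B) :
    conv (Algebra.linearMap R B ∘ₗ Coalgebra.counit) f = f :=
  congrArg WithConv.ofConv (one_mul (WithConv.toConv f))

theorem conv_one {B : Type u} [Ring B] [Algebra R B] (f : C.carrier →ₗ[R] B) :
    conv f (Algebra.linearMap R B ∘ₗ Coalgebra.counit) = f :=
  congrArg WithConv.ofConv (mul_one (WithConv.toConv f))

theorem algHom_comp_conv {A B : Type u} [Ring A] [Algebra R A] [Ring B] [Algebra R B]
    (h : A →ₐ[R] B) (f g : C.carrier →ₗ[R] A) :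
    h.toLinearMap ∘ₗ conv f g = conv (h.toLinearMap ∘ₗ f) (h.toLinearMap ∘ₗ g) :=
  LinearMap.algHom_comp_convMul_distrib h (WithConv.toConv f) (WithConv.toConv g)

theorem conv_comp_coalgHom {D : ConnCoalg R} {B : Type u} [Ring B] [Algebra R B]
    (f g : D.carrier →ₗ[R] B) (h : C.carrier →ₗc[R] D.carrier) :
    conv f g ∘ₗ h.toLinearMap = conv (f ∘ₗ h.toLinearMap) (g ∘ₗ h.toLinearMap) :=
  LinearMap.convMul_comp_coalgHom_distrib (WithConv.toConv f) (WithConv.toConv g) h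

theorem comul_zero {x : C.carrier} (hx : x ∈ C.grading 0) :
    ∃ e ∈ C.grading 0, Coalgebra.counit (R := R) e = 1 ∧
      x = Coalgebra.counit (R := R) x • e ∧
      Coalgebra.comul (R := R) x = Coalgebra.counit (R := R) x • (e ⊗ₜ[R] e) := by
  obtain ⟨⟨e, he⟩, he1⟩ := C.connected.2 1
  have he1 : Coalgebra.counit (R := R) e = 1 := he1
  have hs : ∀ y ∈ C.grading 0, y = Coalgebra.counit (R := R) y • e := by
    intro y hy
    have := @C.connected.1 ⟨y, hy⟩ ⟨Coalgebra.counit (R := R) y • e, Submodule.smul_mem _ _ he⟩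
      (by simp [he1])
    exact congrArg Subtype.val this
  have hc : ∃ c : R, Coalgebra.comul (R := R) x = c • (e ⊗ₜ[R] e) := by
    have h := C.comul_mem 0 x hx
    generalize Coalgebra.comul (R := R) x = d at h ⊢
    induction h using Submodule.span_induction with
    | mem t ht =>
      obtain ⟨p, q, hpq, y, hy, z, hz, rfl⟩ := ht
      obtain ⟨rfl, rfl⟩ : p = 0 ∧ q = 0 := by omega
      rw [hs y hy, hs z hz]
      exact ⟨Coalgebra.counit (R := R) y * Coalgebra.counit (R := R) z,
        by rw [TensorProduct.smul_tmul_smul]⟩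
    | zero => exact ⟨0, by simp⟩
    | add a b _ _ ha hb =>
      obtain ⟨r, rfl⟩ := ha
      obtain ⟨s, rfl⟩ := hb
      exact ⟨r + s, by rw [add_smul]⟩
    | smul r a _ ha =>
      obtain ⟨s, rfl⟩ := ha
      exact ⟨r * s, by rw [mul_smul]⟩
  obtain ⟨c, hc⟩ := hc
  have h1 := Coalgebra.rTensor_counit_comul (R := R) x
  rw [hc] at h1
  simp only [map_smul, LinearMap.rTensor_tmul, he1] at h1
  have h2 := congrArg (TensorProduct.lid R C.carrier) h1
  simp only [map_smul, TensorProduct.lid_tmul, one_smul] at h2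
  have h3 : Coalgebra.counit (R := R) x = c := by
    rw [← h2, map_smul, he1, smul_eq_mul, mul_one]
  exact ⟨e, he, he1, hs x hx, by rw [h3, hc]⟩

/-- The convolution product of two elements of `G(C, B)` lies in `G(C, B)`. -/
theorem IsG.conv {B : ConnAlg R} {f g : C.carrier →ₗ[R] B.carrier} (hf : IsG B f) (hg : IsG B g) :
    IsG B (conv f g) where
  map_mem n x hx := by
    have h := C.comul_mem n x hx
    rw [ConnCoalg.conv, LinearMap.comp_apply, LinearMap.comp_apply]
    generalize Coalgebra.comul (R := R) x = d at h ⊢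
    induction h using Submodule.span_induction with
    | mem t ht =>
      obtain ⟨p, q, rfl, y, hy, z, hz, rfl⟩ := ht
      rw [TensorProduct.map_tmul, LinearMap.mul'_apply]
      exact SetLike.mul_mem_graded (hf.map_mem _ _ hy) (hg.map_mem _ _ hz)
    | zero => rw [_root_.map_zero, _root_.map_zero]; exact zero_mem _
    | add a b _ _ ha hb => rw [map_add, map_add]; exact add_mem ha hb
    | smul r a _ ha => rw [map_smul, map_smul]; exact Submodule.smul_mem _ _ ha
  map_zero x hx := by
    obtain ⟨e, he, he1, _, hx2⟩ := comul_zero hx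
    rw [ConnCoalg.conv, LinearMap.comp_apply, LinearMap.comp_apply, hx2, map_smul, map_smul,
      TensorProduct.map_tmul, LinearMap.mul'_apply, hf.map_zero e he, hg.map_zero e he, he1,
      map_one, one_mul, Algebra.algebraMap_eq_smul_one]

theorem IsG.comp {A B : ConnAlg R} {f : C.carrier →ₗ[R] A.carrier} (hf : IsG A f) (g : A ⟶ B) :
    IsG B ((ConnAlg.Hom.toAlgHom g).toLinearMap ∘ₗ f) where
  map_mem n x hx := g.map_mem _ _ (hf.map_mem n x hx)
  map_zero x hx := by
    rw [LinearMap.comp_apply, hf.map_zero x hx]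
    exact AlgHom.commutes _ _

theorem IsG.comp_coalgHom {D : ConnCoalg R} {B : ConnAlg R} {f : D.carrier →ₗ[R] B.carrier}
    (hf : IsG B f) (g : C ⟶ D) : IsG B (f ∘ₗ (Hom.toCoalgHom g).toLinearMap) where
  map_mem n x hx := hf.map_mem n _ (g.map_mem n x hx)
  map_zero x hx := by
    have h : Coalgebra.counit (R := R) (g.toCoalgHom x) = Coalgebra.counit (R := R) x :=
      CoalgHomClass.counit_comp_apply g.toCoalgHom x
    rw [← h]
    exact hf.map_zero _ (g.map_mem 0 x hx)

variable (C)

/-- The canonical element of `G(C, T)` for the tensor algebra `T` on the positive part of `C`: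
the identity of `R` in degree zero, the inclusion of generators in positive degrees. -/
def gen : C.carrier →ₗ[R] C.tensor.carrier :=
  (Algebra.linearMap R (TensorAlgebra R C.pos) ∘ₗ Coalgebra.counit +
    TensorAlgebra.ι R ∘ₗ C.projPos : C.carrier →ₗ[R] TensorAlgebra R C.pos)

theorem gen_apply (x : C.carrier) :
    C.gen x = (algebraMap R (TensorAlgebra R C.pos) (Coalgebra.counit (R := R) x) +
      TensorAlgebra.ι R (C.projPos x) : TensorAlgebra R C.pos) := rfl

theorem isG_gen : IsG C.tensor C.gen where
  map_mem n x hx := by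
    refine add_mem (S := Submodule R C.tensor.carrier) (s := C.tensor.grading n) ?_ (C.ι_mem hx)
    by_cases h : n = 0
    · subst h
      exact SetLike.algebraMap_mem_graded C.tensor.grading _
    · have h' : algebraMap R (TensorAlgebra R C.pos) (Coalgebra.counit (R := R) x) = 0 := by
        rw [C.counit_eq_zero n x h hx, map_zero]
      exact Eq.mpr (congrArg (· ∈ piece C.tensorDeg n) h') (zero_mem _)
  map_zero x hx := by
    rw [gen_apply, C.projPos_zero hx, _root_.map_zero, add_zero]
    rfl

theorem counit_pos (x : C.pos) : Coalgebra.counit (R := R) (x : C.carrier) = 0 := by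
  have key : ∀ c : C.carrier,
      Coalgebra.counit (R := R) (c - C.projZero c) = 0 := by
    intro c
    induction c using DirectSum.Decomposition.inductionOn C.grading with
    | zero => simp
    | @homogeneous i m =>
      by_cases h : i = 0
      · subst h
        rw [C.projZero_zero m.2, sub_self, map_zero]
      · rw [C.projZero_of_mem h m.2, sub_zero, C.counit_eq_zero i _ h m.2]
    | add a b ha hb => rw [map_add, add_sub_add_comm, map_add, ha, hb, add_zero]
  have h : C.projZero x = 0 := x.2
  have := key x
  rwa [h, sub_zero] at this

theorem gen_coe (x : C.pos) : C.gen x = (TensorAlgebra.ι R x : TensorAlgebra R C.pos) := by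
  rw [gen_apply, C.counit_pos, map_zero, zero_add, projPos_coe]

variable {C}

/-- The homomorphism of graded algebras from the tensor algebra which extends an element of
`G(C, B)`. -/
def extend {B : ConnAlg R} (f : C.carrier →ₗ[R] B.carrier) (hf : IsG B f) : C.tensor ⟶ B where
  toAlgHom := TensorAlgebra.lift R (f ∘ₗ C.pos.subtype)
  map_mem := map_mem_of_gen _ C.tensorGens C.adjoin_tensorGens _ _ (by
    rintro _ ⟨n, c, hc, rfl⟩
    refine ⟨n, C.ι_mem hc, ?_⟩
    rw [TensorAlgebra.lift_ι_apply, LinearMap.comp_apply, Submodule.subtype_apply]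
    by_cases h : n = 0
    · subst h
      rw [C.projPos_zero hc, Submodule.coe_zero, map_zero]
      exact zero_mem _
    · rw [coe_projPos, C.projZero_of_mem h hc, sub_zero]
      exact hf.map_mem n c hc)

theorem extend_gen {B : ConnAlg R} (f : C.carrier →ₗ[R] B.carrier) (hf : IsG B f) :
    (ConnAlg.Hom.toAlgHom (extend f hf)).toLinearMap ∘ₗ C.gen = f := by
  ext x
  have h1 : TensorAlgebra.lift R (f ∘ₗ C.pos.subtype)
      (algebraMap R (TensorAlgebra R C.pos) (Coalgebra.counit (R := R) x) +
        TensorAlgebra.ι R (C.projPos x)) = f x := by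
    have h0 := hf.map_zero _ (C.projZero_mem x)
    have h2 := C.counit_pos (C.projPos x)
    rw [coe_projPos, map_sub, sub_eq_zero] at h2
    rw [map_add, AlgHom.commutes, TensorAlgebra.lift_ι_apply, LinearMap.comp_apply,
      Submodule.subtype_apply, coe_projPos, map_sub, h0, ← h2, add_sub_cancel]
  exact h1

theorem tensor_hom_ext {B : ConnAlg R} {f g : C.tensor ⟶ B}
    (h : (ConnAlg.Hom.toAlgHom f).toLinearMap ∘ₗ C.gen =
      (ConnAlg.Hom.toAlgHom g).toLinearMap ∘ₗ C.gen) : f = g := by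
  refine ConnAlg.hom_ext (TensorAlgebra.hom_ext (LinearMap.ext fun x => ?_))
  have := DFunLike.congr_fun h (x : C.carrier)
  simp only [LinearMap.comp_apply, gen_coe] at this
  exact this

variable (C)

/-- The comultiplication of the tensor algebra, which corresponds to the convolution product of
the two copies of the canonical element: on the positive part it is
`x ↦ x' + x'' + ∑ y' z''` if `Δ x = x ⊗ 1 + 1 ⊗ x + ∑ y ⊗ z`. -/
def tensorComul : C.tensor ⟶ ConnAlg.coprod C.tensor C.tensor :=
  extend (conv ((ConnAlg.Hom.toAlgHom (ConnAlg.inl C.tensor C.tensor)).toLinearMap ∘ₗ C.gen)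
      ((ConnAlg.Hom.toAlgHom (ConnAlg.inr C.tensor C.tensor)).toLinearMap ∘ₗ C.gen))
    ((C.isG_gen.comp _).conv (C.isG_gen.comp _))

theorem tensorComul_gen {B : ConnAlg R} (k : ConnAlg.coprod C.tensor C.tensor ⟶ B) :
    (ConnAlg.Hom.toAlgHom (C.tensorComul ≫ k)).toLinearMap ∘ₗ C.gen =
      conv ((ConnAlg.Hom.toAlgHom (ConnAlg.inl C.tensor C.tensor ≫ k)).toLinearMap ∘ₗ C.gen)
        ((ConnAlg.Hom.toAlgHom (ConnAlg.inr C.tensor C.tensor ≫ k)).toLinearMap ∘ₗ C.gen) := by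
  rw [ConnAlg.comp_toAlgHom, AlgHom.comp_toLinearMap, LinearMap.comp_assoc, tensorComul,
    extend_gen, algHom_comp_conv]
  rfl

theorem triv_gen (B : ConnAlg R) :
    (ConnAlg.Hom.toAlgHom (ConnAlg.triv C.tensor B)).toLinearMap ∘ₗ C.gen =
      Algebra.linearMap R B.carrier ∘ₗ Coalgebra.counit := by
  ext x
  change algebraMap R B.carrier (C.tensor.aug (C.gen x)) = algebraMap R B.carrier _
  congr 1
  induction x using DirectSum.Decomposition.inductionOn C.grading with
  | zero => simp
  | @homogeneous i m =>
    by_cases h : i = 0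
    · subst h
      rw [C.isG_gen.map_zero _ m.2, AlgHom.commutes]
      rfl
    · rw [C.tensor.aug_of_mem h (C.isG_gen.map_mem _ _ m.2), C.counit_eq_zero _ _ h m.2]
  | add a b ha hb => rw [map_add, map_add, ha, hb, map_add]

/-- The comonoid `T_CM(C)`. -/
def tensorComon : AlgComon R where
  toConnAlg := C.tensor
  comul := C.tensorComul
  counit_left := tensor_hom_ext (by
    rw [tensorComul_gen, ConnAlg.inl_desc, ConnAlg.inr_desc, triv_gen, one_conv])
  counit_right := tensor_hom_ext (by
    rw [tensorComul_gen, ConnAlg.inl_desc, ConnAlg.inr_desc, triv_gen, conv_one])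
  coassoc := by
    apply tensor_hom_ext
    rw [tensorComul_gen, tensorComul_gen]
    simp only [ConnAlg.coprodMap, Category.id_comp, ConnAlg.coprodAssoc, ConnAlg.inl_desc,
      ConnAlg.inr_desc, ← Category.assoc]
    simp only [Category.assoc, ConnAlg.inl_desc]
    rw [tensorComul_gen, tensorComul_gen, ConnAlg.inl_desc, ConnAlg.inr_desc, conv_assoc]

variable {C}

/-- The homomorphism of tensor algebras induced by a homomorphism of coalgebras. -/
def tensorMap {D : ConnCoalg R} (f : C ⟶ D) : C.tensor ⟶ D.tensor :=
  extend (D.gen ∘ₗ (Hom.toCoalgHom f).toLinearMap) (D.isG_gen.comp_coalgHom f)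

theorem tensorMap_gen {D : ConnCoalg R} (f : C ⟶ D) :
    (ConnAlg.Hom.toAlgHom (tensorMap f)).toLinearMap ∘ₗ C.gen =
      D.gen ∘ₗ (Hom.toCoalgHom f).toLinearMap :=
  extend_gen _ _

theorem tensorMap_comp_gen {D : ConnCoalg R} (f : C ⟶ D) {B : ConnAlg R} (k : D.tensor ⟶ B) :
    (ConnAlg.Hom.toAlgHom (tensorMap f ≫ k)).toLinearMap ∘ₗ C.gen =
      ((ConnAlg.Hom.toAlgHom k).toLinearMap ∘ₗ D.gen) ∘ₗ (Hom.toCoalgHom f).toLinearMap := by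
  rw [ConnAlg.comp_toAlgHom, AlgHom.comp_toLinearMap, LinearMap.comp_assoc, tensorMap_gen,
    LinearMap.comp_assoc]

theorem tensorMap_comul {D : ConnCoalg R} (f : C ⟶ D) :
    C.tensorComul ≫ ConnAlg.coprodMap (tensorMap f) (tensorMap f) =
      tensorMap f ≫ D.tensorComul := by
  apply tensor_hom_ext
  rw [tensorComul_gen, ConnAlg.coprodMap, ConnAlg.inl_desc, ConnAlg.inr_desc, tensorMap_comp_gen,
    tensorMap_comp_gen, tensorMap_comp_gen, ← conv_comp_coalgHom, tensorComul, extend_gen]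

end ConnCoalg

/-- The functor `T_CM` from connected graded coalgebras to comonoids in connected graded algebras:
the tensor algebra on the positive part. -/
def tensorFunctor (R : Type u) [CommRing R] : ConnCoalg R ⥤ AlgComon R where
  obj C := C.tensorComon
  map f := ⟨ConnCoalg.tensorMap f, ConnCoalg.tensorMap_comul f⟩
  map_id C := by
    have h : ConnCoalg.tensorMap (𝟙 C) = 𝟙 C.tensor :=
      ConnCoalg.tensor_hom_ext ((ConnCoalg.tensorMap_gen _).trans rfl)
    exact AlgComon.hom_ext h
  map_comp {C D E} f g := by
    have h : ConnCoalg.tensorMap (f ≫ g) = ConnCoalg.tensorMap f ≫ ConnCoalg.tensorMap g := by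
      apply ConnCoalg.tensor_hom_ext
      rw [ConnCoalg.tensorMap_comp_gen, ConnCoalg.tensorMap_gen, ConnCoalg.tensorMap_gen]
      rfl
    exact AlgComon.hom_ext h

/-! ## Positively graded modules -/

/-- A positively graded `R`-module: a graded module whose part of degree zero vanishes. -/
structure PosGrMod (R : Type u) [CommRing R] where
  carrier : Type u
  [addCommGroup : AddCommGroup carrier]
  [module : Module R carrier]
  grading : ℕ → Submodule R carrier
  [decomposition : DirectSum.Decomposition grading]
  grading_zero : grading 0 = ⊥

attribute [instance] PosGrMod.addCommGroup PosGrMod.module PosGrMod.decomposition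

namespace PosGrMod

variable {R : Type u} [CommRing R]

/-- A homomorphism of graded modules. -/
@[ext]
structure Hom (M N : PosGrMod R) where
  toLinearMap : M.carrier →ₗ[R] N.carrier
  map_mem : ∀ (n : ℕ) (x : M.carrier), x ∈ M.grading n → toLinearMap x ∈ N.grading n

/-- The category `ℳ` of positively graded modules. -/
instance : Category (PosGrMod R) where
  Hom := Hom
  id M := ⟨LinearMap.id, fun _ _ h => h⟩
  comp f g := ⟨g.toLinearMap ∘ₗ f.toLinearMap, fun n x h => g.map_mem n _ (f.map_mem n x h)⟩

@[ext]
theorem hom_ext {M N : PosGrMod R} {f g : M ⟶ N} (h : Hom.toLinearMap f = Hom.toLinearMap g) :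
    f = g :=
  Hom.ext h

variable (R) in
/-- The graded module `R[n]`, with `R` in degree `n > 0` and zero elsewhere. -/
def shift (n : ℕ) (hn : 0 < n) : PosGrMod R where
  carrier := R
  grading k := if k = n then ⊤ else ⊥
  decomposition := DirectSum.Decomposition.ofLinearMap _
    (DirectSum.lof R ℕ (fun k => ((if k = n then ⊤ else ⊥ : Submodule R R))) n ∘ₗ
      LinearMap.codRestrict _ LinearMap.id (fun x => by simp))
    (by ext; simp)
    (by
      ext i ⟨x, hx⟩ : 2
      by_cases hi : i = n
      · subst hi
        simp [LinearMap.codRestrict]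
      · simp only [hi, if_false, Submodule.mem_bot] at hx
        subst hx
        have : (⟨0, hx⟩ : ((if i = n then ⊤ else ⊥ : Submodule R R))) = 0 := rfl
        rw [this, map_zero, map_zero])
  grading_zero := if_neg hn.ne

variable (R) in
/-- `𝒮`: the locally at most singly generated modules. For every maximal ideal `𝔪`, the
localization `N_𝔪` (computed degree by degree) is isomorphic to `0` or to `(R_𝔪 / 𝔞_𝔪)[n]` for
some ideal `𝔞 ⊆ 𝔪` and some `n`, where `n` is even if the characteristic of `R_𝔪 / 𝔞_𝔪` is
not `2`. -/
def locallySinglyGenerated : ObjectProperty (PosGrMod R) := fun N =>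
  ∀ (m : Ideal R) [m.IsMaximal],
    (∀ k, Subsingleton (LocalizedModule m.primeCompl (N.grading k))) ∨
    ∃ (a : Ideal R) (n : ℕ), a ≤ m ∧
      (ringChar (Localization.AtPrime m ⧸ a.map (algebraMap R (Localization.AtPrime m))) ≠ 2 →
        Even n) ∧
      Nonempty (LocalizedModule m.primeCompl (N.grading n) ≃ₗ[Localization.AtPrime m]
        (Localization.AtPrime m ⧸ a.map (algebraMap R (Localization.AtPrime m)))) ∧
      ∀ k, k ≠ n → Subsingleton (LocalizedModule m.primeCompl (N.grading k))

variable (R) in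
/-- `𝒮^ft`: the objects of `𝒮` of finite type, that is, finitely generated in every degree. -/
def locallySinglyGeneratedFT : ObjectProperty (PosGrMod R) := fun N =>
  locallySinglyGenerated R N ∧ ∀ n, (N.grading n).FG

variable (R) in
/-- `ℱ`: the modules isomorphic to one of `0`, `R[1]`, `R[2]`, … if the characteristic of `R` is
`2`, and to one of `0`, `R[2]`, `R[4]`, … otherwise. -/
def basic : ObjectProperty (PosGrMod R) := fun N =>
  Subsingleton N.carrier ∨
    ∃ (n : ℕ) (hn : 0 < n), (ringChar R ≠ 2 → Even n) ∧ Nonempty (N ≅ shift R n hn)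

/-! ### The coalgebra with trivial coproduct -/

variable (N : PosGrMod R)

/-- The coalgebra structure on `R ⊕ N` with `Δ 1 = 1 ⊗ 1` and `Δ x = x ⊗ 1 + 1 ⊗ x` for `x ∈ N`. -/
@[reducible]
def trivialCoalgebra : Coalgebra R (R × N.carrier) where
  comul :=
    LinearMap.coprod (LinearMap.toSpanSingleton R _ ((1, 0) ⊗ₜ[R] (1, 0)))
      ((TensorProduct.mk R (R × N.carrier) (R × N.carrier)).flip (1, 0) ∘ₗ LinearMap.inr R _ _ +
        (TensorProduct.mk R (R × N.carrier) (R × N.carrier)) (1, 0) ∘ₗ LinearMap.inr R _ _)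
  counit := LinearMap.fst R R N.carrier
  coassoc := by
    have h0 : ((0 : R), (0 : N.carrier)) = 0 := rfl
    ext
    · simp [h0]
    · simp [h0, TensorProduct.add_tmul, TensorProduct.tmul_add, add_assoc]
  rTensor_counit_comp_comul := by
    have h0 : ((0 : R), (0 : N.carrier)) = 0 := rfl
    ext <;> simp [h0]
  lTensor_counit_comp_comul := by
    have h0 : ((0 : R), (0 : N.carrier)) = 0 := rfl
    ext <;> simp [h0]

theorem trivialCoalgebra_comul (x : R × N.carrier) :
    N.trivialCoalgebra.comul x = x.1 • ((1, 0) ⊗ₜ[R] (1, 0)) +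
      ((0, x.2) ⊗ₜ[R] (1, 0) + (1, 0) ⊗ₜ[R] (0, x.2)) := by
  change LinearMap.coprod _ _ x = _
  rw [LinearMap.coprod_apply]
  rfl

/-- The grading of `R ⊕ N` with `R` in degree zero. -/
def trivialGrading (n : ℕ) : Submodule R (R × N.carrier) :=
  (if n = 0 then ⊤ else ⊥ : Submodule R R).prod (N.grading n)

instance : DirectSum.Decomposition N.trivialGrading :=
  DirectSum.Decomposition.ofLinearMap _
    (LinearMap.coprod
      (DirectSum.lof R ℕ (fun n => N.trivialGrading n) 0 ∘ₗ
        LinearMap.codRestrict _ (LinearMap.inl R R N.carrier) (fun r => by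
          simp [trivialGrading]))
      (DirectSum.toModule R ℕ _ (fun n =>
        DirectSum.lof R ℕ (fun n => N.trivialGrading n) n ∘ₗ
          LinearMap.codRestrict _ (LinearMap.inr R R N.carrier ∘ₗ (N.grading n).subtype)
            (fun x => by simp [trivialGrading])) ∘ₗ
        (DirectSum.decomposeLinearEquiv N.grading).toLinearMap))
    (by
      ext x : 2
      · simp
        rfl
      · simp only [LinearMap.comp_apply, LinearMap.coe_inr, LinearMap.coprod_apply, map_zero,
          zero_add, LinearEquiv.coe_coe, LinearMap.id_apply]
        induction x using DirectSum.Decomposition.inductionOn N.grading with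
        | zero => rw [map_zero, map_zero, map_zero]; rfl
        | @homogeneous i m => simp; rfl
        | add a b ha hb =>
          rw [map_add, map_add, map_add, ha, hb, Prod.mk_add_mk, add_zero])
    (by
      ext i ⟨⟨r, y⟩, hx⟩ : 2
      obtain ⟨hr, hy⟩ := Submodule.mem_prod.1 hx
      simp only at hr hy
      by_cases hi : i = 0
      · subst hi
        have hy0 : y = 0 := by rwa [N.grading_zero, Submodule.mem_bot] at hy
        subst hy0
        simp [LinearMap.codRestrict]
      · rw [if_neg hi, Submodule.mem_bot] at hr
        subst hr
        lift y to N.grading i using hy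
        simp only [LinearMap.comp_apply, LinearMap.coprod_apply, DirectSum.lof_eq_of,
          DirectSum.coeLinearMap_of, LinearEquiv.coe_coe, LinearMap.id_apply, map_zero, zero_add,
          DirectSum.decomposeLinearEquiv_apply_coe]
        rw [← DirectSum.lof_eq_of R, DirectSum.toModule_lof]
        rfl)

/-- The connected graded coalgebra `C(N)`. -/
def trivialCoalg : ConnCoalg R where
  carrier := R × N.carrier
  coalgebra := N.trivialCoalgebra
  grading := N.trivialGrading
  comul_mem n x hx := by
    obtain ⟨r, y⟩ := x
    obtain ⟨hr, hy⟩ := Submodule.mem_prod.1 hx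
    simp only at hr hy
    have h1 : ((1, 0) : R × N.carrier) ∈ N.trivialGrading 0 := by simp [trivialGrading]
    refine Eq.mpr (congrArg (· ∈ Submodule.span R _) (N.trivialCoalgebra_comul (r, y))) ?_
    by_cases hn : n = 0
    · subst hn
      have hy0 : y = 0 := by rwa [N.grading_zero, Submodule.mem_bot] at hy
      subst hy0
      have h0 : ((0 : R), (0 : N.carrier)) = 0 := rfl
      rw [h0, TensorProduct.zero_tmul, TensorProduct.tmul_zero, add_zero, add_zero]
      exact Submodule.smul_mem _ _ (Submodule.subset_span ⟨0, 0, rfl, _, h1, _, h1, rfl⟩)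
    · rw [if_neg hn, Submodule.mem_bot] at hr
      subst hr
      rw [zero_smul, zero_add]
      have h2 : ((0, y) : R × N.carrier) ∈ N.trivialGrading n := by
        simp [trivialGrading, hy]
      exact add_mem (Submodule.subset_span ⟨n, 0, rfl, _, h2, _, h1, rfl⟩)
        (Submodule.subset_span ⟨0, n, zero_add n, _, h1, _, h2, rfl⟩)
  counit_eq_zero n x hn hx := by
    have hr := (Submodule.mem_prod.1 hx).1
    rw [if_neg hn, Submodule.mem_bot] at hr
    exact hr
  connected := by
    constructor
    · rintro ⟨⟨r, y⟩, hx⟩ ⟨⟨r', y'⟩, hx'⟩ h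
      have hy := (Submodule.mem_prod.1 hx).2
      have hy' := (Submodule.mem_prod.1 hx').2
      rw [N.grading_zero, Submodule.mem_bot] at hy hy'
      exact Subtype.ext (Prod.ext h (hy.trans hy'.symm))
    · intro r
      exact ⟨⟨(r, 0), by simp [trivialGrading]⟩, rfl⟩

end PosGrMod

/-- The functor `C` from positively graded modules to connected graded coalgebras. -/
def trivialFunctor (R : Type u) [CommRing R] : PosGrMod R ⥤ ConnCoalg R where
  obj N := N.trivialCoalg
  map {M N} f :=
    { toCoalgHom :=
        { toLinearMap := LinearMap.prodMap (LinearMap.id : R →ₗ[R] R) (PosGrMod.Hom.toLinearMap f)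
          counit_comp := rfl
          map_comp_comul := by
            refine LinearMap.ext fun x => ?_
            refine (congrArg (TensorProduct.map
              (LinearMap.prodMap (LinearMap.id : R →ₗ[R] R) (PosGrMod.Hom.toLinearMap f))
              (LinearMap.prodMap (LinearMap.id : R →ₗ[R] R) (PosGrMod.Hom.toLinearMap f)))
              (M.trivialCoalgebra_comul x)).trans ?_
            refine Eq.trans ?_ (N.trivialCoalgebra_comul _).symm
            simp
            rfl }
      map_mem := fun n x hx =>
        Submodule.mem_prod.2 ⟨(Submodule.mem_prod.1 hx).1,
          f.map_mem n _ (Submodule.mem_prod.1 hx).2⟩ }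
  map_id N := rfl
  map_comp f g := rfl

end CogroupAlg

end

open CogroupAlg

noncomputable section
namespace CogroupAlg

/-! ## Convolution inverses -/

namespace ConnCoalg

variable {R : Type u} [CommRing R] {C : ConnCoalg R}

/-! For a comonoid `A` and an arbitrary ungraded algebra `Q`, the algebra homomorphisms `A → Q` form
a monoid under `star`, naturally in `Q`. As `Q` need not be commutative, matrix algebras are
allowed, and homomorphisms into matrices act like a finite automaton which reads the words of `A ∗
A` letter by letter and extracts those of a prescribed shape. Most facts about comonoids below come
from a choice of idempotent matrices together with the associativity of `star`.

The words in which letters of the second factor precede letters of the first define a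
deconcatenation `dec : A → A ⊗ A`. It is coassociative (`dec_coassoc`) and computes `star f g`
whenever `f` times `g` vanishes on the augmentation ideal (`star_eq_dec`). A geometric series,
finite in each degree, gives the convolution inverse `antip` of the identity, and its values are
primitive for `dec` (`antip_mem_prim`). In a tensor algebra `antip` kills the words of length at
least two, so up to sign and scalars it is the projection onto the generators. In a general comonoid
the primitive elements are therefore the candidates for generators.

On a primitive element the comultiplication is a sum of products `y' z''`
(`mulMap_tcomul_eq_comul`), and `y`, `z` can be taken primitive (`map_primProj_tcomul`). Hence the
primitive elements form a connected coalgebra `P`, and the canonical map `T_CM(P) → A` is bijective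
(`ofPrim_bijective`): its inverse is the convolution inverse of `antip` lifted to the generators.
Conversely, the primitive elements of `T_CM(C)` are exactly `C` (`mem_range_tgen`), which gives full
faithfulness. The geometric series also produces the cogroup inverse on `T_CM(C)`
(`tensorComon_cogroup`).

The other columns translate extra conditions on `A` into conditions on `P`. Cocommutativity of the
underlying coalgebra is that of `P` (`coalgCocomm_tensorComon_iff`). Cocommutativity of the cogroup
makes `star` commutative for all `Q`, and the matrices which define `dec` then show that the reduced
comultiplication of `P` vanishes (`comul_eq_of_cocomm`). Graded commutativity of the algebra gives
`x ⊗ y = ± y ⊗ x` for generators, since `decBar` reads a product of two generators as their tensor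
(`symmTensor_of_isGradedCommutative`). For finitely generated components Nakayama's lemma at each
maximal ideal leaves at most one degree, cyclic, and killed by `2` if the degree is odd
(`locallySinglyGenerated_of_symm`). Distinct degrees then have comaximal annihilators, so the
reduced comultiplication vanishes (`redComul_eq_zero`). Over a field the symmetry of tensors alone
bounds each dimension by one (`SymmTensor.fg`), so no finiteness hypothesis is needed. -/

theorem conv_mem {B : Type u} [Ring B] [Algebra R B] {f g : C.carrier →ₗ[R] B}
    {S : Submodule R B} {n : ℕ}
    (h : ∀ p q, p + q = n → ∀ y ∈ C.grading p, ∀ z ∈ C.grading q, f y * g z ∈ S)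
    {x : C.carrier} (hx : x ∈ C.grading n) : conv f g x ∈ S := by
  have h' := C.comul_mem n x hx
  rw [conv, LinearMap.comp_apply, LinearMap.comp_apply]
  generalize Coalgebra.comul (R := R) x = d at h' ⊢
  induction h' using Submodule.span_induction with
  | mem t ht =>
    obtain ⟨p, q, hpq, y, hy, z, hz, rfl⟩ := ht
    rw [TensorProduct.map_tmul, LinearMap.mul'_apply]
    exact h p q hpq y hy z hz
  | zero => rw [map_zero, map_zero]; exact zero_mem _
  | add a b _ _ ha hb => rw [map_add, map_add]; exact add_mem ha hb
  | smul r a _ ha => rw [map_smul, map_smul]; exact Submodule.smul_mem _ _ ha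

/-- In degree `n` a convolution only sees its factors in degrees at most `n`. This permits replacing
the infinite geometric series by a partial sum. -/
theorem conv_congr {B : Type u} [Ring B] [Algebra R B] {f g f' g' : C.carrier →ₗ[R] B} {n : ℕ}
    (h : ∀ p q, p + q = n → ∀ y ∈ C.grading p, ∀ z ∈ C.grading q, f y * g z = f' y * g' z)
    {x : C.carrier} (hx : x ∈ C.grading n) : conv f g x = conv f' g' x := by
  have h' := C.comul_mem n x hx
  simp only [conv, LinearMap.comp_apply]
  generalize Coalgebra.comul (R := R) x = d at h' ⊢
  induction h' using Submodule.span_induction with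
  | mem t ht =>
    obtain ⟨p, q, hpq, y, hy, z, hz, rfl⟩ := ht
    simp only [TensorProduct.map_tmul, LinearMap.mul'_apply]
    exact h p q hpq y hy z hz
  | zero => simp only [map_zero]
  | add a b _ _ ha hb => simp only [map_add, ha, hb]
  | smul r a _ ha => simp only [map_smul, ha]

/-- The unit of the convolution algebra. -/
def convUnit (C : ConnCoalg R) (B : Type u) [Ring B] [Algebra R B] : C.carrier →ₗ[R] B :=
  Algebra.linearMap R B ∘ₗ Coalgebra.counit

theorem convUnit_apply (B : Type u) [Ring B] [Algebra R B] (x : C.carrier) :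
    convUnit C B x = algebraMap R B (Coalgebra.counit (R := R) x) := rfl

theorem hom_ext_grading {M : Type u} [AddCommGroup M] [Module R M] {f g : C.carrier →ₗ[R] M}
    (h : ∀ n, ∀ x ∈ C.grading n, f x = g x) : f = g := by
  ext x
  induction x using DirectSum.Decomposition.inductionOn C.grading with
  | zero => rw [map_zero, map_zero]
  | homogeneous m => exact h _ m m.2
  | add a b ha hb => rw [map_add, map_add, ha, hb]

/-! ### Geometric series in the convolution algebra -/

section Inverse

variable {B : ConnAlg R} (f : C.carrier →ₗ[R] B.carrier)

/-- The powers of `1 - f` in the convolution algebra. -/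
def defectPow (k : ℕ) : C.carrier →ₗ[R] B.carrier := ((1 - WithConv.toConv f) ^ k).ofConv

theorem defectPow_zero : defectPow f 0 = convUnit C B.carrier := by
  rw [defectPow, pow_zero]; rfl

theorem defectPow_one : defectPow f 1 = convUnit C B.carrier - f := by
  rw [defectPow, pow_one]; rfl

theorem defectPow_succ (k : ℕ) :
    defectPow f (k + 1) = conv (defectPow f k) (defectPow f 1) := by
  rw [defectPow, pow_succ, conv_eq, defectPow, defectPow, pow_one]

variable {f}

theorem isG_convUnit (C : ConnCoalg R) (B : ConnAlg R) : IsG B (convUnit C B.carrier) where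
  map_mem n x hx := by
    rw [convUnit_apply]
    by_cases h : n = 0
    · subst h; exact SetLike.algebraMap_mem_graded _ _
    · rw [C.counit_eq_zero n x h hx, map_zero]; exact zero_mem _
  map_zero _ _ := rfl

theorem defectPow_one_zero (hf : IsG B f) {x : C.carrier} (hx : x ∈ C.grading 0) :
    defectPow f 1 x = 0 := by
  rw [defectPow_one, LinearMap.sub_apply, hf.map_zero x hx, convUnit_apply, sub_self]

theorem defectPow_mem (hf : IsG B f) (k : ℕ) :
    ∀ n, ∀ x ∈ C.grading n, defectPow f k x ∈ B.grading n := by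
  induction k with
  | zero => rw [defectPow_zero]; exact (isG_convUnit C B).map_mem
  | succ k ih =>
    intro n x hx
    rw [defectPow_succ]
    refine conv_mem ?_ hx
    rintro p q rfl y hy z hz
    refine SetLike.mul_mem_graded (ih p y hy) ?_
    rw [defectPow_one]
    exact sub_mem ((isG_convUnit C B).map_mem _ _ hz) (hf.map_mem _ _ hz)

/-- The map `1 - f` vanishes in degree zero, so each of the `k` convolution factors uses up at least
one degree. This makes the geometric series finite in every degree. -/
theorem defectPow_eq_zero (hf : IsG B f) (k : ℕ) :
    ∀ n, n < k → ∀ x ∈ C.grading n, defectPow f k x = 0 := by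
  induction k with
  | zero => intro n hn; omega
  | succ k ih =>
    intro n hn x hx
    rw [defectPow_succ]
    refine (Submodule.mem_bot R).1 (conv_mem ?_ hx)
    rintro p q rfl y hy z hz
    rw [Submodule.mem_bot]
    by_cases hq : q = 0
    · subst hq; rw [defectPow_one_zero hf hz, mul_zero]
    · rw [ih p (by omega) y hy, zero_mul]

variable (f)

/-- The partial sums of the geometric series. -/
def geomPart (n : ℕ) : C.carrier →ₗ[R] B.carrier :=
  ∑ k ∈ Finset.range (n + 1), defectPow f k

theorem geomPart_eq (n : ℕ) :
    geomPart f n = (∑ k ∈ Finset.range (n + 1), (1 - WithConv.toConv f) ^ k).ofConv := by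
  rw [geomPart, WithConv.ofConv_sum]; rfl

theorem conv_geomPart (n : ℕ) :
    conv f (geomPart f n) = convUnit C B.carrier - defectPow f (n + 1) := by
  have h := mul_neg_geom_sum (1 - WithConv.toConv f) (n + 1)
  rw [sub_sub_cancel] at h
  rw [conv_eq, geomPart_eq, WithConv.toConv_ofConv, h]
  rfl

theorem geomPart_conv (n : ℕ) :
    conv (geomPart f n) f = convUnit C B.carrier - defectPow f (n + 1) := by
  have h := geom_sum_mul_neg (1 - WithConv.toConv f) (n + 1)
  rw [sub_sub_cancel] at h
  rw [conv_eq, geomPart_eq, WithConv.toConv_ofConv, h]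
  rfl

/-- The convolution inverse, the sum of the geometric series. -/
def convInv : C.carrier →ₗ[R] B.carrier :=
  DirectSum.toModule R ℕ B.carrier (fun n => geomPart f n ∘ₗ (C.grading n).subtype) ∘ₗ
    (DirectSum.decomposeLinearEquiv C.grading).toLinearMap

variable {f}

/-- The terms beyond the degree of `x` vanish, so one truncation `n` serves all degrees `p ≤ n` at
once, as needed for the factors of a coproduct of degree `n`. -/
theorem convInv_apply (hf : IsG B f) {p n : ℕ} (hpn : p ≤ n) {x : C.carrier}
    (hx : x ∈ C.grading p) : convInv f x = geomPart f n x := by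
  have h0 : convInv f x = geomPart f p x := by
    lift x to C.grading p using hx
    simp [convInv]
  rw [h0, geomPart, geomPart, LinearMap.sum_apply, LinearMap.sum_apply]
  refine Finset.sum_subset (Finset.range_mono (by omega)) fun k _ hk => ?_
  rw [Finset.mem_range, not_lt] at hk
  exact defectPow_eq_zero hf k p (by omega) x hx

theorem conv_convInv (hf : IsG B f) : conv f (convInv f) = convUnit C B.carrier := by
  refine hom_ext_grading fun n x hx => ?_
  -- The partial sum telescopes to `1 - (1 - f)^(n+1)`, and the error term is zero in degree `n`.
  rw [conv_congr (f' := f) (g' := geomPart f n) _ hx, conv_geomPart, LinearMap.sub_apply,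
    defectPow_eq_zero hf _ n (by omega) x hx, sub_zero]
  intro p q hpq y _ z hz
  rw [convInv_apply hf (by omega : q ≤ n) hz]

theorem convInv_conv (hf : IsG B f) : conv (convInv f) f = convUnit C B.carrier := by
  refine hom_ext_grading fun n x hx => ?_
  rw [conv_congr (f' := geomPart f n) (g' := f) _ hx, geomPart_conv, LinearMap.sub_apply,
    defectPow_eq_zero hf _ n (by omega) x hx, sub_zero]
  intro p q hpq y hy z _
  rw [convInv_apply hf (by omega : p ≤ n) hy]

theorem isG_convInv (hf : IsG B f) : IsG B (convInv f) where
  map_mem n x hx := by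
    rw [convInv_apply hf le_rfl hx, geomPart, LinearMap.sum_apply]
    exact sum_mem fun k _ => defectPow_mem hf k n x hx
  map_zero x hx := by
    rw [convInv_apply hf le_rfl hx, geomPart, zero_add, Finset.sum_range_one, defectPow_zero,
      convUnit_apply]

end Inverse

/-- The inverse of the cogroup `T_CM(C)`. -/
def tensorInv (C : ConnCoalg R) : C.tensor ⟶ C.tensor :=
  extend (convInv C.gen) (isG_convInv C.isG_gen)

theorem tensorInv_gen (C : ConnCoalg R) :
    (ConnAlg.Hom.toAlgHom C.tensorInv).toLinearMap ∘ₗ C.gen = convInv C.gen := extend_gen _ _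

theorem tensorComul_desc_inv_id (C : ConnCoalg R) :
    C.tensorComul ≫ ConnAlg.desc C.tensorInv (𝟙 C.tensor) = ConnAlg.triv _ _ := by
  apply tensor_hom_ext
  rw [tensorComul_gen, ConnAlg.inl_desc, ConnAlg.inr_desc, triv_gen, tensorInv_gen]
  exact convInv_conv C.isG_gen

theorem tensorComul_desc_id_inv (C : ConnCoalg R) :
    C.tensorComul ≫ ConnAlg.desc (𝟙 C.tensor) C.tensorInv = ConnAlg.triv _ _ := by
  apply tensor_hom_ext
  rw [tensorComul_gen, ConnAlg.inl_desc, ConnAlg.inr_desc, triv_gen, tensorInv_gen]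
  exact conv_convInv C.isG_gen

/-- The comonoid `T_CM(C)` is a cogroup. -/
theorem tensorComon_cogroup (C : ConnCoalg R) : AlgComon.cogroup R C.tensorComon :=
  ⟨C.tensorInv, C.tensorComul_desc_inv_id, C.tensorComul_desc_id_inv⟩

end ConnCoalg

/-! ## Graded modules -/

section Graded

variable {R : Type u} [CommRing R] {M N : Type u} [AddCommGroup M] [Module R M]
  [AddCommGroup N] [Module R N]

/-- A graded linear map commutes with the projections onto the homogeneous parts. -/
theorem coe_decompose_map (ℳ : ℕ → Submodule R M) (𝒩 : ℕ → Submodule R N)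
    [DirectSum.Decomposition ℳ] [DirectSum.Decomposition 𝒩] (f : M →ₗ[R] N)
    (hf : ∀ n, ∀ x ∈ ℳ n, f x ∈ 𝒩 n) (n : ℕ) (x : M) :
    (DirectSum.decompose 𝒩 (f x) n : N) = f (DirectSum.decompose ℳ x n : M) := by
  induction x using DirectSum.Decomposition.inductionOn ℳ with
  | zero => simp
  | @homogeneous i m =>
    by_cases h : i = n
    · subst h
      rw [DirectSum.decompose_of_mem_same _ (hf _ _ m.2), DirectSum.decompose_of_mem_same _ m.2]
    · rw [DirectSum.decompose_of_mem_ne _ (hf _ _ m.2) h, DirectSum.decompose_of_mem_ne _ m.2 h,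
        map_zero]
  | add a b ha hb => simp [DirectSum.decompose_add, ha, hb]

/-- An injective graded linear map reflects degrees. -/
theorem mem_of_map_mem (ℳ : ℕ → Submodule R M) (𝒩 : ℕ → Submodule R N)
    [DirectSum.Decomposition ℳ] [DirectSum.Decomposition 𝒩] (f : M →ₗ[R] N)
    (hf : ∀ n, ∀ x ∈ ℳ n, f x ∈ 𝒩 n) (hi : Function.Injective f) {n : ℕ} {x : M}
    (hx : f x ∈ 𝒩 n) : x ∈ ℳ n := by
  have h := coe_decompose_map ℳ 𝒩 f hf n x
  rw [DirectSum.decompose_of_mem_same _ hx] at h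
  rw [hi h]
  exact SetLike.coe_mem _

/-- The grading of a retract of a graded module. -/
@[reducible]
def retractDecomposition (ℳ : ℕ → Submodule R M) [DirectSum.Decomposition ℳ] (i : N →ₗ[R] M)
    (π : M →ₗ[R] N) (hπi : ∀ x, π (i x) = x) (h : ∀ n, ∀ x ∈ ℳ n, i (π x) ∈ ℳ n) :
    DirectSum.Decomposition fun n => (ℳ n).comap i :=
  DirectSum.Decomposition.ofLinearMap _
    (DirectSum.toModule R ℕ _ (fun n =>
      DirectSum.lof R ℕ (fun n => (ℳ n).comap i) n ∘ₗ
        LinearMap.codRestrict _ (π ∘ₗ (ℳ n).subtype) (fun x => h n x x.2)) ∘ₗ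
      (DirectSum.decomposeLinearEquiv ℳ).toLinearMap ∘ₗ i)
    (by
      -- Stated on all of `M`, and not only on the image of `i`, so that homogeneous components can
      -- be used for the induction.
      have key : ∀ y : M, DirectSum.coeLinearMap (fun n => (ℳ n).comap i)
          (DirectSum.toModule R ℕ _ (fun n =>
            DirectSum.lof R ℕ (fun n => (ℳ n).comap i) n ∘ₗ
              LinearMap.codRestrict _ (π ∘ₗ (ℳ n).subtype) (fun x => h n x x.2))
            (DirectSum.decomposeLinearEquiv ℳ y)) = π y := by
        intro y
        induction y using DirectSum.Decomposition.inductionOn ℳ with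
        | zero => simp only [map_zero]
        | @homogeneous i m => simp [LinearMap.codRestrict]
        | add a b ha hb => simp only [map_add, ha, hb]
      ext x
      exact (key (i x)).trans (hπi x))
    (by
      ext n ⟨x, hx⟩ : 2
      have hx' : i x ∈ ℳ n := hx
      have h2 : DirectSum.decomposeLinearEquiv ℳ (i x) =
        DirectSum.lof R ℕ (fun n => ℳ n) n ⟨i x, hx'⟩ := DirectSum.decompose_of_mem _ hx'
      simp only [LinearMap.comp_apply, DirectSum.lof_eq_of, DirectSum.coeLinearMap_of,
        LinearEquiv.coe_coe, LinearMap.id_apply, h2]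
      rw [← DirectSum.lof_eq_of R, DirectSum.toModule_lof]
      simp only [LinearMap.codRestrict, LinearMap.comp_apply, Submodule.subtype_apply,
        LinearMap.coe_mk, AddHom.coe_mk, hπi]
      rfl)

end Graded

/-! ## Bijective homomorphisms are isomorphisms -/

section Iso

variable {R : Type u} [CommRing R]

/-- A bijective homomorphism of connected graded algebras is an isomorphism. -/
def ConnAlg.isoOfBijective {A B : ConnAlg R} (f : A ⟶ B)
    (h : Function.Bijective (ConnAlg.Hom.toAlgHom f)) : A ≅ B where
  hom := f
  inv := ⟨(AlgEquiv.ofBijective (ConnAlg.Hom.toAlgHom f) h).symm, fun n x hx =>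
    mem_of_map_mem A.grading B.grading (ConnAlg.Hom.toAlgHom f).toLinearMap f.map_mem h.1
      (by
        change (AlgEquiv.ofBijective (ConnAlg.Hom.toAlgHom f) h)
          ((AlgEquiv.ofBijective (ConnAlg.Hom.toAlgHom f) h).symm x) ∈ _
        rwa [AlgEquiv.apply_symm_apply])⟩
  hom_inv_id := ConnAlg.hom_ext (AlgHom.ext
    (AlgEquiv.ofBijective (ConnAlg.Hom.toAlgHom f) h).symm_apply_apply)
  inv_hom_id := ConnAlg.hom_ext (AlgHom.ext
    (AlgEquiv.ofBijective (ConnAlg.Hom.toAlgHom f) h).apply_symm_apply)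

theorem ConnAlg.coprodMap_comp {A B D A' B' D' : ConnAlg R} (f : A ⟶ B) (g : B ⟶ D)
    (f' : A' ⟶ B') (g' : B' ⟶ D') :
    coprodMap f f' ≫ coprodMap g g' = coprodMap (f ≫ g) (f' ≫ g') := by
  refine coprod_hom_ext ?_ ?_
  · simp only [coprodMap, inl_desc, ← Category.assoc]
    simp only [Category.assoc, inl_desc]
  · simp only [coprodMap, inr_desc, ← Category.assoc]
    simp only [Category.assoc, inr_desc]

theorem ConnAlg.coprodMap_id (A B : ConnAlg R) : coprodMap (𝟙 A) (𝟙 B) = 𝟙 _ :=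
  coprod_hom_ext (by simp [coprodMap]) (by simp [coprodMap])

/-- A bijective homomorphism of comonoids is an isomorphism. -/
def AlgComon.isoOfBijective {A B : AlgComon R} (f : A ⟶ B)
    (h : Function.Bijective (ConnAlg.Hom.toAlgHom (AlgComon.Hom.hom f))) : A ≅ B where
  hom := f
  inv := ⟨(ConnAlg.isoOfBijective (AlgComon.Hom.hom f) h).inv, by
    set e := ConnAlg.isoOfBijective (AlgComon.Hom.hom f) h
    have h1 : A.comul ≫ ConnAlg.coprodMap e.hom e.hom = e.hom ≫ B.comul := f.comul_comm
    rw [Iso.eq_inv_comp, ← Category.assoc, ← h1, Category.assoc, ConnAlg.coprodMap_comp,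
      e.hom_inv_id, ConnAlg.coprodMap_id, Category.comp_id]⟩
  hom_inv_id := AlgComon.hom_ext (ConnAlg.isoOfBijective (AlgComon.Hom.hom f) h).hom_inv_id
  inv_hom_id := AlgComon.hom_ext (ConnAlg.isoOfBijective (AlgComon.Hom.hom f) h).inv_hom_id

/-- A bijective homomorphism of connected graded coalgebras is an isomorphism. -/
def ConnCoalg.isoOfBijective {C D : ConnCoalg R} (f : C ⟶ D)
    (h : Function.Bijective (ConnCoalg.Hom.toCoalgHom f)) : C ≅ D where
  hom := f
  inv := ⟨(CoalgEquiv.ofBijective (f := ConnCoalg.Hom.toCoalgHom f) h).symm.toCoalgHom,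
    fun n x hx =>
      mem_of_map_mem C.grading D.grading (ConnCoalg.Hom.toCoalgHom f).toLinearMap f.map_mem h.1
        (by
          change (CoalgEquiv.ofBijective (f := ConnCoalg.Hom.toCoalgHom f) h)
            ((CoalgEquiv.ofBijective (f := ConnCoalg.Hom.toCoalgHom f) h).symm x) ∈ _
          rwa [CoalgEquiv.apply_symm_apply])⟩
  hom_inv_id := ConnCoalg.hom_ext (CoalgHom.ext
    (CoalgEquiv.ofBijective (f := ConnCoalg.Hom.toCoalgHom f) h).symm_apply_apply)
  inv_hom_id := ConnCoalg.hom_ext (CoalgHom.ext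
    (CoalgEquiv.ofBijective (f := ConnCoalg.Hom.toCoalgHom f) h).apply_symm_apply)

end Iso

end CogroupAlg

end

noncomputable section
namespace CogroupAlg

/-! ## The product of algebra homomorphisms defined by a comonoid -/

namespace ConnAlg

variable {R : Type u} [CommRing R]

section CoprodLift

variable {A B D : ConnAlg R} {Q Q' : Type u} [Ring Q] [Algebra R Q] [Ring Q'] [Algebra R Q']

/-- The homomorphism from `A ∗ B` to an algebra which is given by `f` on `A` and by `g` on `B`. -/
def coprodLift (f : A.carrier →ₐ[R] Q) (g : B.carrier →ₐ[R] Q) :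
    (coprod A B).carrier →ₐ[R] Q := FreeProd.lift f g

@[simp]
theorem coprodLift_inl (f : A.carrier →ₐ[R] Q) (g : B.carrier →ₐ[R] Q) (a : A.carrier) :
    coprodLift f g (Hom.toAlgHom (inl A B) a) = f a := FreeProd.lift_inl f g a

@[simp]
theorem coprodLift_inr (f : A.carrier →ₐ[R] Q) (g : B.carrier →ₐ[R] Q) (b : B.carrier) :
    coprodLift f g (Hom.toAlgHom (inr A B) b) = g b := FreeProd.lift_inr f g b

@[simp]
theorem coprodLift_comp_inl (f : A.carrier →ₐ[R] Q) (g : B.carrier →ₐ[R] Q) :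
    (coprodLift f g).comp (Hom.toAlgHom (inl A B)) = f := AlgHom.ext (coprodLift_inl f g)

@[simp]
theorem coprodLift_comp_inr (f : A.carrier →ₐ[R] Q) (g : B.carrier →ₐ[R] Q) :
    (coprodLift f g).comp (Hom.toAlgHom (inr A B)) = g := AlgHom.ext (coprodLift_inr f g)

theorem coprod_algHom_ext {f g : (coprod A B).carrier →ₐ[R] Q}
    (h₁ : f.comp (Hom.toAlgHom (inl A B)) = g.comp (Hom.toAlgHom (inl A B)))
    (h₂ : f.comp (Hom.toAlgHom (inr A B)) = g.comp (Hom.toAlgHom (inr A B))) : f = g :=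
  FreeProd.algHom_ext (fun a => DFunLike.congr_fun h₁ a) (fun b => DFunLike.congr_fun h₂ b)

theorem comp_coprodLift (k : Q →ₐ[R] Q') (f : A.carrier →ₐ[R] Q) (g : B.carrier →ₐ[R] Q) :
    k.comp (coprodLift f g) = coprodLift (k.comp f) (k.comp g) :=
  coprod_algHom_ext (by rw [AlgHom.comp_assoc]; simp) (by rw [AlgHom.comp_assoc]; simp)

theorem toAlgHom_desc (f : A ⟶ D) (g : B ⟶ D) :
    Hom.toAlgHom (desc f g) = coprodLift (Hom.toAlgHom f) (Hom.toAlgHom g) := rfl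

/-- Right multiplications by elements of the two factors generate the free product. -/
theorem mem_of_mul_mem {S : Submodule R (coprod A B).carrier}
    (h1 : 1 ∈ S) (hl : ∀ t ∈ S, ∀ a, t * Hom.toAlgHom (inl A B) a ∈ S)
    (hr : ∀ t ∈ S, ∀ b, t * Hom.toAlgHom (inr A B) b ∈ S) (t : (coprod A B).carrier) : t ∈ S := by
  have ht : t ∈ Algebra.adjoin R (FreeProd.gens A B) := by rw [FreeProd.adjoin_gens]; trivial
  -- Quantifying over the left factor `s` lets a product be absorbed one letter at a time from the
  -- right.
  have key : ∀ s ∈ S, s * t ∈ S := by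
    induction ht using Algebra.adjoin_induction with
    | mem y hy =>
      obtain ⟨n, ⟨a, -, rfl⟩ | ⟨b, -, rfl⟩⟩ := hy
      · exact fun s hs => hl s hs a
      · exact fun s hs => hr s hs b
    | algebraMap r =>
      intro s hs
      have h : s * algebraMap R (coprod A B).carrier r = r • s := by
        rw [← Algebra.commutes, ← Algebra.smul_def]
      exact h ▸ S.smul_mem r hs
    | add x y _ _ hx hy =>
      intro s hs
      have h : s * (x + y : (coprod A B).carrier) = s * x + s * y := mul_add _ _ _
      exact h ▸ add_mem (hx s hs) (hy s hs)
    | mul x y _ _ hx hy =>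
      intro s hs
      have h : s * (x * y : (coprod A B).carrier) = s * x * y := (mul_assoc _ _ _).symm
      exact h ▸ hy _ (hx s hs)
  have := key 1 h1
  rwa [one_mul] at this

end CoprodLift

/-! ### Corner homomorphisms and vanishing products -/

variable (A : ConnAlg R)

/-- The unit of the group of algebra homomorphisms `A → Q`. -/
def unitHom (Q : Type u) [Ring Q] [Algebra R Q] : A.carrier →ₐ[R] Q :=
  (Algebra.ofId R Q).comp A.aug

theorem unitHom_apply (Q : Type u) [Ring Q] [Algebra R Q] (x : A.carrier) :
    A.unitHom Q x = algebraMap R Q (A.aug x) := rfl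

variable {A} {Q : Type u} [Ring Q] [Algebra R Q]

/-- The homomorphism which is `F e` on the augmentation ideal, for an idempotent `e` which
commutes with the values of `F`. -/
def corner (F : A.carrier →ₐ[R] Q) (e : Q) (he : e * e = e) (hc : ∀ a, e * F a = F a * e) :
    A.carrier →ₐ[R] Q :=
  AlgHom.ofLinearMap
    ((LinearMap.mulRight R e) ∘ₗ F.toLinearMap +
      (LinearMap.mulRight R (1 - e)) ∘ₗ (A.unitHom Q).toLinearMap)
    (by simp)
    (by
      intro x y
      have h1 : e * (1 - e) = 0 := by rw [mul_sub, mul_one, he, sub_self]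
      have h2 : (1 - e) * e = 0 := by rw [sub_mul, one_mul, he, sub_self]
      have h3 : (1 - e) * (1 - e) = 1 - e := by rw [sub_mul, h1, one_mul, sub_zero]
      have h4 : (1 - e) * F y = F y * (1 - e) := by
        rw [sub_mul, mul_sub, one_mul, mul_one, hc]
      have h5 : ∀ r, (1 - e) * algebraMap R Q r = algebraMap R Q r * (1 - e) :=
        fun r => (Algebra.commutes r _).symm
      have h6 : ∀ r, e * algebraMap R Q r = algebraMap R Q r * e :=
        fun r => (Algebra.commutes r _).symm
      simp only [LinearMap.add_apply, LinearMap.comp_apply, LinearMap.mulRight_apply,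
        AlgHom.toLinearMap_apply, map_mul, unitHom_apply]
      rw [mul_add, add_mul, add_mul, mul_assoc (F x) e, ← mul_assoc e, hc, mul_assoc (F y) e, he,
        mul_assoc _ (1 - e) (F y * e), ← mul_assoc (1 - e) (F y), h4, mul_assoc (F y), h2,
        mul_assoc (F x) e, ← mul_assoc e (algebraMap R Q _), h6, mul_assoc _ e (1 - e), h1,
        mul_assoc _ (1 - e) (_ * (1 - e)), ← mul_assoc (1 - e), h5, mul_assoc _ (1 - e) (1 - e), h3]
      simp only [mul_zero, add_zero, zero_add, mul_assoc])

theorem corner_apply (F : A.carrier →ₐ[R] Q) (e : Q) (he : e * e = e)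
    (hc : ∀ a, e * F a = F a * e) (a : A.carrier) :
    corner F e he hc a = F a * e + algebraMap R Q (A.aug a) * (1 - e) := rfl

variable (A) in
/-- The projection onto the augmentation ideal. -/
def pr : A.carrier →ₗ[R] A.carrier := LinearMap.id - (A.unitHom A.carrier).toLinearMap

theorem pr_apply (x : A.carrier) : A.pr x = x - algebraMap R A.carrier (A.aug x) := rfl

theorem aug_pr (x : A.carrier) : A.aug (A.pr x) = 0 := by
  rw [pr_apply, map_sub, AlgHom.commutes, Algebra.algebraMap_self_apply, sub_self]

/-- The products of values of `f` and of `g` on the augmentation ideal vanish. -/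
def MulZero (f g : A.carrier →ₐ[R] Q) : Prop := ∀ a b, A.aug a = 0 → A.aug b = 0 → f a * g b = 0

/-- Expansion of `f (a - ε a) * g (b - ε b) = 0`; it evaluates the product of values on arbitrary
elements. -/
theorem MulZero.mul {f g : A.carrier →ₐ[R] Q} (h : MulZero f g) (a b : A.carrier) :
    f a * g b = algebraMap R Q (A.aug b) * f a + algebraMap R Q (A.aug a) * g b -
      algebraMap R Q (A.aug a * A.aug b) := by
  have := h (A.pr a) (A.pr b) (aug_pr a) (aug_pr b)
  rw [pr_apply, pr_apply, map_sub, map_sub, AlgHom.commutes, AlgHom.commutes, mul_sub, sub_mul,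
    sub_mul, ← Algebra.commutes, ← map_mul] at this
  rw [← sub_eq_zero, ← this]
  abel

end ConnAlg

/-! ### The monoid of algebra homomorphisms out of a comonoid -/

namespace AlgComon

variable {R : Type u} [CommRing R] {A : AlgComon R} {Q Q' : Type u} [Ring Q] [Algebra R Q]
  [Ring Q'] [Algebra R Q']

/-- The product of the algebra homomorphisms `f, g : A → Q`. -/
def star (f g : A.carrier →ₐ[R] Q) : A.carrier →ₐ[R] Q :=
  (ConnAlg.coprodLift f g).comp (ConnAlg.Hom.toAlgHom A.comul)

theorem star_apply (f g : A.carrier →ₐ[R] Q) (x : A.carrier) :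
    star f g x = ConnAlg.coprodLift f g (ConnAlg.Hom.toAlgHom A.comul x) := rfl

theorem comp_star (k : Q →ₐ[R] Q') (f g : A.carrier →ₐ[R] Q) :
    k.comp (star f g) = star (k.comp f) (k.comp g) := by
  rw [star, ← AlgHom.comp_assoc, ConnAlg.comp_coprodLift]; rfl

/-- Naturality in the comonoid: a homomorphism of comonoids turns the pair of inclusions of the
source into that of the target. -/
theorem star_comp {B : AlgComon R} (k : A ⟶ B) (f g : B.carrier →ₐ[R] Q) :
    (star f g).comp (ConnAlg.Hom.toAlgHom (Hom.hom k)) =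
      star (f.comp (ConnAlg.Hom.toAlgHom (Hom.hom k)))
        (g.comp (ConnAlg.Hom.toAlgHom (Hom.hom k))) := by
  have h := congrArg ConnAlg.Hom.toAlgHom k.comul_comm
  rw [ConnAlg.comp_toAlgHom, ConnAlg.comp_toAlgHom] at h
  rw [star, AlgHom.comp_assoc, ← h, star, ← AlgHom.comp_assoc]
  congr 1
  rw [ConnAlg.coprodMap, ConnAlg.toAlgHom_desc, ConnAlg.comp_coprodLift, ConnAlg.comp_toAlgHom,
    ConnAlg.comp_toAlgHom, ← AlgHom.comp_assoc, ← AlgHom.comp_assoc, ConnAlg.coprodLift_comp_inl,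
    ConnAlg.coprodLift_comp_inr]

theorem unitHom_star (f : A.carrier →ₐ[R] Q) : star (A.unitHom Q) f = f := by
  have h := congrArg (fun k => f.comp (ConnAlg.Hom.toAlgHom k)) A.counit_left
  refine Eq.trans ?_ h
  simp only [ConnAlg.comp_toAlgHom]
  rw [← AlgHom.comp_assoc, star, ConnAlg.toAlgHom_desc, ConnAlg.comp_coprodLift]
  congr 2
  ext a
  exact (f.commutes _).symm

theorem star_unitHom (f : A.carrier →ₐ[R] Q) : star f (A.unitHom Q) = f := by
  have h := congrArg (fun k => f.comp (ConnAlg.Hom.toAlgHom k)) A.counit_right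
  refine Eq.trans ?_ h
  simp only [ConnAlg.comp_toAlgHom]
  rw [← AlgHom.comp_assoc, star, ConnAlg.toAlgHom_desc, ConnAlg.comp_coprodLift]
  congr 2
  ext a
  exact (f.commutes _).symm

/-- Coassociativity, followed by the homomorphism from the triple coproduct given by `f`, `g`, `h`.
Nothing is required of `Q`, so the identity may be read in matrix algebras. -/
theorem star_assoc (f g h : A.carrier →ₐ[R] Q) : star (star f g) h = star f (star g h) := by
  have h0 := congrArg (fun k => AlgHom.comp (ConnAlg.coprodLift f (ConnAlg.coprodLift g h))
    (ConnAlg.Hom.toAlgHom k)) A.coassoc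
  simp only [ConnAlg.comp_toAlgHom, ConnAlg.coprodMap, ConnAlg.coprodAssoc, ConnAlg.toAlgHom_desc,
    ← AlgHom.comp_assoc, ConnAlg.comp_coprodLift, ConnAlg.coprodLift_comp_inl,
    ConnAlg.coprodLift_comp_inr, ConnAlg.id_toAlgHom, AlgHom.comp_id] at h0
  exact h0

end AlgComon

end CogroupAlg

end

noncomputable section
namespace CogroupAlg

/-! ## Homomorphisms to matrix algebras -/

namespace ConnAlg

variable {R : Type u} [CommRing R] {A : ConnAlg R} {P : Type u} [Ring P] [Algebra R P] {k : ℕ}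

/-- For an idempotent matrix `e`, the homomorphism to matrices which is `a ↦ f(a) e` on the
augmentation ideal. -/
def matCorner (f : A.carrier →ₐ[R] P) (e : Matrix (Fin k) (Fin k) R) (he : e * e = e) :
    A.carrier →ₐ[R] Matrix (Fin k) (Fin k) P :=
  corner ((Matrix.scalarAlgHom (Fin k) R).comp f) ((algebraMap R P).mapMatrix e)
    (by rw [← map_mul, he])
    (fun a => by
      ext i j
      simp [Matrix.scalar_apply, Algebra.commutes])

theorem matCorner_apply (f : A.carrier →ₐ[R] P) (e : Matrix (Fin k) (Fin k) R) (he : e * e = e)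
    (a : A.carrier) (i j : Fin k) :
    matCorner f e he a i j = e i j • f a + ((1 - e) i j * A.aug a) • (1 : P) := by
  rw [matCorner, corner_apply]
  have h : (1 - (algebraMap R P).mapMatrix e : Matrix (Fin k) (Fin k) P) =
    (algebraMap R P).mapMatrix (1 - e) := by rw [map_sub, map_one]
  rw [h]
  simp only [Matrix.add_apply, AlgHom.comp_apply, Matrix.scalarAlgHom_apply, Matrix.scalar_apply,
    Matrix.diagonal_mul, RingHom.mapMatrix_apply, Matrix.map_apply, Matrix.algebraMap_eq_diagonal,
    Pi.algebraMap_apply]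
  rw [← Algebra.commutes, ← Algebra.smul_def, ← map_mul, Algebra.algebraMap_eq_smul_one, mul_comm]

/-- The transition rule of the automaton: how one more letter on the right changes a row of the
matrix of a word. -/
theorem mul_matCorner_apply (f : A.carrier →ₐ[R] P) (e : Matrix (Fin k) (Fin k) R)
    (he : e * e = e) (a : A.carrier) (M : Matrix (Fin k) (Fin k) P) (i j : Fin k) :
    (M * matCorner f e he a) i j =
      ∑ l, (e l j • (M i l * f a) + ((1 - e) l j * A.aug a) • M i l) := by
  rw [Matrix.mul_apply]
  refine Finset.sum_congr rfl fun l _ => ?_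
  rw [matCorner_apply, mul_add, mul_smul_comm, mul_smul_comm, mul_one]

/-- On the augmentation ideal the values are `f a` times `e` and `g b` times `e'`. The entries of
`e` and `e'` are scalars, so the product carries the factor `e * e' = 0`. -/
theorem mulZero_matCorner (f g : A.carrier →ₐ[R] P) {e e' : Matrix (Fin k) (Fin k) R}
    (he : e * e = e) (he' : e' * e' = e') (h : e * e' = 0) :
    MulZero (matCorner f e he) (matCorner g e' he') := by
  intro a b ha hb
  ext i j
  rw [Matrix.mul_apply, Matrix.zero_apply]
  have h' := congrFun (congrFun h i) j
  rw [Matrix.mul_apply, Matrix.zero_apply] at h'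
  rw [← zero_smul R (f a * g b), ← h', Finset.sum_smul]
  refine Finset.sum_congr rfl fun l _ => ?_
  rw [matCorner_apply, matCorner_apply, ha, hb, mul_zero, zero_smul, add_zero, mul_zero, zero_smul,
    add_zero, smul_mul_smul_comm]

end ConnAlg

/-! ## The comultiplication of deconcatenation -/

namespace AlgComon

open ConnAlg

variable {R : Type u} [CommRing R] {A : AlgComon R} {Q : Type u} [Ring Q] [Algebra R Q]

/-- Next to `h b`, with `b` in the augmentation ideal, every letter of a word acts through its
augmentation alone. Absorbing the letters one by one shows that the whole word acts as a scalar,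
which is zero on the augmentation ideal. -/
theorem MulZero.star_left {f g h : A.carrier →ₐ[R] Q} (hf : MulZero f h) (hg : MulZero g h) :
    MulZero (star f g) h := by
  have key : ∀ t : (coprod A.toConnAlg A.toConnAlg).carrier, ∀ b, A.aug b = 0 →
      coprodLift f g t * h b = coprodLift A.aug A.aug t • h b := by
    intro t
    let S : Submodule R (coprod A.toConnAlg A.toConnAlg).carrier :=
      ⨅ b : {b // A.aug b = 0}, LinearMap.eqLocus
        (LinearMap.mulRight R (h b) ∘ₗ (coprodLift f g).toLinearMap)
        (LinearMap.toSpanSingleton R Q (h b) ∘ₗ (coprodLift A.aug A.aug).toLinearMap)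
    have hS : ∀ t, t ∈ S ↔ ∀ b, A.aug b = 0 →
        coprodLift f g t * h b = coprodLift A.aug A.aug t • h b := fun t => by
      simp [S, Submodule.mem_iInf]
    rw [← hS]
    refine mem_of_mul_mem ?_ ?_ ?_ t
    · rw [hS]; intro b _; simp
    · intro t ht a
      rw [hS] at ht ⊢
      intro b hb
      rw [map_mul, map_mul, coprodLift_inl, coprodLift_inl, mul_assoc, MulZero.mul hf, hb]
      rw [map_zero, zero_mul, mul_zero, map_zero, sub_zero, zero_add, ← Algebra.smul_def,
        mul_smul_comm, ht b hb, smul_smul, mul_comm]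
    · intro t ht a
      rw [hS] at ht ⊢
      intro b hb
      rw [map_mul, map_mul, coprodLift_inr, coprodLift_inr, mul_assoc, MulZero.mul hg, hb]
      rw [map_zero, zero_mul, mul_zero, map_zero, sub_zero, zero_add, ← Algebra.smul_def,
        mul_smul_comm, ht b hb, smul_smul, mul_comm]
  intro a b ha hb
  rw [star_apply, key _ b hb]
  have h2 : coprodLift A.aug A.aug (Hom.toAlgHom A.comul a) = A.aug a :=
    DFunLike.congr_fun (unitHom_star (A := A) A.aug) a
  rw [h2, ha, zero_smul]

theorem MulZero.star_right {f g h : A.carrier →ₐ[R] Q} (hf : MulZero h f) (hg : MulZero h g) :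
    MulZero h (star f g) := by
  have key : ∀ t : (coprod A.toConnAlg A.toConnAlg).carrier, ∀ b, A.aug b = 0 →
      h b * coprodLift f g t = coprodLift A.aug A.aug t • h b := by
    intro t
    let S : Submodule R (coprod A.toConnAlg A.toConnAlg).carrier :=
      ⨅ b : {b // A.aug b = 0}, LinearMap.eqLocus
        (LinearMap.mulLeft R (h b) ∘ₗ (coprodLift f g).toLinearMap)
        (LinearMap.toSpanSingleton R Q (h b) ∘ₗ (coprodLift A.aug A.aug).toLinearMap)
    have hS : ∀ t, t ∈ S ↔ ∀ b, A.aug b = 0 →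
        h b * coprodLift f g t = coprodLift A.aug A.aug t • h b := fun t => by
      simp [S, Submodule.mem_iInf]
    rw [← hS]
    refine mem_of_mul_mem ?_ ?_ ?_ t
    · rw [hS]; intro b _; simp
    · intro t ht a
      rw [hS] at ht ⊢
      intro b hb
      rw [map_mul, map_mul, coprodLift_inl, coprodLift_inl, ← mul_assoc, ht b hb, smul_mul_assoc,
        MulZero.mul hf, hb]
      rw [map_zero, zero_mul, zero_mul, map_zero, sub_zero, add_zero, ← Algebra.smul_def, smul_smul]
    · intro t ht a
      rw [hS] at ht ⊢
      intro b hb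
      rw [map_mul, map_mul, coprodLift_inr, coprodLift_inr, ← mul_assoc, ht b hb, smul_mul_assoc,
        MulZero.mul hg, hb]
      rw [map_zero, zero_mul, zero_mul, map_zero, sub_zero, add_zero, ← Algebra.smul_def, smul_smul]
  intro a b ha hb
  rw [star_apply, key _ a ha]
  have h2 : coprodLift A.aug A.aug (Hom.toAlgHom A.comul b) = A.aug b :=
    DFunLike.congr_fun (unitHom_star (A := A) A.aug) b
  rw [h2, hb, zero_smul]

variable (A)

/-- The first homomorphism to matrices over `A ⊗ A` which defines the deconcatenation. -/
def decFst : A.carrier →ₐ[R] Matrix (Fin 2) (Fin 2) (A.carrier ⊗[R] A.carrier) :=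
  -- Two states: letters of the first factor lead from either state to state `1`; for `decSnd`,
  -- letters of the second factor keep state `0` and kill state `1`. Starting from state `0`, the
  -- surviving words are letters of the second factor followed by letters of the first.
  matCorner Algebra.TensorProduct.includeRight !![0, 1; 0, 1]
    (by ext i j; fin_cases i <;> fin_cases j <;> simp [Matrix.mul_apply])

/-- The second homomorphism to matrices over `A ⊗ A` which defines the deconcatenation. -/
def decSnd : A.carrier →ₐ[R] Matrix (Fin 2) (Fin 2) (A.carrier ⊗[R] A.carrier) :=
  matCorner Algebra.TensorProduct.includeLeft !![1, 0; 0, 0]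
    (by ext i j; fin_cases i <;> fin_cases j <;> simp [Matrix.mul_apply])

/-- The product of the two homomorphisms. -/
def decHom : A.carrier →ₐ[R] Matrix (Fin 2) (Fin 2) (A.carrier ⊗[R] A.carrier) :=
  star A.decFst A.decSnd

/-- The sum of the entries of the first row. -/
def rowSum (R : Type u) [CommRing R] (k : ℕ) [NeZero k] (P : Type u) [Ring P] [Algebra R P] :
    Matrix (Fin k) (Fin k) P →ₗ[R] P :=
  ∑ j, Matrix.entryLinearMap R P 0 j

theorem rowSum_apply {k : ℕ} [NeZero k] {P : Type u} [Ring P] [Algebra R P]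
    (M : Matrix (Fin k) (Fin k) P) : rowSum R k P M = ∑ j, M 0 j := by
  simp [rowSum, LinearMap.sum_apply]

/-- The deconcatenation `A → A ⊗ A` of a comonoid. For a tensor algebra `T_CM(C)` it is
`x₁ ⋯ xₙ ↦ ∑ x₁ ⋯ xᵢ ⊗ xᵢ₊₁ ⋯ xₙ`. -/
def dec : A.carrier →ₗ[R] A.carrier ⊗[R] A.carrier :=
  rowSum R 2 _ ∘ₗ A.decHom.toLinearMap

theorem dec_apply (x : A.carrier) : A.dec x = A.decHom x 0 0 + A.decHom x 0 1 := by
  rw [dec, LinearMap.comp_apply, rowSum_apply, Fin.sum_univ_two]; rfl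

theorem mulZero_decFst_decSnd : MulZero A.decFst A.decSnd :=
  mulZero_matCorner _ _ _ _
    (by ext i j; fin_cases i <;> fin_cases j <;> simp [Matrix.mul_apply])

variable {A}

theorem mul'_map_mul_right (f g : A.carrier →ₐ[R] Q) (s : A.carrier ⊗[R] A.carrier)
    (y : A.carrier) :
    LinearMap.mul' R Q (TensorProduct.map g.toLinearMap f.toLinearMap (s * (1 ⊗ₜ y))) =
      LinearMap.mul' R Q (TensorProduct.map g.toLinearMap f.toLinearMap s) * f y := by
  induction s with
  | zero => simp
  | tmul a b => simp [mul_assoc]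
  | add a b ha hb => rw [add_mul, map_add, map_add, ha, hb, map_add, map_add, add_mul]

/-- The product of two homomorphisms in terms of the deconcatenation. -/
theorem star_eq_dec {f g : A.carrier →ₐ[R] Q} (h : MulZero f g) (x : A.carrier) :
    star f g x = LinearMap.mul' R Q (TensorProduct.map g.toLinearMap f.toLinearMap (A.dec x)) := by
  set μ : A.carrier ⊗[R] A.carrier →ₗ[R] Q :=
    LinearMap.mul' R Q ∘ₗ TensorProduct.map g.toLinearMap f.toLinearMap with hμ
  set θ := coprodLift A.decFst A.decSnd
  have hμr : ∀ s y, μ (s * (1 ⊗ₜ y)) = μ s * f y := mul'_map_mul_right f g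
  -- Invariant along words: place `(0, 0)` contains only letters of the second factor; at place `(0,
  -- 1)` the word ends in the first factor, so a further value of `g` on the augmentation ideal
  -- annihilates it; and together the two places already evaluate to the correct element of `Q`.
  have key : ∀ t : (coprod A.toConnAlg A.toConnAlg).carrier,
      θ t 0 0 ∈ LinearMap.range
        (Algebra.TensorProduct.includeLeft : A.carrier →ₐ[R] A.carrier ⊗[R] A.carrier).toLinearMap ∧
      (∀ b : {b // A.aug b = 0}, μ (θ t 0 1) * g b = 0) ∧
      μ (θ t 0 0 + θ t 0 1) = coprodLift f g t := by
    intro t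
    let S : Submodule R (coprod A.toConnAlg A.toConnAlg).carrier :=
      { carrier := {t | θ t 0 0 ∈ LinearMap.range
          (Algebra.TensorProduct.includeLeft :
            A.carrier →ₐ[R] A.carrier ⊗[R] A.carrier).toLinearMap ∧
          (∀ b : {b // A.aug b = 0}, μ (θ t 0 1) * g b = 0) ∧
          μ (θ t 0 0 + θ t 0 1) = coprodLift f g t}
        add_mem' := by
          rintro s t ⟨h1, h2, h3⟩ ⟨h1', h2', h3'⟩
          have e : ∀ i j, θ (s + t) i j = θ s i j + θ t i j := fun i j => by rw [map_add]; rfl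
          refine ⟨?_, fun b => ?_, ?_⟩
          · rw [e]; exact add_mem h1 h1'
          · rw [e, map_add, add_mul, h2, h2', add_zero]
          · rw [e, e, add_add_add_comm, map_add, h3, h3', map_add]
        zero_mem' := by
          refine ⟨⟨0, ?_⟩, fun b => ?_, ?_⟩ <;> simp
        smul_mem' := by
          rintro r t ⟨h1, h2, h3⟩
          have e : ∀ i j, θ (r • t) i j = r • θ t i j := fun i j => by rw [map_smul]; rfl
          refine ⟨?_, fun b => ?_, ?_⟩
          · rw [e]; exact Submodule.smul_mem _ _ h1
          · rw [e, map_smul, smul_mul_assoc, h2, smul_zero]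
          · rw [e, e, ← smul_add, map_smul, h3, map_smul] }
    change t ∈ S
    refine mem_of_mul_mem ?_ ?_ ?_ t
    · refine ⟨⟨1, ?_⟩, fun b => ?_, ?_⟩ <;> simp [hμ, Algebra.TensorProduct.one_def]
    · rintro t ⟨h1, h2, h3⟩ y
      have e0 : θ (t * Hom.toAlgHom (inl A.toConnAlg A.toConnAlg) y) 0 0 =
          A.aug y • θ t 0 0 := by
        rw [map_mul, coprodLift_inl, decFst, mul_matCorner_apply]
        simp [Fin.sum_univ_two]
      have e1 : θ (t * Hom.toAlgHom (inl A.toConnAlg A.toConnAlg) y) 0 1 =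
          (θ t 0 0 + θ t 0 1) * (1 ⊗ₜ y) - A.aug y • θ t 0 0 := by
        rw [map_mul, coprodLift_inl, decFst, mul_matCorner_apply]
        simp [Fin.sum_univ_two, add_mul]
        abel
      refine ⟨?_, fun b => ?_, ?_⟩
      · rw [e0]; exact Submodule.smul_mem _ _ h1
      · have h4 := h (A.pr y) b (aug_pr y) b.2
        rw [pr_apply, map_sub, AlgHom.commutes, sub_mul, sub_eq_zero, ← Algebra.smul_def] at h4
        have h5 := h2 b
        rw [e1, map_sub, hμr, map_smul, sub_mul, mul_assoc, h4, map_add, add_mul, mul_smul_comm,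
          mul_smul_comm, h5, smul_mul_assoc, smul_zero, add_zero, sub_self]
      · rw [e0, e1, add_sub_cancel, hμr, h3, map_mul, coprodLift_inl]
    · rintro t ⟨h1, h2, h3⟩ y
      have e0 : θ (t * Hom.toAlgHom (inr A.toConnAlg A.toConnAlg) y) 0 0 =
          θ t 0 0 * (y ⊗ₜ 1) := by
        rw [map_mul, coprodLift_inr, decSnd, mul_matCorner_apply]
        simp [Fin.sum_univ_two]
      have e1 : θ (t * Hom.toAlgHom (inr A.toConnAlg A.toConnAlg) y) 0 1 =
          A.aug y • θ t 0 1 := by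
        rw [map_mul, coprodLift_inr, decSnd, mul_matCorner_apply]
        simp [Fin.sum_univ_two]
      obtain ⟨z, hz⟩ := h1
      have hz' : z ⊗ₜ[R] 1 = θ t 0 0 := hz
      refine ⟨?_, fun b => ?_, ?_⟩
      · rw [e0, ← hz']; exact ⟨z * y, by simp⟩
      · rw [e1, map_smul, smul_mul_assoc, h2, smul_zero]
      · have h4 : μ (θ t 0 1) * g (A.pr y) = 0 := h2 ⟨A.pr y, aug_pr y⟩
        rw [pr_apply, map_sub, AlgHom.commutes, mul_sub, sub_eq_zero, ← Algebra.commutes,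
          ← Algebra.smul_def] at h4
        rw [e0, e1, map_mul, coprodLift_inr, ← h3, map_add, map_add, add_mul, h4, map_smul, ← hz']
        simp [hμ]
  have := (key (Hom.toAlgHom A.comul x)).2.2
  rw [star_apply, ← this, dec_apply]
  rfl

/-- The left counit property of the deconcatenation. -/
theorem lid_dec (x : A.carrier) :
    TensorProduct.lid R A.carrier (TensorProduct.map A.aug.toLinearMap LinearMap.id (A.dec x)) =
      x := by
  -- The unit homomorphism vanishes on the augmentation ideal, so it has vanishing products with
  -- every homomorphism, and the unit law of `star` becomes a counit law.
  have h := star_eq_dec (A := A) (f := AlgHom.id R A.carrier) (g := A.unitHom A.carrier)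
    (fun a b _ hb => by rw [unitHom_apply, hb, map_zero, mul_zero]) x
  rw [star_unitHom] at h
  refine Eq.trans ?_ h.symm
  generalize A.dec x = d
  induction d with
  | zero => simp
  | tmul a b => simp [unitHom_apply, Algebra.smul_def]
  | add a b ha hb => simp only [map_add, ha, hb]

/-- The right counit property of the deconcatenation. -/
theorem rid_dec (x : A.carrier) :
    TensorProduct.rid R A.carrier (TensorProduct.map LinearMap.id A.aug.toLinearMap (A.dec x)) =
      x := by
  have h := star_eq_dec (A := A) (g := AlgHom.id R A.carrier) (f := A.unitHom A.carrier)
    (fun a b ha _ => by rw [unitHom_apply, ha, map_zero, zero_mul]) x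
  rw [unitHom_star] at h
  refine Eq.trans ?_ h.symm
  generalize A.dec x = d
  induction d with
  | zero => simp
  | tmul a b => simp [unitHom_apply, Algebra.smul_def, Algebra.commutes]
  | add a b ha hb => simp only [map_add, ha, hb]

/-- If `f g` and `g f` vanish on the augmentation ideal, the product is the sum. -/
theorem star_eq_add {f g : A.carrier →ₐ[R] Q} (h : MulZero f g) (h' : MulZero g f)
    (x : A.carrier) : star f g x = f x + g x - algebraMap R Q (A.aug x) := by
  rw [star_eq_dec h]
  have key : ∀ d : A.carrier ⊗[R] A.carrier,
      LinearMap.mul' R Q (TensorProduct.map g.toLinearMap f.toLinearMap d) =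
        f (TensorProduct.lid R _ (TensorProduct.map A.aug.toLinearMap LinearMap.id d)) +
        g (TensorProduct.rid R _ (TensorProduct.map LinearMap.id A.aug.toLinearMap d)) -
        algebraMap R Q (A.aug (TensorProduct.lid R _
          (TensorProduct.map A.aug.toLinearMap LinearMap.id d))) := by
    intro d
    induction d with
    | zero => simp
    | tmul a b =>
      simp [MulZero.mul h', Algebra.smul_def]
      abel
    | add a b ha hb => simp only [map_add, ha, hb]; abel
  rw [key, lid_dec, rid_dec]

/-- Coassociativity of the deconcatenation. -/
theorem dec_coassoc (x : A.carrier) :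
    TensorProduct.assoc R A.carrier A.carrier A.carrier (A.dec.rTensor A.carrier (A.dec x)) =
      A.dec.lTensor A.carrier (A.dec x) := by
  set i₁ : A.carrier →ₐ[R] A.carrier ⊗[R] (A.carrier ⊗[R] A.carrier) :=
    Algebra.TensorProduct.includeLeft
  set i₂ : A.carrier →ₐ[R] A.carrier ⊗[R] (A.carrier ⊗[R] A.carrier) :=
    Algebra.TensorProduct.includeRight.comp Algebra.TensorProduct.includeLeft
  set i₃ : A.carrier →ₐ[R] A.carrier ⊗[R] (A.carrier ⊗[R] A.carrier) :=
    Algebra.TensorProduct.includeRight.comp Algebra.TensorProduct.includeRight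
  -- Three-state version: `f₁` stays in state `0`, `f₂` moves states `0` and `1` to `1`, and `f₃`
  -- moves every state to `2`. Products in the order `f₁ f₂ f₃` survive, and every inversion of this
  -- order vanishes.
  set f₁ := matCorner i₁ !![1, 0, 0; 0, 0, 0; 0, 0, 0]
    (by ext i j; fin_cases i <;> fin_cases j <;> simp [Matrix.mul_apply, Fin.sum_univ_three])
  set f₂ := matCorner i₂ !![0, 1, 0; 0, 1, 0; 0, 0, 0]
    (by ext i j; fin_cases i <;> fin_cases j <;> simp [Matrix.mul_apply, Fin.sum_univ_three])
  set f₃ := matCorner i₃ !![0, 0, 1; 0, 0, 1; 0, 0, 1]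
    (by ext i j; fin_cases i <;> fin_cases j <;> simp [Matrix.mul_apply, Fin.sum_univ_three])
  have h32 : MulZero f₃ f₂ := mulZero_matCorner _ _ _ _
    (by ext i j; fin_cases i <;> fin_cases j <;> simp [Matrix.mul_apply, Fin.sum_univ_three])
  have h31 : MulZero f₃ f₁ := mulZero_matCorner _ _ _ _
    (by ext i j; fin_cases i <;> fin_cases j <;> simp [Matrix.mul_apply, Fin.sum_univ_three])
  have h21 : MulZero f₂ f₁ := mulZero_matCorner _ _ _ _
    (by ext i j; fin_cases i <;> fin_cases j <;> simp [Matrix.mul_apply, Fin.sum_univ_three])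
  have hρ : ∀ a b c, rowSum R 3 _ (f₁ a * f₂ b * f₃ c) = a ⊗ₜ[R] (b ⊗ₜ[R] c) := by
    intro a b c
    rw [rowSum_apply]
    simp only [Fin.sum_univ_three, f₃, f₂, mul_matCorner_apply]
    simp [f₁, matCorner_apply, i₁, i₂, i₃, add_mul]
    module
  -- Both bracketings are expressed by iterated deconcatenations, and the row sum recovers the
  -- triple tensor.
  have h := DFunLike.congr_fun (star_assoc f₃ f₂ f₁) x
  rw [star_eq_dec (MulZero.star_left h31 h21), star_eq_dec (MulZero.star_right h32 h31)] at h
  have h' := congrArg (rowSum R 3 _) h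
  refine Eq.trans ?_ (h'.symm.trans ?_)
  · generalize A.dec x = d
    induction d with
    | zero => simp
    | tmul a b =>
      simp only [TensorProduct.map_tmul, AlgHom.toLinearMap_apply, LinearMap.mul'_apply,
        LinearMap.rTensor_tmul, star_eq_dec h21]
      generalize A.dec a = d
      induction d with
      | zero => simp
      | tmul a' a'' => simp [hρ]
      | add a b ha hb => simp only [map_add, TensorProduct.add_tmul, add_mul, ha, hb]
    | add a b ha hb => simp only [map_add, ha, hb]
  · generalize A.dec x = d
    induction d with
    | zero => simp
    | tmul a b =>
      simp only [TensorProduct.map_tmul, AlgHom.toLinearMap_apply, LinearMap.mul'_apply,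
        LinearMap.lTensor_tmul, star_eq_dec h32]
      generalize A.dec b = d
      induction d with
      | zero => simp
      | tmul a' a'' => simp [hρ, ← mul_assoc]
      | add a b ha hb => simp only [map_add, TensorProduct.tmul_add, mul_add, ha, hb]
    | add a b ha hb => simp only [map_add, ha, hb]

end AlgComon

end CogroupAlg

end

noncomputable section
namespace CogroupAlg

/-! ## Gradings of tensor products and of matrices -/

section Gradings

variable {R : Type u} [CommRing R]

/-- The grading of the tensor product of a graded module with itself. -/
def tensorGrading {M : Type u} [AddCommGroup M] [Module R M] (ℳ : ℕ → Submodule R M) (n : ℕ) :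
    Submodule R (M ⊗[R] M) :=
  Submodule.span R {t | ∃ p q, p + q = n ∧ ∃ y ∈ ℳ p, ∃ z ∈ ℳ q, t = y ⊗ₜ[R] z}

theorem tmul_mem_tensorGrading {M : Type u} [AddCommGroup M] [Module R M]
    {ℳ : ℕ → Submodule R M} {p q : ℕ} {y z : M} (hy : y ∈ ℳ p) (hz : z ∈ ℳ q) :
    y ⊗ₜ[R] z ∈ tensorGrading ℳ (p + q) :=
  Submodule.subset_span ⟨p, q, rfl, y, hy, z, hz, rfl⟩

theorem map_mem_tensorGrading {M N : Type u} [AddCommGroup M] [Module R M] [AddCommGroup N]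
    [Module R N] {ℳ : ℕ → Submodule R M} {𝒩 : ℕ → Submodule R N} (f : M →ₗ[R] N)
    (hf : ∀ n, ∀ x ∈ ℳ n, f x ∈ 𝒩 n) {n : ℕ} {d : M ⊗[R] M} (hd : d ∈ tensorGrading ℳ n) :
    TensorProduct.map f f d ∈ tensorGrading 𝒩 n := by
  induction hd using Submodule.span_induction with
  | mem t ht =>
    obtain ⟨p, q, rfl, y, hy, z, hz, rfl⟩ := ht
    exact tmul_mem_tensorGrading (hf p y hy) (hf q z hz)
  | zero => rw [map_zero]; exact zero_mem _
  | add a b _ _ ha hb => rw [map_add]; exact add_mem ha hb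
  | smul r a _ ha => rw [map_smul]; exact Submodule.smul_mem _ _ ha

instance {P : Type u} [Ring P] [Algebra R P] (𝒬 : ℕ → Submodule R P) [SetLike.GradedMonoid 𝒬] :
    SetLike.GradedMonoid (tensorGrading 𝒬) where
  one_mem := by
    have h : (1 : P) ∈ 𝒬 0 := SetLike.GradedOne.one_mem
    have h' := tmul_mem_tensorGrading h h
    rwa [add_zero, ← Algebra.TensorProduct.one_def] at h'
  mul_mem i j x y hx hy := by
    induction hx using Submodule.span_induction with
    | mem s hs =>
      induction hy using Submodule.span_induction with
      | mem t ht =>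
        obtain ⟨p, q, rfl, a, ha, b, hb, rfl⟩ := hs
        obtain ⟨p', q', rfl, a', ha', b', hb', rfl⟩ := ht
        rw [Algebra.TensorProduct.tmul_mul_tmul, add_add_add_comm]
        exact tmul_mem_tensorGrading (SetLike.mul_mem_graded ha ha') (SetLike.mul_mem_graded hb hb')
      | zero => rw [mul_zero]; exact zero_mem _
      | add a b _ _ ha hb => rw [mul_add]; exact add_mem ha hb
      | smul r a _ ha => rw [mul_smul_comm]; exact Submodule.smul_mem _ _ ha
    | zero => rw [zero_mul]; exact zero_mem _
    | add a b _ _ ha hb => rw [add_mul]; exact add_mem ha hb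
    | smul r a _ ha => rw [smul_mul_assoc]; exact Submodule.smul_mem _ _ ha

/-- The grading of matrices over a graded algebra. -/
def matrixGrading {P : Type u} [Ring P] [Algebra R P] (𝒬 : ℕ → Submodule R P) (k n : ℕ) :
    Submodule R (Matrix (Fin k) (Fin k) P) where
  carrier := {M | ∀ i j, M i j ∈ 𝒬 n}
  add_mem' ha hb i j := add_mem (ha i j) (hb i j)
  zero_mem' _ _ := zero_mem _
  smul_mem' r _ ha i j := Submodule.smul_mem _ r (ha i j)

instance {P : Type u} [Ring P] [Algebra R P] (𝒬 : ℕ → Submodule R P) [SetLike.GradedMonoid 𝒬]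
    (k : ℕ) : SetLike.GradedMonoid (matrixGrading 𝒬 k) where
  one_mem i j := by
    rw [Matrix.one_apply]
    split_ifs
    · exact SetLike.GradedOne.one_mem
    · exact zero_mem _
  mul_mem m n x y hx hy i j := by
    rw [Matrix.mul_apply]
    exact sum_mem fun l _ => SetLike.mul_mem_graded (hx i l) (hy l j)

theorem ConnAlg.matCorner_mem {A : ConnAlg R} {P : Type u} [Ring P] [Algebra R P]
    (𝒬 : ℕ → Submodule R P) [SetLike.GradedMonoid 𝒬] {k : ℕ} {f : A.carrier →ₐ[R] P}
    (hf : ∀ n, ∀ x ∈ A.grading n, f x ∈ 𝒬 n) (e : Matrix (Fin k) (Fin k) R) (he : e * e = e)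
    (n : ℕ) (x : A.carrier) (hx : x ∈ A.grading n) :
    matCorner f e he x ∈ matrixGrading 𝒬 k n := by
  intro i j
  rw [matCorner_apply]
  refine add_mem (Submodule.smul_mem _ _ (hf n x hx)) ?_
  by_cases h : n = 0
  · subst h; exact Submodule.smul_mem _ _ SetLike.GradedOne.one_mem
  · rw [A.aug_of_mem h hx, mul_zero, zero_smul]; exact zero_mem _

theorem AlgComon.star_mem {A : AlgComon R} {Q : Type u} [Ring Q] [Algebra R Q]
    (𝒬 : ℕ → Submodule R Q) [SetLike.GradedMonoid 𝒬] {f g : A.carrier →ₐ[R] Q}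
    (hf : ∀ n, ∀ x ∈ A.grading n, f x ∈ 𝒬 n) (hg : ∀ n, ∀ x ∈ A.grading n, g x ∈ 𝒬 n)
    (n : ℕ) (x : A.carrier) (hx : x ∈ A.grading n) : star f g x ∈ 𝒬 n := by
  refine map_mem_of_gen _ (ConnAlg.FreeProd.gens _ _) (ConnAlg.FreeProd.adjoin_gens _ _) 𝒬
    (ConnAlg.coprodLift f g) ?_ n _ ((ConnAlg.Hom.map_mem A.comul) n x hx)
  rintro _ ⟨n, ⟨a, ha, rfl⟩ | ⟨b, hb, rfl⟩⟩
  · exact ⟨n, ConnAlg.FreeProd.inl_mem ha, by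
      have := hf n a ha
      rwa [← ConnAlg.coprodLift_inl f g a] at this⟩
  · exact ⟨n, ConnAlg.FreeProd.inr_mem hb, by
      have := hg n b hb
      rwa [← ConnAlg.coprodLift_inr f g b] at this⟩

end Gradings

/-! ### The deconcatenation coalgebra and its antipode -/

namespace AlgComon

open ConnAlg

variable {R : Type u} [CommRing R] (A : AlgComon R) {Q : Type u} [Ring Q] [Algebra R Q]

theorem includeLeft_mem (A : ConnAlg R) (n : ℕ) (x : A.carrier) (hx : x ∈ A.grading n) :
    (Algebra.TensorProduct.includeLeft : A.carrier →ₐ[R] A.carrier ⊗[R] A.carrier) x ∈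
      tensorGrading A.grading n :=
  tmul_mem_tensorGrading (q := 0) hx SetLike.GradedOne.one_mem

theorem includeRight_mem (A : ConnAlg R) (n : ℕ) (x : A.carrier) (hx : x ∈ A.grading n) :
    (Algebra.TensorProduct.includeRight : A.carrier →ₐ[R] A.carrier ⊗[R] A.carrier) x ∈
      tensorGrading A.grading n := by
  have h := tmul_mem_tensorGrading (ℳ := A.grading) (p := 0) SetLike.GradedOne.one_mem hx
  rwa [zero_add] at h

theorem dec_mem (n : ℕ) (x : A.carrier) (hx : x ∈ A.grading n) :
    A.dec x ∈ tensorGrading A.grading n := by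
  have h := star_mem (A := A) (matrixGrading (tensorGrading A.grading) 2) (f := A.decFst)
    (g := A.decSnd) (matCorner_mem _ (includeRight_mem _) _ _) (matCorner_mem _ (includeLeft_mem _) _ _)
    n x hx
  rw [dec_apply]
  exact add_mem (h 0 0) (h 0 1)

theorem counit_bijective (A : ConnAlg R) :
    Function.Bijective fun x : A.grading 0 => A.aug (x : A.carrier) := by
  constructor
  · rintro ⟨x, hx⟩ ⟨y, hy⟩ h
    obtain ⟨r, rfl⟩ := A.exists_scalar x hx
    obtain ⟨s, rfl⟩ := A.exists_scalar y hy
    simp only [AlgHom.commutes, Algebra.algebraMap_self_apply] at h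
    rw [Subtype.mk.injEq, h]
  · intro r
    exact ⟨⟨algebraMap R A.carrier r, SetLike.algebraMap_mem_graded _ r⟩, by
      simp only [AlgHom.commutes, Algebra.algebraMap_self_apply]⟩

/-- The coalgebra given by the deconcatenation. -/
def decCoalg : ConnCoalg R where
  carrier := A.carrier
  coalgebra :=
    { comul := A.dec
      counit := A.aug.toLinearMap
      coassoc := LinearMap.ext A.dec_coassoc
      rTensor_counit_comp_comul := LinearMap.ext fun x =>
        (TensorProduct.lid R A.carrier).injective
          ((lid_dec x).trans (by simp))
      lTensor_counit_comp_comul := LinearMap.ext fun x =>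
        (TensorProduct.rid R A.carrier).injective
          ((rid_dec x).trans (by simp)) }
  grading := A.grading
  comul_mem := A.dec_mem
  counit_eq_zero _ _ hn hx := A.aug_of_mem hn hx
  connected := counit_bijective A.toConnAlg

variable {A}

/-- The convolution product with respect to the deconcatenation. -/
def dconv (f g : A.carrier →ₗ[R] Q) : A.carrier →ₗ[R] Q :=
  LinearMap.mul' R Q ∘ₗ TensorProduct.map f g ∘ₗ A.dec

theorem dconv_apply (f g : A.carrier →ₗ[R] Q) (x : A.carrier) :
    dconv f g x = LinearMap.mul' R Q (TensorProduct.map f g (A.dec x)) := rfl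

theorem dconv_assoc (f g h : A.carrier →ₗ[R] Q) :
    dconv (dconv f g) h = dconv f (dconv g h) :=
  ConnCoalg.conv_assoc (C := A.decCoalg) f g h

theorem unit_dconv (f : A.carrier →ₗ[R] Q) : dconv (A.unitHom Q).toLinearMap f = f :=
  ConnCoalg.one_conv (C := A.decCoalg) f

theorem dconv_unit (f : A.carrier →ₗ[R] Q) : dconv f (A.unitHom Q).toLinearMap = f :=
  ConnCoalg.conv_one (C := A.decCoalg) f

theorem comp_dconv {Q' : Type u} [Ring Q'] [Algebra R Q'] (h : Q →ₐ[R] Q')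
    (f g : A.carrier →ₗ[R] Q) :
    h.toLinearMap ∘ₗ dconv f g = dconv (h.toLinearMap ∘ₗ f) (h.toLinearMap ∘ₗ g) :=
  ConnCoalg.algHom_comp_conv (C := A.decCoalg) h f g

theorem comp_unitHom {Q' : Type u} [Ring Q'] [Algebra R Q'] (h : Q →ₐ[R] Q') :
    h.toLinearMap ∘ₗ (A.unitHom Q).toLinearMap = (A.unitHom Q').toLinearMap :=
  LinearMap.ext fun _ => h.commutes _

/-- The geometric series for the connected coalgebra `decCoalg`. -/
theorem exists_dconv_inverse {B : ConnAlg R} (f : A.carrier →ₗ[R] B.carrier)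
    (hf : ∀ n, ∀ x ∈ A.grading n, f x ∈ B.grading n)
    (hf0 : ∀ x ∈ A.grading 0, f x = algebraMap R B.carrier (A.aug x)) :
    ∃ g : A.carrier →ₗ[R] B.carrier, dconv f g = (A.unitHom B.carrier).toLinearMap ∧
      dconv g f = (A.unitHom B.carrier).toLinearMap ∧
      (∀ n, ∀ x ∈ A.grading n, g x ∈ B.grading n) ∧
      ∀ x ∈ A.grading 0, g x = algebraMap R B.carrier (A.aug x) :=
  have h : ConnCoalg.IsG (C := A.decCoalg) B f := ⟨hf, hf0⟩
  ⟨ConnCoalg.convInv (C := A.decCoalg) f, ConnCoalg.conv_convInv h, ConnCoalg.convInv_conv h,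
    (ConnCoalg.isG_convInv h).map_mem, (ConnCoalg.isG_convInv h).map_zero⟩

theorem dconv_left_inv_eq {f g h : A.carrier →ₗ[R] Q}
    (h₁ : dconv g f = (A.unitHom Q).toLinearMap) (h₂ : dconv f h = (A.unitHom Q).toLinearMap) :
    g = h := by
  rw [← dconv_unit g, ← h₂, ← dconv_assoc, h₁, unit_dconv]

/-- In a tensor algebra with deconcatenation the identity is the sum of the convolution powers of
the projection onto the generators. Its inverse is the unit minus that projection, which is why this
inverse finds the generators of a general comonoid. -/
theorem exists_antipode (A : AlgComon R) :
    ∃ S : A.carrier →ₗ[R] A.carrier, dconv LinearMap.id S = (A.unitHom A.carrier).toLinearMap ∧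
      dconv S LinearMap.id = (A.unitHom A.carrier).toLinearMap ∧
      (∀ n, ∀ x ∈ A.grading n, S x ∈ A.grading n) ∧
      ∀ x ∈ A.grading 0, S x = algebraMap R A.carrier (A.aug x) :=
  exists_dconv_inverse LinearMap.id (fun _ _ h => h) (fun x hx => by
    obtain ⟨r, rfl⟩ := A.exists_scalar x hx
    rw [AlgHom.commutes]; rfl)

/-- The convolution inverse of the identity with respect to the deconcatenation. -/
def antip (A : AlgComon R) : A.carrier →ₗ[R] A.carrier := A.exists_antipode.choose

theorem id_dconv_antip : dconv LinearMap.id A.antip = (A.unitHom A.carrier).toLinearMap :=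
  A.exists_antipode.choose_spec.1

theorem antip_dconv_id : dconv A.antip LinearMap.id = (A.unitHom A.carrier).toLinearMap :=
  A.exists_antipode.choose_spec.2.1

theorem antip_mem (n : ℕ) (x : A.carrier) (hx : x ∈ A.grading n) : A.antip x ∈ A.grading n :=
  A.exists_antipode.choose_spec.2.2.1 n x hx

theorem antip_zero {x : A.carrier} (hx : x ∈ A.grading 0) :
    A.antip x = algebraMap R A.carrier (A.aug x) :=
  A.exists_antipode.choose_spec.2.2.2 x hx

theorem antip_one : A.antip 1 = 1 := by
  rw [antip_zero SetLike.GradedOne.one_mem, map_one, map_one]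

theorem aug_antip (x : A.carrier) : A.aug (A.antip x) = A.aug x := by
  induction x using DirectSum.Decomposition.inductionOn A.grading with
  | zero => simp
  | @homogeneous i m =>
    by_cases h : i = 0
    · subst h
      rw [antip_zero m.2, AlgHom.commutes]; rfl
    · rw [A.aug_of_mem h m.2, A.aug_of_mem h (antip_mem _ _ m.2)]
  | add a b ha hb => simp only [map_add, ha, hb]

/-! ### The primitive elements -/

variable (A)

/-- The reduced deconcatenation. -/
def decBar : A.carrier →ₗ[R] A.carrier ⊗[R] A.carrier := TensorProduct.map A.pr A.pr ∘ₗ A.dec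

variable {A}

theorem decBar_apply (x : A.carrier) :
    A.decBar x = A.dec x - x ⊗ₜ 1 - 1 ⊗ₜ x + A.aug x • (1 ⊗ₜ 1) := by
  have key : ∀ d : A.carrier ⊗[R] A.carrier, TensorProduct.map A.pr A.pr d =
      d - (TensorProduct.rid R _ (TensorProduct.map LinearMap.id A.aug.toLinearMap d)) ⊗ₜ 1 -
        1 ⊗ₜ (TensorProduct.lid R _ (TensorProduct.map A.aug.toLinearMap LinearMap.id d)) +
        A.aug (TensorProduct.lid R _ (TensorProduct.map A.aug.toLinearMap LinearMap.id d)) •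
          (1 ⊗ₜ 1) := by
    intro d
    induction d with
    | zero => simp
    | tmul a b =>
      simp only [TensorProduct.map_tmul, pr_apply, Algebra.algebraMap_eq_smul_one, AlgHom.toLinearMap_apply,
        TensorProduct.rid_tmul, TensorProduct.lid_tmul, LinearMap.id_apply, map_smul,
        TensorProduct.sub_tmul, TensorProduct.tmul_sub, TensorProduct.tmul_smul,
        TensorProduct.smul_tmul', smul_eq_mul]
      rw [← TensorProduct.smul_tmul', ← TensorProduct.smul_tmul', ← TensorProduct.smul_tmul',
        ← TensorProduct.smul_tmul', mul_smul]
      module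
    | add a b ha hb =>
      simp only [map_add, ha, hb, TensorProduct.add_tmul, TensorProduct.tmul_add, add_smul]
      abel
  rw [decBar, LinearMap.comp_apply, key, rid_dec, lid_dec]

variable (A) in
/-- The elements whose deconcatenation is trivial. -/
def prim : Submodule R A.carrier := LinearMap.ker A.decBar

theorem dec_of_mem_prim {x : A.carrier} (hx : x ∈ A.prim) :
    A.dec x = x ⊗ₜ 1 + 1 ⊗ₜ x - A.aug x • (1 ⊗ₜ 1) := by
  have h := decBar_apply x
  rw [LinearMap.mem_ker.1 hx] at h
  rw [← sub_eq_zero, h]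
  abel

theorem mem_prim_of_dec {x : A.carrier}
    (hx : A.dec x = x ⊗ₜ 1 + 1 ⊗ₜ x - A.aug x • (1 ⊗ₜ 1)) : x ∈ A.prim := by
  rw [prim, LinearMap.mem_ker, decBar_apply, hx]
  abel

/-- The factors appear in the opposite order, since `star_eq_dec` puts the value of the second
homomorphism first. -/
theorem decHom_eq : A.decHom.toLinearMap = dconv A.decSnd.toLinearMap A.decFst.toLinearMap :=
  LinearMap.ext (star_eq_dec A.mulZero_decFst_decSnd)

theorem rowSum_decFst (x : A.carrier) : rowSum R 2 _ (A.decFst x) = 1 ⊗ₜ x := by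
  rw [rowSum_apply, Fin.sum_univ_two, decFst, matCorner_apply, matCorner_apply]
  simp

theorem rowSum_decSnd (x : A.carrier) : rowSum R 2 _ (A.decSnd x) = x ⊗ₜ 1 := by
  rw [rowSum_apply, Fin.sum_univ_two, decSnd, matCorner_apply, matCorner_apply]
  simp

theorem rowSum_algebraMap (r : R) :
    rowSum R 2 (A.carrier ⊗[R] A.carrier) (algebraMap R _ r) = r • (1 ⊗ₜ 1) := by
  rw [rowSum_apply, Fin.sum_univ_two, Matrix.algebraMap_eq_diagonal]
  simp [Algebra.algebraMap_eq_smul_one, Algebra.TensorProduct.one_def]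

/-- Here the convolution multiplies in the order `f`, `g` in which products vanish, so only the
terms seen by the two counit laws remain. -/
theorem dconv_of_mulZero {f g : A.carrier →ₐ[R] Q} (h : MulZero f g)
    {s : A.carrier →ₗ[R] A.carrier} (hs : ∀ x, A.aug (s x) = A.aug x) (x : A.carrier) :
    dconv (f.toLinearMap ∘ₗ s) (g.toLinearMap ∘ₗ s) x =
      f (s x) + g (s x) - algebraMap R Q (A.aug x) := by
  have key : ∀ d : A.carrier ⊗[R] A.carrier,
      LinearMap.mul' R Q (TensorProduct.map (f.toLinearMap ∘ₗ s) (g.toLinearMap ∘ₗ s) d) =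
        f (s (TensorProduct.rid R _ (TensorProduct.map LinearMap.id A.aug.toLinearMap d))) +
        g (s (TensorProduct.lid R _ (TensorProduct.map A.aug.toLinearMap LinearMap.id d))) -
        algebraMap R Q (A.aug (TensorProduct.lid R _
          (TensorProduct.map A.aug.toLinearMap LinearMap.id d))) := by
    intro d
    induction d with
    | zero => simp
    | tmul a b => simp [MulZero.mul h, hs, ← Algebra.smul_def]
    | add a b ha hb => simp only [map_add, ha, hb]; abel
  rw [dconv_apply, key, lid_dec, rid_dec]

/-- By `decHom_eq`, `decHom` is the convolution of `decSnd` and `decFst`. Composing a homomorphism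
with `antip` inverts it, and inverting a product reverses its factors. In the reversed order
`decFst` times `decSnd` vanishes, so only a sum is left, and its row sum says that the element is
primitive. -/
theorem antip_mem_prim (x : A.carrier) : A.antip x ∈ A.prim := by
  have h₁ : dconv (A.decHom.toLinearMap ∘ₗ A.antip) A.decHom.toLinearMap =
      (A.unitHom _).toLinearMap := by
    rw [← comp_unitHom A.decHom, ← antip_dconv_id, comp_dconv]; rfl
  have h₂ : dconv A.decHom.toLinearMap
      (dconv (A.decFst.toLinearMap ∘ₗ A.antip) (A.decSnd.toLinearMap ∘ₗ A.antip)) =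
      (A.unitHom _).toLinearMap := by
    have e : ∀ f : A.carrier →ₐ[R] Matrix (Fin 2) (Fin 2) (A.carrier ⊗[R] A.carrier),
        dconv f.toLinearMap (f.toLinearMap ∘ₗ A.antip) = (A.unitHom _).toLinearMap := fun f => by
      rw [← comp_unitHom f, ← id_dconv_antip, comp_dconv]; rfl
    rw [decHom_eq, dconv_assoc, ← dconv_assoc A.decFst.toLinearMap, e, unit_dconv, e]
  have h := DFunLike.congr_fun (dconv_left_inv_eq h₁ h₂) x
  rw [dconv_of_mulZero A.mulZero_decFst_decSnd aug_antip] at h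
  have h' := congrArg (rowSum R 2 _) h
  rw [map_sub, map_add, rowSum_decFst, rowSum_decSnd, rowSum_algebraMap] at h'
  refine mem_prim_of_dec ?_
  rw [aug_antip, add_comm (_ ⊗ₜ _)]
  exact h'

theorem one_mem_prim : (1 : A.carrier) ∈ A.prim := by
  rw [← antip_one]; exact antip_mem_prim 1

variable (A) in
/-- The projection onto the primitive elements. -/
def primProj : A.carrier →ₗ[R] A.carrier := (2 : R) • (A.unitHom A.carrier).toLinearMap - A.antip

/-- The coefficient `2` in `primProj` makes up for scalars: `antip` is the identity on them, but
minus the identity on primitive elements of augmentation zero. -/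
theorem primProj_mem_prim (x : A.carrier) : A.primProj x ∈ A.prim := by
  refine sub_mem (Submodule.smul_mem _ _ ?_) (antip_mem_prim x)
  rw [AlgHom.toLinearMap_apply, unitHom_apply, Algebra.algebraMap_eq_smul_one]
  exact Submodule.smul_mem _ _ one_mem_prim

/-- The projection onto the primitive elements in terms of the reduced deconcatenation. -/
theorem primProj_eq (x : A.carrier) :
    A.primProj x = x + LinearMap.mul' R A.carrier
      (TensorProduct.map A.antip LinearMap.id (A.decBar x)) := by
  have h : LinearMap.mul' R A.carrier (TensorProduct.map A.antip LinearMap.id (A.dec x)) =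
    algebraMap R _ (A.aug x) := DFunLike.congr_fun antip_dconv_id x
  rw [decBar_apply]
  simp only [map_add, map_sub, map_smul, h, TensorProduct.map_tmul, LinearMap.mul'_apply,
    antip_one, LinearMap.id_apply, mul_one, one_mul]
  rw [primProj, LinearMap.sub_apply, LinearMap.smul_apply, AlgHom.toLinearMap_apply, unitHom_apply,
    Algebra.algebraMap_eq_smul_one]
  module

theorem primProj_of_mem {x : A.carrier} (hx : x ∈ A.prim) : A.primProj x = x := by
  rw [primProj_eq, LinearMap.mem_ker.1 hx, map_zero, map_zero, add_zero]

theorem primProj_mem (n : ℕ) (x : A.carrier) (hx : x ∈ A.grading n) :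
    A.primProj x ∈ A.grading n := by
  refine sub_mem (Submodule.smul_mem _ _ ?_) (antip_mem n x hx)
  rw [AlgHom.toLinearMap_apply, unitHom_apply]
  by_cases h : n = 0
  · subst h; exact SetLike.algebraMap_mem_graded _ _
  · rw [A.aug_of_mem h hx, map_zero]; exact zero_mem _

theorem decHom_of_mem_prim {c : A.carrier} (hc : c ∈ A.prim) (hc0 : A.aug c = 0) :
    A.decHom c = A.decFst c + A.decSnd c := by
  have h := DFunLike.congr_fun (decHom_eq (A := A)) c
  rw [AlgHom.toLinearMap_apply] at h
  rw [h, dconv_apply, dec_of_mem_prim hc, hc0, zero_smul, sub_zero]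
  simp [add_comm]

/-- From state `1` only letters of the first factor survive, so this row deletes the second factor
by its counit. -/
theorem decHom_row_one (x : A.carrier) : A.decHom x 1 0 + A.decHom x 1 1 = 1 ⊗ₜ x := by
  have h := DFunLike.congr_fun (decHom_eq (A := A)) x
  rw [AlgHom.toLinearMap_apply, dconv_apply] at h
  have key : ∀ d : A.carrier ⊗[R] A.carrier,
      (LinearMap.mul' R _ (TensorProduct.map A.decSnd.toLinearMap A.decFst.toLinearMap d)) 1 0 +
      (LinearMap.mul' R _ (TensorProduct.map A.decSnd.toLinearMap A.decFst.toLinearMap d)) 1 1 =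
      1 ⊗ₜ (TensorProduct.lid R _ (TensorProduct.map A.aug.toLinearMap LinearMap.id d)) := by
    intro d
    induction d with
    | zero => simp
    | tmul a b =>
      simp only [TensorProduct.map_tmul, AlgHom.toLinearMap_apply, LinearMap.mul'_apply, decFst,
        decSnd, mul_matCorner_apply, Fin.sum_univ_two, matCorner_apply]
      simp
    | add a b ha hb =>
      simp only [map_add, Matrix.add_apply, TensorProduct.tmul_add, ← ha, ← hb]; abel
  rw [h, key, lid_dec]

/-- The deconcatenation of a product with a primitive element. -/
theorem dec_mul {c : A.carrier} (hc : c ∈ A.prim) (hc0 : A.aug c = 0) (x : A.carrier) :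
    A.dec (c * x) = (c ⊗ₜ 1) * A.dec x + 1 ⊗ₜ (c * x) := by
  -- The first letter is either `c''`, which stays in state `0` and multiplies the old first row, or
  -- `c'`, which passes to state `1`, where the second row gives `1 ⊗ x`.
  rw [dec_apply, dec_apply, map_mul, decHom_of_mem_prim hc hc0, Matrix.mul_apply, Matrix.mul_apply,
    Fin.sum_univ_two, Fin.sum_univ_two]
  have h := decHom_row_one x
  have e : (1 : A.carrier) ⊗ₜ[R] (c * x) = (1 ⊗ₜ c) * (1 ⊗ₜ x) := by simp
  rw [e, ← h, mul_add, mul_add]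
  simp [decFst, decSnd, matCorner_apply, hc0]
  abel

/-- Evaluate `antip * id = ε` at `c x` with the help of `dec_mul`: both `antip (c ·)` and `-c ε(·)`
have convolution with the identity equal to `-c ·`, and the identity can be cancelled on the right.
-/
theorem antip_mul {c : A.carrier} (hc : c ∈ A.prim) (hc0 : A.aug c = 0) (x : A.carrier) :
    A.antip (c * x) = -(A.aug x • c) := by
  have h1 : dconv (A.antip ∘ₗ LinearMap.mulLeft R c) LinearMap.id = -LinearMap.mulLeft R c := by
    ext y
    have h := DFunLike.congr_fun (antip_dconv_id (A := A)) (c * y)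
    rw [dconv_apply, dec_mul hc hc0, map_add, map_add, AlgHom.toLinearMap_apply, unitHom_apply,
      map_mul A.aug, hc0, zero_mul, map_zero, TensorProduct.map_tmul, LinearMap.mul'_apply, antip_one,
      one_mul, LinearMap.id_apply] at h
    rw [LinearMap.neg_apply, LinearMap.mulLeft_apply, ← add_eq_zero_iff_eq_neg, ← h, dconv_apply]
    congr 2
    generalize A.dec y = d
    induction d with
    | zero => simp
    | tmul a b => simp
    | add a b ha hb => simp only [map_add, mul_add, ha, hb]
  have h2 : dconv (-(LinearMap.mulLeft R c ∘ₗ (A.unitHom A.carrier).toLinearMap)) LinearMap.id =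
      -LinearMap.mulLeft R c := by
    ext y
    have h := DFunLike.congr_fun (unit_dconv (A := A) (LinearMap.id : A.carrier →ₗ[R] A.carrier)) y
    rw [dconv_apply, LinearMap.id_apply] at h
    rw [LinearMap.neg_apply, LinearMap.mulLeft_apply]
    conv_rhs => rw [← h]
    rw [dconv_apply]
    generalize A.dec y = d
    induction d with
    | zero => simp
    | tmul a b => simp [mul_assoc]
    | add a b ha hb => rw [map_add, map_add, ha, hb, map_add, map_add, mul_add, neg_add]
  have h3 : A.antip ∘ₗ LinearMap.mulLeft R c =
      -(LinearMap.mulLeft R c ∘ₗ (A.unitHom A.carrier).toLinearMap) := by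
    rw [← dconv_unit (A.antip ∘ₗ LinearMap.mulLeft R c), ← id_dconv_antip, ← dconv_assoc, h1, ← h2,
      dconv_assoc, id_dconv_antip, dconv_unit]
  have := DFunLike.congr_fun h3 x
  rw [LinearMap.comp_apply, LinearMap.mulLeft_apply] at this
  rw [this, LinearMap.neg_apply, LinearMap.comp_apply, AlgHom.toLinearMap_apply, unitHom_apply,
    LinearMap.mulLeft_apply, ← Algebra.commutes, ← Algebra.smul_def]

end AlgComon

end CogroupAlg

end

noncomputable section
namespace CogroupAlg

/-! ## The comultiplication on primitive elements -/

namespace AlgComon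

open ConnAlg

variable {R : Type u} [CommRing R] {A : AlgComon R} {Q : Type u} [Ring Q] [Algebra R Q]

/-- For orthogonal idempotents the products vanish in both orders, so `star` is a sum. Read
backwards, this splits one homomorphism into a product along a decomposition of its idempotent. -/
theorem star_matCorner {P : Type u} [Ring P] [Algebra R P] {k : ℕ} (f : A.carrier →ₐ[R] P)
    {e e' : Matrix (Fin k) (Fin k) R} (he : e * e = e) (he' : e' * e' = e') (h : e * e' = 0)
    (h' : e' * e = 0) (hs : (e + e') * (e + e') = e + e') :
    star (matCorner f e he) (matCorner f e' he') = matCorner f (e + e') hs := by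
  ext x i j
  rw [star_eq_add (mulZero_matCorner _ _ _ _ h) (mulZero_matCorner _ _ _ _ h'), Matrix.sub_apply,
    Matrix.add_apply, matCorner_apply, matCorner_apply, matCorner_apply]
  have e3 : algebraMap R (Matrix (Fin k) (Fin k) P) (A.aug x) i j =
      ((1 : Matrix (Fin k) (Fin k) R) i j * A.aug x) • (1 : P) := by
    rw [Matrix.algebraMap_matrix_apply, Matrix.one_apply]
    split_ifs <;> simp [Algebra.algebraMap_eq_smul_one]
  rw [e3]
  simp only [Matrix.add_apply, Matrix.sub_apply]
  module

theorem matCorner_eq_star {P : Type u} [Ring P] [Algebra R P] {k : ℕ} (f : A.carrier →ₐ[R] P)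
    {e e' e'' : Matrix (Fin k) (Fin k) R} (he : e * e = e) (he' : e' * e' = e')
    (he'' : e'' * e'' = e'') (h : e * e' = 0) (h' : e' * e = 0) (hs : e'' = e + e') :
    matCorner f e'' he'' = star (matCorner f e he) (matCorner f e' he') := by
  subst hs
  rw [star_matCorner f he he' h h' he'']

theorem star_mem_subalgebra (T : Subalgebra R Q) {f g : A.carrier →ₐ[R] Q} (hf : ∀ x, f x ∈ T)
    (hg : ∀ x, g x ∈ T) (x : A.carrier) : star f g x ∈ T := by
  have h := comp_star T.val (f.codRestrict T hf) (g.codRestrict T hg)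
  rw [AlgHom.val_comp_codRestrict, AlgHom.val_comp_codRestrict] at h
  rw [← h]
  exact Subtype.property _

/-- Matrices which vanish at two given places of the first row. -/
def firstRowSubalgebra (R : Type u) [CommRing R] (P : Type u) [Ring P] [Algebra R P] :
    Subalgebra R (Matrix (Fin 3) (Fin 3) P) where
  carrier := {M | M 0 1 = 0 ∧ M 0 2 = 0}
  mul_mem' := by
    rintro M N ⟨h1, h2⟩ ⟨h3, h4⟩
    constructor <;> simp [Matrix.mul_apply, Fin.sum_univ_three, h1, h2, h3, h4]
  add_mem' := by
    rintro M N ⟨h1, h2⟩ ⟨h3, h4⟩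
    constructor <;> simp [h1, h2, h3, h4]
  algebraMap_mem' r := by
    constructor <;> simp [Matrix.algebraMap_matrix_apply]

/-- Matrices which vanish at two given places of the last column. -/
def lastColSubalgebra (R : Type u) [CommRing R] (P : Type u) [Ring P] [Algebra R P] :
    Subalgebra R (Matrix (Fin 3) (Fin 3) P) where
  carrier := {M | M 0 2 = 0 ∧ M 1 2 = 0}
  mul_mem' := by
    rintro M N ⟨h1, h2⟩ ⟨h3, h4⟩
    constructor <;> simp [Matrix.mul_apply, Fin.sum_univ_three, h1, h2, h3, h4]
  add_mem' := by
    rintro M N ⟨h1, h2⟩ ⟨h3, h4⟩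
    constructor <;> simp [h1, h2, h3, h4]
  algebraMap_mem' r := by
    constructor <;> simp [Matrix.algebraMap_matrix_apply]

/-- Unlike in `star_eq_add`, vanishing in one order suffices, because the deconcatenation of `x` has
no mixed terms. -/
theorem star_of_mem_prim {f g : A.carrier →ₐ[R] Q} (h : MulZero f g) {x : A.carrier}
    (hx : x ∈ A.prim) : star f g x = f x + g x - algebraMap R Q (A.aug x) := by
  rw [star_eq_dec h, dec_of_mem_prim hx]
  simp [Algebra.algebraMap_eq_smul_one, add_comm]

/-! ### Detection of words in which the second factor precedes the first -/

section Words

variable {P : Type u} [Ring P] [Algebra R P] (l r : A.carrier →ₐ[R] P)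

/-- The first homomorphism which detects products of an element of the second factor with an
element of the first factor. -/
def wordFst : A.carrier →ₐ[R] Matrix (Fin 3) (Fin 3) P :=
  -- State `0`: only letters of the first factor so far; state `1`: these followed by letters of the
  -- second factor; state `2`: a letter of the first factor has come after one of the second.
  -- Letters of the first factor move `0` to `0`, `1` to `2` and `2` to `2`.
  matCorner l !![1, 0, 0; 0, 0, 1; 0, 0, 1]
    (by simp only [← Matrix.ext_iff, Fin.forall_fin_succ]; simp)

/-- The second homomorphism which detects products of an element of the second factor with an
element of the first factor. -/
def wordSnd : A.carrier →ₐ[R] Matrix (Fin 3) (Fin 3) P :=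
  -- Letters of the second factor move `0` to `1`, `1` to `1` and `2` to `2`.
  matCorner r !![0, 1, 0; 0, 1, 0; 0, 0, 1]
    (by simp only [← Matrix.ext_iff, Fin.forall_fin_succ]; simp)

set_option maxHeartbeats 1000000 in
-- Split each idempotent into two orthogonal ones and regroup the four factors of the product by
-- associativity, so that the two halves have vanishing products. On a primitive element the product
-- of the halves is a sum, and neither half reaches the place `(0, 2)`.
theorem star_word_eq_zero {x : A.carrier} (hx : x ∈ A.prim) :
    star (wordFst l) (wordSnd r) x 0 2 = 0 := by
  obtain ⟨f, hf⟩ : ∃ f, f = matCorner l !![0, 0, 0; 0, 0, 1; 0, 0, 1] (by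
    simp only [← Matrix.ext_iff, Fin.forall_fin_succ]; simp) := ⟨_, rfl⟩
  obtain ⟨g, hg⟩ : ∃ g, g = matCorner l !![1, 0, 0; 0, 0, 0; 0, 0, 0] (by
    simp only [← Matrix.ext_iff, Fin.forall_fin_succ]; simp) := ⟨_, rfl⟩
  obtain ⟨h, hh⟩ : ∃ h, h = matCorner r !![0, 1, 0; 0, 1, 0; 0, 0, 0] (by
    simp only [← Matrix.ext_iff, Fin.forall_fin_succ]; simp) := ⟨_, rfl⟩
  obtain ⟨h', hh'⟩ : ∃ h', h' = matCorner r !![0, 0, 0; 0, 0, 0; 0, 0, 1] (by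
    simp only [← Matrix.ext_iff, Fin.forall_fin_succ]; simp) := ⟨_, rfl⟩
  have mfg : MulZero f g := by
    subst hf hg
    exact mulZero_matCorner _ _ _ _
      (by simp only [← Matrix.ext_iff, Fin.forall_fin_succ]; simp)
  have mfh : MulZero f h := by
    subst hf hh
    exact mulZero_matCorner _ _ _ _
      (by simp only [← Matrix.ext_iff, Fin.forall_fin_succ]; simp)
  have mhg : MulZero h' g := by
    subst hh' hg
    exact mulZero_matCorner _ _ _ _
      (by simp only [← Matrix.ext_iff, Fin.forall_fin_succ]; simp)
  have mgh : MulZero g h' := by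
    subst hh' hg
    exact mulZero_matCorner _ _ _ _
      (by simp only [← Matrix.ext_iff, Fin.forall_fin_succ]; simp)
  have mhh : MulZero h' h := by
    subst hh' hh
    exact mulZero_matCorner _ _ _ _
      (by simp only [← Matrix.ext_iff, Fin.forall_fin_succ]; simp)
  have eφ : wordFst l = star f g := by
    subst hf hg
    apply matCorner_eq_star <;>
      (simp only [← Matrix.ext_iff, Fin.forall_fin_succ]; simp)
  have eψ : wordSnd r = star h' h := by
    subst hh hh'
    apply matCorner_eq_star <;>
      (simp only [← Matrix.ext_iff, Fin.forall_fin_succ]; simp)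
  -- The two middle factors have orthogonal idempotents, so their product is a sum and may be
  -- interchanged.
  have hcomm : star g h' = star h' g := by
    refine AlgHom.ext fun y => ?_
    rw [star_eq_add mgh mhg, star_eq_add mhg mgh, add_comm (g y)]
  have hassoc : star (wordFst l) (wordSnd r) = star (star f h') (star g h) := by
    rw [eφ, eψ, star_assoc, ← star_assoc g, hcomm, star_assoc, star_assoc]
  have hzero : MulZero (star f h') (star g h) :=
    MulZero.star_left (MulZero.star_right mfg mfh) (MulZero.star_right mhg mhh)
  -- The half `f`, `h'` never leaves state `0`, and the half `g`, `h` never enters state `2`; both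
  -- conditions define subalgebras.
  have h1 : star f h' x ∈ firstRowSubalgebra R P := star_mem_subalgebra _
    (fun y => by subst hf; constructor <;> simp [matCorner_apply])
    (fun y => by subst hh'; constructor <;> simp [matCorner_apply]) x
  have h2 : star g h x ∈ lastColSubalgebra R P := star_mem_subalgebra _
    (fun y => by subst hg; constructor <;> simp [matCorner_apply])
    (fun y => by subst hh; constructor <;> simp [matCorner_apply]) x
  have h3 : star (wordFst l) (wordSnd r) x = star f h' x + star g h x -
      algebraMap R _ (A.aug x) := by
    rw [hassoc]; exact star_of_mem_prim hzero hx
  rw [h3, Matrix.sub_apply, Matrix.add_apply, h1.2, h2.1, Matrix.algebraMap_matrix_apply]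
  simp

/-- The linear map `a ⊗ b ↦ l(a) r(b)`. -/
def mulMap : A.carrier ⊗[R] A.carrier →ₗ[R] P :=
  LinearMap.mul' R P ∘ₗ TensorProduct.map l.toLinearMap r.toLinearMap

theorem mulMap_tmul (a b : A.carrier) : mulMap l r (a ⊗ₜ b) = l a * r b := rfl

theorem mulMap_mul (s : A.carrier ⊗[R] A.carrier) (b : A.carrier) :
    mulMap l r s * r b = mulMap l r (s * (1 ⊗ₜ b)) := by
  induction s with
  | zero => simp
  | tmul a c => simp [mulMap_tmul, mul_assoc]
  | add a c ha hc => rw [map_add, add_mul, ha, hc, add_mul, map_add]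

/-- The elements of the coproduct for which the first row of the detecting matrix has entries of
the expected shape. -/
def wordSubmodule : Submodule R (coprod A.toConnAlg A.toConnAlg).carrier where
  carrier := {t | coprodLift (wordFst l) (wordSnd r) t 0 0 ∈ LinearMap.range l.toLinearMap ∧
    coprodLift (wordFst l) (wordSnd r) t 0 1 ∈ LinearMap.range (mulMap l r) ∧
    coprodLift (wordFst l) (wordSnd r) t 0 0 + coprodLift (wordFst l) (wordSnd r) t 0 1 +
      coprodLift (wordFst l) (wordSnd r) t 0 2 = coprodLift l r t}
  add_mem' := by
    rintro s t ⟨h1, h2, h3⟩ ⟨h1', h2', h3'⟩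
    have e : ∀ i j, coprodLift (wordFst l) (wordSnd r) (s + t) i j =
      coprodLift (wordFst l) (wordSnd r) s i j + coprodLift (wordFst l) (wordSnd r) t i j :=
      fun i j => by rw [map_add]; rfl
    refine ⟨?_, ?_, ?_⟩
    · rw [e]; exact add_mem h1 h1'
    · rw [e]; exact add_mem h2 h2'
    · rw [e, e, e, map_add, ← h3, ← h3']
      abel
  zero_mem' := by
    refine ⟨⟨0, ?_⟩, ⟨0, ?_⟩, ?_⟩ <;> simp
  smul_mem' := by
    rintro c t ⟨h1, h2, h3⟩
    have e : ∀ i j, coprodLift (wordFst l) (wordSnd r) (c • t) i j =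
      c • coprodLift (wordFst l) (wordSnd r) t i j := fun i j => by rw [map_smul]; rfl
    refine ⟨?_, ?_, ?_⟩
    · rw [e]; exact Submodule.smul_mem _ _ h1
    · rw [e]; exact Submodule.smul_mem _ _ h2
    · rw [e, e, e, map_smul, ← h3]
      module

/-- The transition rules preserve the three conditions: a letter of either factor keeps the row sum
equal to the value of the word, and the first two places keep the shapes `l(y)` and `∑ l(y) r(z)`.
-/
theorem mem_wordSubmodule (t : (coprod A.toConnAlg A.toConnAlg).carrier) :
    t ∈ wordSubmodule l r := by
  refine mem_of_mul_mem ?_ ?_ ?_ t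
  · refine ⟨⟨1, ?_⟩, ⟨0, ?_⟩, ?_⟩ <;> simp
  · rintro t ⟨h1, h2, h3⟩ y
    change _ ∧ _ ∧ _
    rw [map_mul, map_mul, coprodLift_inl, coprodLift_inl]
    rw [← h3]
    generalize coprodLift (wordFst l) (wordSnd r) t = M at h1 h2 ⊢
    have e0 : (M * wordFst l y) 0 0 = M 0 0 * l y := by
      rw [wordFst, mul_matCorner_apply]
      simp [Fin.sum_univ_three]
    have e1 : (M * wordFst l y) 0 1 = A.aug y • M 0 1 := by
      rw [wordFst, mul_matCorner_apply]
      simp [Fin.sum_univ_three]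
    have e2 : (M * wordFst l y) 0 2 = M 0 1 * l y + M 0 2 * l y - A.aug y • M 0 1 := by
      rw [wordFst, mul_matCorner_apply]
      simp [Fin.sum_univ_three]
      abel
    refine ⟨?_, ?_, ?_⟩
    · rw [e0]
      obtain ⟨z, hz⟩ := h1
      exact ⟨z * y, by rw [← hz]; simp⟩
    · rw [e1]; exact Submodule.smul_mem _ _ h2
    · rw [e0, e1, e2, add_mul, add_mul]
      abel
  · rintro t ⟨h1, h2, h3⟩ y
    change _ ∧ _ ∧ _
    rw [map_mul, map_mul, coprodLift_inr, coprodLift_inr]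
    rw [← h3]
    generalize coprodLift (wordFst l) (wordSnd r) t = M at h1 h2 ⊢
    have e0 : (M * wordSnd r y) 0 0 = A.aug y • M 0 0 := by
      rw [wordSnd, mul_matCorner_apply]
      simp [Fin.sum_univ_three]
    have e1 : (M * wordSnd r y) 0 1 = M 0 0 * r y + M 0 1 * r y - A.aug y • M 0 0 := by
      rw [wordSnd, mul_matCorner_apply]
      simp [Fin.sum_univ_three]
      abel
    have e2 : (M * wordSnd r y) 0 2 = M 0 2 * r y := by
      rw [wordSnd, mul_matCorner_apply]
      simp [Fin.sum_univ_three]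
    obtain ⟨z, hz⟩ := h1
    have hz' : mulMap l r (z ⊗ₜ 1) = M 0 0 := by rw [mulMap_tmul, map_one, mul_one]; exact hz
    obtain ⟨w, hw⟩ := h2
    refine ⟨?_, ?_, ?_⟩
    · rw [e0, ← hz]; exact Submodule.smul_mem _ _ ⟨z, rfl⟩
    · rw [e1, ← hz', ← hw, mulMap_mul, mulMap_mul]
      exact sub_mem (add_mem ⟨_, rfl⟩ ⟨_, rfl⟩) (Submodule.smul_mem _ _ ⟨_, rfl⟩)
    · rw [e0, e1, e2, add_mul, add_mul]
      abel

/-- On primitive elements a product of homomorphisms is a sum of products of values. -/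
theorem star_mem_range_mulMap {x : A.carrier} (hx : x ∈ A.prim) :
    star l r x ∈ LinearMap.range (mulMap l r) := by
  obtain ⟨⟨z, hz⟩, h2, h3⟩ := mem_wordSubmodule l r (Hom.toAlgHom A.comul x)
  have h4 := star_word_eq_zero l r hx
  rw [star_apply] at h4 ⊢
  -- With state `2` empty, only sums of `l(y)` and of `l(y) r(z)` remain.
  rw [← h3, h4, add_zero]
  exact add_mem ⟨z ⊗ₜ 1, by rw [mulMap_tmul, map_one, mul_one]; exact hz⟩ h2

end Words

/-! ### The unsigned comultiplication into the tensor square -/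

variable (A)

/-- The composite `A → A ∗ A → A ⊗ A` for the multiplication of `A ⊗ A` without sign. -/
def tcomul : A.carrier →ₐ[R] A.carrier ⊗[R] A.carrier :=
  star Algebra.TensorProduct.includeLeft Algebra.TensorProduct.includeRight

variable {A}

theorem coprodLift_mulMap (f g : A.carrier →ₐ[R] Q) (d : A.carrier ⊗[R] A.carrier) :
    coprodLift f g (mulMap (Hom.toAlgHom (inl A.toConnAlg A.toConnAlg))
      (Hom.toAlgHom (inr A.toConnAlg A.toConnAlg)) d) = mulMap f g d := by
  induction d with
  | zero => simp
  | tmul a b => simp [mulMap_tmul]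
  | add a b ha hb => simp only [map_add, ha, hb]

theorem mulMap_include (d : A.carrier ⊗[R] A.carrier) :
    mulMap (Algebra.TensorProduct.includeLeft : A.carrier →ₐ[R] A.carrier ⊗[R] A.carrier)
      Algebra.TensorProduct.includeRight d = d := by
  induction d with
  | zero => simp
  | tmul a b => simp [mulMap_tmul]
  | add a b ha hb => simp only [map_add, ha, hb]

theorem star_inl_inr (A : AlgComon R) : star (Hom.toAlgHom (inl A.toConnAlg A.toConnAlg))
    (Hom.toAlgHom (inr A.toConnAlg A.toConnAlg)) = Hom.toAlgHom A.comul := by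
  have h : coprodLift (Hom.toAlgHom (inl A.toConnAlg A.toConnAlg))
      (Hom.toAlgHom (inr A.toConnAlg A.toConnAlg)) = AlgHom.id R _ :=
    coprod_algHom_ext (by simp) (by simp)
  rw [star, h, AlgHom.id_comp]

/-- The comultiplication of a primitive element `x` is `∑ y' z''` for some `∑ y ⊗ z`. -/
theorem mulMap_tcomul_eq_comul {x : A.carrier} (hx : x ∈ A.prim) :
    mulMap (Hom.toAlgHom (inl A.toConnAlg A.toConnAlg))
      (Hom.toAlgHom (inr A.toConnAlg A.toConnAlg)) (A.tcomul x) = Hom.toAlgHom A.comul x := by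
  obtain ⟨d, hd⟩ := star_mem_range_mulMap (Hom.toAlgHom (inl A.toConnAlg A.toConnAlg))
    (Hom.toAlgHom (inr A.toConnAlg A.toConnAlg)) hx
  rw [star_inl_inr] at hd
  rw [tcomul, star_apply, ← hd, coprodLift_mulMap, mulMap_include]

/-- For primitive `x`, products of homomorphisms into any algebra are governed by one tensor, even
when their values do not commute. -/
theorem star_eq_tcomul (f g : A.carrier →ₐ[R] Q) {x : A.carrier} (hx : x ∈ A.prim) :
    star f g x = mulMap f g (A.tcomul x) := by
  rw [star_apply, ← mulMap_tcomul_eq_comul hx, coprodLift_mulMap]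

theorem tcomul_mem (n : ℕ) (x : A.carrier) (hx : x ∈ A.grading n) :
    A.tcomul x ∈ tensorGrading A.grading n :=
  star_mem (tensorGrading A.grading) (includeLeft_mem _) (includeRight_mem _) n x hx

/-- Associativity of `star` for the three inclusions into the triple tensor product; both sides are
algebra homomorphisms, so no elements are needed. -/
theorem tcomul_coassoc (x : A.carrier) :
    TensorProduct.assoc R A.carrier A.carrier A.carrier
      (A.tcomul.toLinearMap.rTensor A.carrier (A.tcomul x)) =
      A.tcomul.toLinearMap.lTensor A.carrier (A.tcomul x) := by
  let i₁ : A.carrier →ₐ[R] A.carrier ⊗[R] (A.carrier ⊗[R] A.carrier) :=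
    Algebra.TensorProduct.includeLeft
  let i₂ : A.carrier →ₐ[R] A.carrier ⊗[R] (A.carrier ⊗[R] A.carrier) :=
    Algebra.TensorProduct.includeRight.comp Algebra.TensorProduct.includeLeft
  let i₃ : A.carrier →ₐ[R] A.carrier ⊗[R] (A.carrier ⊗[R] A.carrier) :=
    Algebra.TensorProduct.includeRight.comp Algebra.TensorProduct.includeRight
  have h1 : ((Algebra.TensorProduct.assoc R R R A.carrier A.carrier A.carrier).toAlgHom.comp
      (Algebra.TensorProduct.map A.tcomul (AlgHom.id R A.carrier))).comp A.tcomul =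
      (Algebra.TensorProduct.map (AlgHom.id R A.carrier) A.tcomul).comp A.tcomul := by
    rw [tcomul, comp_star, comp_star]
    have e1 : ((Algebra.TensorProduct.assoc R R R A.carrier A.carrier A.carrier).toAlgHom.comp
        (Algebra.TensorProduct.map A.tcomul (AlgHom.id R A.carrier))).comp
        Algebra.TensorProduct.includeLeft =
      star i₁ i₂ := by
      rw [AlgHom.comp_assoc, Algebra.TensorProduct.map_comp_includeLeft, tcomul, comp_star,
        comp_star]
      congr 1
    have e2 : (Algebra.TensorProduct.map (AlgHom.id R A.carrier) A.tcomul).comp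
        Algebra.TensorProduct.includeRight =
      star i₂ i₃ := by
      rw [Algebra.TensorProduct.map_comp_includeRight, tcomul, comp_star]
    rw [tcomul] at e1 e2
    rw [e1, e2, star_assoc]
    congr 1
    · ext; simp [i₁]
    · congr 1; ext; simp [i₃, Algebra.TensorProduct.one_def]
  exact DFunLike.congr_fun h1 x

theorem lid_tcomul (x : A.carrier) :
    TensorProduct.lid R A.carrier (A.aug.toLinearMap.rTensor A.carrier (A.tcomul x)) = x := by
  have h : ((Algebra.TensorProduct.lid R A.carrier).toAlgHom.comp
      (Algebra.TensorProduct.map A.aug (AlgHom.id R A.carrier))).comp A.tcomul =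
      AlgHom.id R A.carrier := by
    rw [tcomul, comp_star]
    refine Eq.trans ?_ (unitHom_star (AlgHom.id R A.carrier))
    congr 1
    · ext; simp [unitHom_apply, Algebra.algebraMap_eq_smul_one]
    · ext; simp
  exact DFunLike.congr_fun h x

theorem rid_tcomul (x : A.carrier) :
    TensorProduct.rid R A.carrier (A.aug.toLinearMap.lTensor A.carrier (A.tcomul x)) = x := by
  have h : ((Algebra.TensorProduct.rid R R A.carrier).toAlgHom.comp
      (Algebra.TensorProduct.map (AlgHom.id R A.carrier) A.aug)).comp A.tcomul =
      AlgHom.id R A.carrier := by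
    rw [tcomul, comp_star]
    refine Eq.trans ?_ (star_unitHom (AlgHom.id R A.carrier))
    congr 1
    · ext; simp
    · ext; simp [unitHom_apply, Algebra.algebraMap_eq_smul_one]
  exact DFunLike.congr_fun h x

end AlgComon

end CogroupAlg

end

noncomputable section
namespace CogroupAlg

/-! ## The coalgebra of primitive elements -/

namespace AlgComon

open ConnAlg

variable {R : Type u} [CommRing R] {A : AlgComon R} {Q : Type u} [Ring Q] [Algebra R Q]

/-! ### Primitivity of the two tensor factors -/

section Corners

variable {P : Type u} [Ring P] [Algebra R P] (a₁ a₂ a₃ : A.carrier →ₐ[R] P)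

set_option maxHeartbeats 800000 in
/-- Three homomorphisms which detect the reduced deconcatenation in the first factor. -/
theorem exists_detect_fst : ∃ f g h : A.carrier →ₐ[R] Matrix (Fin 3) (Fin 3) P,
    MulZero f g ∧ MulZero g h ∧ MulZero h g ∧
    (∀ a b c, (g a * f b * h c) 0 2 = a₁ (A.pr a) * a₂ (A.pr b) * a₃ c) ∧
    ∀ a b, (f a * (g b + h b - algebraMap R _ (A.aug b))) 0 2 = 0 := by
  -- Only products in the order `g`, `f`, `h` pass from state `0` through `1` to `2`. When `f` comes
  -- first it acts on state `0` as a scalar, and the sum of `g` and `h` has no entry at `(0, 2)`.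
  refine ⟨matCorner a₂ !![0, 0, 0; 0, 1, 1; 0, 0, 0]
      (by simp only [← Matrix.ext_iff, Fin.forall_fin_succ]; simp),
    matCorner a₁ !![1, 1, 0; 0, 0, 0; 0, 0, 0]
      (by simp only [← Matrix.ext_iff, Fin.forall_fin_succ]; simp),
    matCorner a₃ !![0, 0, 0; 0, 0, 0; 0, 0, 1]
      (by simp only [← Matrix.ext_iff, Fin.forall_fin_succ]; simp),
    mulZero_matCorner _ _ _ _ (by simp only [← Matrix.ext_iff, Fin.forall_fin_succ]; simp),
    mulZero_matCorner _ _ _ _ (by simp only [← Matrix.ext_iff, Fin.forall_fin_succ]; simp),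
    mulZero_matCorner _ _ _ _ (by simp only [← Matrix.ext_iff, Fin.forall_fin_succ]; simp), ?_, ?_⟩
  · intro a b c
    simp only [Matrix.mul_apply, Fin.sum_univ_three]
    simp only [matCorner_apply]
    simp [pr_apply, Algebra.algebraMap_eq_smul_one, ← sub_eq_add_neg]
  · intro a b
    rw [Matrix.mul_apply, Fin.sum_univ_three]
    simp [matCorner_apply, Matrix.algebraMap_matrix_apply]

set_option maxHeartbeats 800000 in
/-- Three homomorphisms which detect the reduced deconcatenation in the second factor. -/
theorem exists_detect_snd : ∃ f g h : A.carrier →ₐ[R] Matrix (Fin 3) (Fin 3) P,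
    MulZero g h ∧ MulZero f g ∧ MulZero g f ∧
    (∀ a b c, (f a * (h b * g c)) 0 2 = a₁ a * (a₂ (A.pr b) * a₃ (A.pr c))) ∧
    ∀ a b, ((f a + g a - algebraMap R _ (A.aug a)) * h b) 0 2 = 0 := by
  -- Here `f` stays in state `0`, `h` leads on to state `1` and `g` to state `2`. Without `h`
  -- between them, `f` and `g` are orthogonal, and `h` on the right has no transition into state `2`
  -- from another state.
  refine ⟨matCorner a₁ !![1, 0, 0; 0, 0, 0; 0, 0, 0]
      (by simp only [← Matrix.ext_iff, Fin.forall_fin_succ]; simp),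
    matCorner a₃ !![0, 0, 0; 0, 0, 1; 0, 0, 1]
      (by simp only [← Matrix.ext_iff, Fin.forall_fin_succ]; simp),
    matCorner a₂ !![0, 1, 0; 0, 1, 0; 0, 0, 0]
      (by simp only [← Matrix.ext_iff, Fin.forall_fin_succ]; simp),
    mulZero_matCorner _ _ _ _ (by simp only [← Matrix.ext_iff, Fin.forall_fin_succ]; simp),
    mulZero_matCorner _ _ _ _ (by simp only [← Matrix.ext_iff, Fin.forall_fin_succ]; simp),
    mulZero_matCorner _ _ _ _ (by simp only [← Matrix.ext_iff, Fin.forall_fin_succ]; simp), ?_, ?_⟩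
  · intro a b c
    simp only [← mul_assoc, Matrix.mul_apply, Fin.sum_univ_three]
    simp only [matCorner_apply]
    simp [pr_apply, Algebra.algebraMap_eq_smul_one, ← sub_eq_add_neg, mul_assoc]
  · intro a b
    rw [Matrix.mul_apply, Fin.sum_univ_three]
    simp [matCorner_apply, Matrix.algebraMap_matrix_apply]

end Corners

/-- With one bracketing of three homomorphisms a matrix entry is the reduced deconcatenation of the
first tensor factor; with the other bracketing the same entry vanishes. Associativity of `star`
equates the two. -/
theorem rTensor_decBar_tcomul {x : A.carrier} (hx : x ∈ A.prim) :
    A.decBar.rTensor A.carrier (A.tcomul x) = 0 := by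
  let i₁ : A.carrier →ₐ[R] A.carrier ⊗[R] (A.carrier ⊗[R] A.carrier) :=
    Algebra.TensorProduct.includeLeft
  let i₂ : A.carrier →ₐ[R] A.carrier ⊗[R] (A.carrier ⊗[R] A.carrier) :=
    Algebra.TensorProduct.includeRight.comp Algebra.TensorProduct.includeLeft
  let i₃ : A.carrier →ₐ[R] A.carrier ⊗[R] (A.carrier ⊗[R] A.carrier) :=
    Algebra.TensorProduct.includeRight.comp Algebra.TensorProduct.includeRight
  obtain ⟨f, g, h, hfg, hgh, hhg, h₁, h₂⟩ := exists_detect_fst i₁ i₂ i₃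
  have key : ∀ s : A.carrier ⊗[R] A.carrier, mulMap (star f g) h s 0 2 =
      TensorProduct.assoc R A.carrier A.carrier A.carrier (A.decBar.rTensor A.carrier s) := by
    intro s
    induction s with
    | zero => simp
    | add s t hs ht => rw [map_add, Matrix.add_apply, hs, ht, map_add, map_add]
    | tmul y z =>
      rw [mulMap_tmul, star_eq_dec hfg, LinearMap.rTensor_tmul, decBar, LinearMap.comp_apply]
      generalize A.dec y = d
      induction d with
      | zero => simp
      | add s t hs ht =>
        rw [map_add, map_add, add_mul, Matrix.add_apply, hs, ht, map_add, add_tmul, map_add]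
      | tmul a b =>
        rw [TensorProduct.map_tmul, LinearMap.mul'_apply, AlgHom.toLinearMap_apply,
          AlgHom.toLinearMap_apply, h₁]
        simp [i₁, i₂, i₃]
  have key' : ∀ s : A.carrier ⊗[R] A.carrier, mulMap f (star g h) s 0 2 = 0 := by
    intro s
    induction s with
    | zero => simp
    | add s t hs ht => rw [map_add, Matrix.add_apply, hs, ht, add_zero]
    | tmul y z => rw [mulMap_tmul, star_eq_add hgh hhg, h₂]
  have h3 := key (A.tcomul x)
  rw [← star_eq_tcomul _ _ hx, star_assoc, star_eq_tcomul _ _ hx, key'] at h3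
  exact (TensorProduct.assoc R A.carrier A.carrier A.carrier).injective
    (h3.symm.trans (map_zero _).symm)

/-- The same comparison of bracketings, with matrices that test the second tensor factor. -/
theorem lTensor_decBar_tcomul {x : A.carrier} (hx : x ∈ A.prim) :
    A.decBar.lTensor A.carrier (A.tcomul x) = 0 := by
  let i₁ : A.carrier →ₐ[R] A.carrier ⊗[R] (A.carrier ⊗[R] A.carrier) :=
    Algebra.TensorProduct.includeLeft
  let i₂ : A.carrier →ₐ[R] A.carrier ⊗[R] (A.carrier ⊗[R] A.carrier) :=
    Algebra.TensorProduct.includeRight.comp Algebra.TensorProduct.includeLeft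
  let i₃ : A.carrier →ₐ[R] A.carrier ⊗[R] (A.carrier ⊗[R] A.carrier) :=
    Algebra.TensorProduct.includeRight.comp Algebra.TensorProduct.includeRight
  obtain ⟨f, g, h, hgh, hfg, hgf, h₁, h₂⟩ := exists_detect_snd i₁ i₂ i₃
  have key : ∀ s : A.carrier ⊗[R] A.carrier, mulMap f (star g h) s 0 2 =
      A.decBar.lTensor A.carrier s := by
    intro s
    induction s with
    | zero => simp
    | add s t hs ht => rw [map_add, Matrix.add_apply, hs, ht, map_add]
    | tmul y z =>
      rw [mulMap_tmul, star_eq_dec hgh, LinearMap.lTensor_tmul, decBar, LinearMap.comp_apply]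
      generalize A.dec z = d
      induction d with
      | zero => simp
      | add s t hs ht =>
        rw [map_add, map_add, mul_add, Matrix.add_apply, hs, ht, map_add, tmul_add]
      | tmul a b =>
        rw [TensorProduct.map_tmul, LinearMap.mul'_apply, AlgHom.toLinearMap_apply,
          AlgHom.toLinearMap_apply, h₁]
        simp [i₁, i₂, i₃]
  have key' : ∀ s : A.carrier ⊗[R] A.carrier, mulMap (star f g) h s 0 2 = 0 := by
    intro s
    induction s with
    | zero => simp
    | add s t hs ht => rw [map_add, Matrix.add_apply, hs, ht, add_zero]
    | tmul y z => rw [mulMap_tmul, star_eq_add hfg hgf, h₂]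
  have h3 := key (A.tcomul x)
  rwa [← star_eq_tcomul _ _ hx, ← star_assoc, star_eq_tcomul _ _ hx, key', eq_comm] at h3

theorem primProj_eq_comp (A : AlgComon R) : A.primProj = LinearMap.id +
    (LinearMap.mul' R A.carrier ∘ₗ TensorProduct.map A.antip LinearMap.id) ∘ₗ A.decBar :=
  LinearMap.ext primProj_eq

/-- The comultiplication of a primitive element lies in the tensor product of the primitive
elements. -/
theorem map_primProj_tcomul {x : A.carrier} (hx : x ∈ A.prim) :
    TensorProduct.map A.primProj A.primProj (A.tcomul x) = A.tcomul x := by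
  -- The difference between `primProj` and the identity factors through `decBar`, which kills each
  -- tensor factor.
  have h1 : A.primProj.rTensor A.carrier (A.tcomul x) = A.tcomul x := by
    rw [primProj_eq_comp, LinearMap.rTensor_add, LinearMap.add_apply, LinearMap.rTensor_comp,
      LinearMap.comp_apply, rTensor_decBar_tcomul hx, map_zero, add_zero, LinearMap.rTensor_id]
    rfl
  have h2 : A.primProj.lTensor A.carrier (A.tcomul x) = A.tcomul x := by
    rw [primProj_eq_comp, LinearMap.lTensor_add, LinearMap.add_apply, LinearMap.lTensor_comp,
      LinearMap.comp_apply, lTensor_decBar_tcomul hx, map_zero, add_zero, LinearMap.lTensor_id]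
    rfl
  rw [← LinearMap.lTensor_comp_rTensor, LinearMap.comp_apply, h1, h2]

/-! ### The coalgebra structure on the primitive elements -/

variable (A) in
/-- The projection onto the submodule of primitive elements. -/
def toPrim : A.carrier →ₗ[R] A.prim := A.primProj.codRestrict A.prim primProj_mem_prim

theorem toPrim_coe (x : A.prim) : A.toPrim x = x := Subtype.ext (primProj_of_mem x.2)

variable (A) in
/-- The comultiplication on the submodule of primitive elements. -/
def primComul : A.prim →ₗ[R] A.prim ⊗[R] A.prim :=
  TensorProduct.map A.toPrim A.toPrim ∘ₗ A.tcomul.toLinearMap ∘ₗ A.prim.subtype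

theorem map_primComul (x : A.prim) :
    TensorProduct.map A.prim.subtype A.prim.subtype (A.primComul x) = A.tcomul x := by
  refine Eq.trans ?_ (map_primProj_tcomul x.2)
  rw [primComul, LinearMap.comp_apply, ← LinearMap.comp_apply, ← TensorProduct.map_comp]
  rfl

theorem toPrim_comp_subtype : A.toPrim ∘ₗ A.prim.subtype = LinearMap.id :=
  LinearMap.ext toPrim_coe

theorem algebraMap_mem_prim (r : R) : algebraMap R A.carrier r ∈ A.prim := by
  rw [Algebra.algebraMap_eq_smul_one]
  exact Submodule.smul_mem _ _ one_mem_prim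

variable (A)

/-- The connected graded coalgebra of primitive elements for the deconcatenation. -/
def primCoalg : ConnCoalg R where
  carrier := A.prim
  coalgebra :=
    { comul := A.primComul
      counit := A.aug.toLinearMap ∘ₗ A.prim.subtype
      coassoc := by
        refine LinearMap.ext fun x => ?_
        -- No flatness is available, but the inclusion of the primitive elements is split by
        -- `toPrim`, so its tensor powers are injective and identities may be checked in `A`.
        have hinj : Function.LeftInverse (TensorProduct.map A.toPrim
            (TensorProduct.map A.toPrim A.toPrim))
            (TensorProduct.map A.prim.subtype
              (TensorProduct.map A.prim.subtype A.prim.subtype)) := by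
          intro d
          rw [← LinearMap.comp_apply, ← TensorProduct.map_comp, ← TensorProduct.map_comp,
            toPrim_comp_subtype, TensorProduct.map_id, TensorProduct.map_id, LinearMap.id_apply]
        apply hinj.injective
        have e1 : ∀ d : A.prim ⊗[R] A.prim,
            TensorProduct.map A.prim.subtype (TensorProduct.map A.prim.subtype A.prim.subtype)
              (TensorProduct.assoc R A.prim A.prim A.prim (A.primComul.rTensor A.prim d)) =
            TensorProduct.assoc R A.carrier A.carrier A.carrier
              (A.tcomul.toLinearMap.rTensor A.carrier
                (TensorProduct.map A.prim.subtype A.prim.subtype d)) := by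
          intro d
          induction d with
          | zero => simp
          | add a b ha hb => simp only [map_add, ha, hb]
          | tmul a b =>
            rw [LinearMap.rTensor_tmul, TensorProduct.map_tmul, LinearMap.rTensor_tmul,
              AlgHom.toLinearMap_apply, Submodule.subtype_apply, ← map_primComul]
            generalize A.primComul a = s
            induction s with
            | zero => simp
            | add a b ha hb => simp only [map_add, add_tmul, ha, hb]
            | tmul a b => simp
        have e2 : ∀ d : A.prim ⊗[R] A.prim,
            TensorProduct.map A.prim.subtype (TensorProduct.map A.prim.subtype A.prim.subtype)
              (A.primComul.lTensor A.prim d) =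
              (A.tcomul.toLinearMap.lTensor A.carrier
                (TensorProduct.map A.prim.subtype A.prim.subtype d)) := by
          intro d
          induction d with
          | zero => simp
          | add a b ha hb => simp only [map_add, ha, hb]
          | tmul a b =>
            rw [LinearMap.lTensor_tmul, TensorProduct.map_tmul, TensorProduct.map_tmul,
              LinearMap.lTensor_tmul, AlgHom.toLinearMap_apply, map_primComul]
            rfl
        refine (e1 _).trans (Eq.trans ?_ (e2 _).symm)
        rw [map_primComul]
        exact tcomul_coassoc _
      rTensor_counit_comp_comul := by
        refine LinearMap.ext fun x => (TensorProduct.lid R A.prim).injective (Subtype.ext ?_)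
        have e : ∀ d : A.prim ⊗[R] A.prim,
            A.prim.subtype (TensorProduct.lid R A.prim
              ((A.aug.toLinearMap ∘ₗ A.prim.subtype).rTensor A.prim d)) =
            TensorProduct.lid R A.carrier (A.aug.toLinearMap.rTensor A.carrier
              (TensorProduct.map A.prim.subtype A.prim.subtype d)) := by
          intro d
          induction d with
          | zero => simp
          | add a b ha hb => simp only [map_add, ha, hb]
          | tmul a b => simp
        refine (e _).trans ?_
        rw [map_primComul, lid_tcomul]
        simp
      lTensor_counit_comp_comul := by
        refine LinearMap.ext fun x => (TensorProduct.rid R A.prim).injective (Subtype.ext ?_)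
        have e : ∀ d : A.prim ⊗[R] A.prim,
            A.prim.subtype (TensorProduct.rid R A.prim
              ((A.aug.toLinearMap ∘ₗ A.prim.subtype).lTensor A.prim d)) =
            TensorProduct.rid R A.carrier (A.aug.toLinearMap.lTensor A.carrier
              (TensorProduct.map A.prim.subtype A.prim.subtype d)) := by
          intro d
          induction d with
          | zero => simp
          | add a b ha hb => simp only [map_add, ha, hb]
          | tmul a b => simp
        refine (e _).trans ?_
        rw [map_primComul, rid_tcomul]
        simp }
  grading n := (A.grading n).comap A.prim.subtype
  decomposition := retractDecomposition A.grading A.prim.subtype A.toPrim toPrim_coe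
    (fun n x hx => primProj_mem n x hx)
  comul_mem n x hx := map_mem_tensorGrading A.toPrim (𝒩 := fun n => (A.grading n).comap A.prim.subtype)
    (fun n x hx => primProj_mem n x hx) (tcomul_mem n (x : A.carrier) hx :
      (A.tcomul.toLinearMap ∘ₗ A.prim.subtype) x ∈ tensorGrading A.grading n)
  counit_eq_zero n x hn hx := A.aug_of_mem hn hx
  connected := by
    constructor
    · rintro ⟨x, hx⟩ ⟨y, hy⟩ h
      have := @(counit_bijective A.toConnAlg).1 ⟨x, hx⟩ ⟨y, hy⟩ h
      exact Subtype.ext (Subtype.ext (Subtype.mk.inj this))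
    · intro r
      exact ⟨⟨⟨algebraMap R A.carrier r, algebraMap_mem_prim r⟩,
        SetLike.algebraMap_mem_graded A.grading r⟩, A.aug.commutes r⟩

end AlgComon

end CogroupAlg

end

noncomputable section
namespace CogroupAlg

/-! ## Every comonoid is a tensor algebra -/

variable {R : Type u} [CommRing R]

/-- Left multiplications by generators generate the tensor algebra. -/
theorem ConnCoalg.tensor_mem_of_mul_mem {C : ConnCoalg R} {S : Submodule R C.tensor.carrier}
    (h1 : 1 ∈ S) (h : ∀ c, Coalgebra.counit (R := R) c = 0 → ∀ t ∈ S, C.gen c * t ∈ S)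
    (t : C.tensor.carrier) : t ∈ S := by
  have key : ∀ t : TensorAlgebra R C.pos, ∀ s : C.tensor.carrier, s ∈ S →
      (show C.tensor.carrier from t) * s ∈ S := by
    intro t
    induction t using TensorAlgebra.induction with
    | algebraMap r =>
      intro s hs
      have e : (algebraMap R C.tensor.carrier r) * s = r • s := (Algebra.smul_def r s).symm
      exact Eq.mpr (congrArg (· ∈ S) e) (Submodule.smul_mem _ _ hs)
    | ι x =>
      intro s hs
      have := h x (C.counit_pos x) s hs
      rwa [C.gen_coe] at this
    | mul a b ha hb =>
      intro s hs
      have := ha _ (hb s hs)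
      exact Eq.mpr (congrArg (· ∈ S) (mul_assoc (G := C.tensor.carrier) a b s)) this
    | add a b ha hb =>
      intro s hs
      exact Eq.mpr (congrArg (· ∈ S) (add_mul (R := C.tensor.carrier) a b s))
        (add_mem (ha s hs) (hb s hs))
  have := key t 1 h1
  exact Eq.mp (congrArg (· ∈ S) (mul_one (M := C.tensor.carrier) t)) this

namespace AlgComon

open ConnAlg

variable (A : AlgComon R)

/-- The inclusion of the primitive elements. -/
def primIncl : A.primCoalg.carrier →ₗ[R] A.carrier := A.prim.subtype

theorem isG_primIncl : ConnCoalg.IsG A.toConnAlg A.primIncl where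
  map_mem _ _ hx := hx
  map_zero x hx := by
    obtain ⟨r, hr⟩ := A.exists_scalar _ hx
    have h : A.primIncl x = algebraMap R A.carrier r := hr.symm
    have h' : Coalgebra.counit (R := R) x = A.aug (A.primIncl x) := rfl
    rw [h', h, AlgHom.commutes]
    rfl

/-- The homomorphism from the tensor algebra on the primitive elements, as a homomorphism of
algebras. -/
def ofPrimHom : A.primCoalg.tensor ⟶ A.toConnAlg := ConnCoalg.extend A.primIncl A.isG_primIncl

theorem ofPrimHom_gen (c : A.primCoalg.carrier) :
    Hom.toAlgHom A.ofPrimHom (A.primCoalg.gen c) = A.primIncl c :=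
  DFunLike.congr_fun (ConnCoalg.extend_gen A.primIncl A.isG_primIncl) c

theorem map_primIncl_comul (c : A.primCoalg.carrier) :
    TensorProduct.map A.primIncl A.primIncl (Coalgebra.comul (R := R) c) =
      A.tcomul (A.primIncl c) := map_primComul c

/-- On a generator `c` both sides are the sum `∑ y' z''` given by `tcomul c`: on the left by the
definition of the tensor algebra, on the right because `c` is primitive in `A`. -/
theorem ofPrimHom_comul : A.primCoalg.tensorComul ≫ coprodMap A.ofPrimHom A.ofPrimHom =
    A.ofPrimHom ≫ A.comul := by
  apply ConnCoalg.tensor_hom_ext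
  rw [ConnCoalg.tensorComul_gen, coprodMap, inl_desc, inr_desc]
  ext c
  have e1 : (Hom.toAlgHom (A.ofPrimHom ≫ inl A.toConnAlg A.toConnAlg)).toLinearMap ∘ₗ
      A.primCoalg.gen = (Hom.toAlgHom (inl A.toConnAlg A.toConnAlg)).toLinearMap ∘ₗ A.primIncl :=
    LinearMap.ext fun c => congrArg (Hom.toAlgHom (inl A.toConnAlg A.toConnAlg))
      (A.ofPrimHom_gen c)
  have e2 : (Hom.toAlgHom (A.ofPrimHom ≫ inr A.toConnAlg A.toConnAlg)).toLinearMap ∘ₗ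
      A.primCoalg.gen = (Hom.toAlgHom (inr A.toConnAlg A.toConnAlg)).toLinearMap ∘ₗ A.primIncl :=
    LinearMap.ext fun c => congrArg (Hom.toAlgHom (inr A.toConnAlg A.toConnAlg))
      (A.ofPrimHom_gen c)
  have e3 : (Hom.toAlgHom (A.ofPrimHom ≫ A.comul)) (A.primCoalg.gen c) =
      Hom.toAlgHom A.comul (A.primIncl c) := congrArg (Hom.toAlgHom A.comul) (A.ofPrimHom_gen c)
  rw [e1, e2]
  refine Eq.trans ?_ e3.symm
  have hc : A.primIncl c ∈ A.prim := Subtype.property (p := (· ∈ A.prim)) c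
  rw [← mulMap_tcomul_eq_comul hc, ← map_primIncl_comul, mulMap, ConnCoalg.conv,
    TensorProduct.map_comp]
  rfl

/-- The homomorphism from the tensor algebra on the primitive elements. -/
def ofPrim : A.primCoalg.tensorComon ⟶ A := ⟨A.ofPrimHom, A.ofPrimHom_comul⟩

/-- The antipode of the deconcatenation, with values in the generators of the tensor algebra. -/
def genAntip : A.carrier →ₗ[R] A.primCoalg.tensor.carrier :=
  A.primCoalg.gen ∘ₗ (A.antip.codRestrict A.prim antip_mem_prim :
    A.carrier →ₗ[R] A.primCoalg.carrier)

theorem ofPrimHom_genAntip :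
    (Hom.toAlgHom A.ofPrimHom).toLinearMap ∘ₗ A.genAntip = A.antip :=
  LinearMap.ext fun _ => A.ofPrimHom_gen _

/-- Inverting the lifted antipode in the convolution algebra with values in the tensor algebra
produces the candidate for the inverse of `ofPrim`. -/
theorem exists_ofPrim_inverse : ∃ J : A.carrier →ₗ[R] A.primCoalg.tensor.carrier,
    dconv A.genAntip J = (A.unitHom _).toLinearMap ∧ dconv J A.genAntip = (A.unitHom _).toLinearMap ∧
    J 1 = 1 := by
  obtain ⟨J, h1, h2, _, h4⟩ := exists_dconv_inverse (A := A) (B := A.primCoalg.tensor) A.genAntip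
    (fun n x hx => A.primCoalg.isG_gen.map_mem n _ (antip_mem n x hx)) (fun x hx => by
      refine (A.primCoalg.isG_gen.map_zero _ (antip_mem 0 x hx)).trans ?_
      exact congrArg _ (aug_antip x))
  refine ⟨J, h1, h2, ?_⟩
  rw [h4 1 SetLike.GradedOne.one_mem, map_one, map_one]

/-- Two-sided inverse `J`: it is a section because `ofPrim ∘ J` and the identity are both
convolution inverses of `antip`, and a retraction because it commutes with left multiplication by
generators. -/
theorem ofPrim_bijective : Function.Bijective (Hom.toAlgHom (Hom.hom A.ofPrim)) := by
  obtain ⟨J, h1, h2, hJ1⟩ := A.exists_ofPrim_inverse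
  have hright : (Hom.toAlgHom A.ofPrimHom).toLinearMap ∘ₗ J = LinearMap.id := by
    refine (dconv_left_inv_eq id_dconv_antip ?_).symm
    rw [← ofPrimHom_genAntip, ← comp_dconv, h1, comp_unitHom]
  -- Evaluate `genAntip * J = ε` at `c x`: by `dec_mul` and `antip_mul` only `J (c x)` and `-c J x`
  -- occur.
  have hmul : ∀ c : A.primCoalg.carrier, Coalgebra.counit (R := R) c = 0 → ∀ x : A.carrier,
      J (A.primIncl c * x) = A.primCoalg.gen c * J x := by
    intro c hc0 x
    have hc : A.primIncl c ∈ A.prim := Subtype.property (p := (· ∈ A.prim)) c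
    have h := DFunLike.congr_fun h1 (A.primIncl c * x)
    rw [dconv_apply, dec_mul hc hc0, map_add, map_add, AlgHom.toLinearMap_apply, unitHom_apply,
      map_mul A.aug, show A.aug (A.primIncl c) = 0 from hc0, zero_mul, map_zero,
      TensorProduct.map_tmul, LinearMap.mul'_apply] at h
    have hg1 : A.genAntip 1 = 1 := by
      refine (A.primCoalg.isG_gen.map_zero _ (antip_mem 0 1 SetLike.GradedOne.one_mem)).trans ?_
      refine (congrArg _ (aug_antip (A := A) 1)).trans ?_
      rw [map_one, map_one]
    have hgc : ∀ y, A.genAntip (A.primIncl c * y) = -(A.aug y • A.primCoalg.gen c) := by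
      intro y
      rw [← map_smul, ← map_neg]
      refine congrArg A.primCoalg.gen (Subtype.ext ?_)
      exact antip_mul hc hc0 y
    have key : ∀ d : A.carrier ⊗[R] A.carrier,
        LinearMap.mul' R _ (TensorProduct.map A.genAntip J ((A.primIncl c ⊗ₜ 1) * d)) =
        -(A.primCoalg.gen c * J (TensorProduct.lid R A.carrier
          (TensorProduct.map A.aug.toLinearMap LinearMap.id d))) := by
      intro d
      induction d with
      | zero => simp
      | add a b ha hb =>
        rw [mul_add, map_add, map_add, ha, hb, map_add, map_add, map_add, mul_add, neg_add]
      | tmul a b => simp [hgc]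
    rw [key, lid_dec, hg1, one_mul] at h
    exact (neg_add_eq_zero.1 h).symm
  have hleft : ∀ t : A.primCoalg.tensor.carrier, J (Hom.toAlgHom A.ofPrimHom t) = t := by
    intro t
    refine ConnCoalg.tensor_mem_of_mul_mem (S := LinearMap.eqLocus
      (J ∘ₗ (Hom.toAlgHom A.ofPrimHom).toLinearMap) LinearMap.id) ?_ ?_ t
    · change J (Hom.toAlgHom A.ofPrimHom 1) = 1
      rw [map_one, hJ1]
    · intro c hc s hs
      have hs : J (Hom.toAlgHom A.ofPrimHom s) = s := hs
      change J (Hom.toAlgHom A.ofPrimHom (_ * s)) = _ * s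
      rw [map_mul, ofPrimHom_gen, hmul c hc, hs]
  exact ⟨Function.LeftInverse.injective hleft,
    Function.RightInverse.surjective (DFunLike.congr_fun hright)⟩

/-- A comonoid is isomorphic to the tensor algebra on its primitive elements. -/
def ofPrimIso : A.primCoalg.tensorComon ≅ A := isoOfBijective A.ofPrim A.ofPrim_bijective

end AlgComon

end CogroupAlg

end

noncomputable section
namespace CogroupAlg

/-! ## The tensor algebra functor is fully faithful -/

variable {R : Type u} [CommRing R]

namespace AlgComon

open ConnAlg

variable {A B : AlgComon R}

/-- The homomorphism of algebras underlying a homomorphism of comonoids. -/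
def mapHom (k : A ⟶ B) : A.carrier →ₐ[R] B.carrier := ConnAlg.Hom.toAlgHom (Hom.hom k)

theorem aug_mapHom (k : A ⟶ B) (x : A.carrier) : B.aug (mapHom k x) = A.aug x :=
  DFunLike.congr_fun (aug_comp (Hom.hom k)) x

theorem mapHom_mem (k : A ⟶ B) (n : ℕ) (x : A.carrier) (hx : x ∈ A.grading n) :
    mapHom k x ∈ B.grading n := (Hom.hom k).map_mem n x hx

theorem rowSum_decSnd_mul_decFst (a b : A.carrier) :
    rowSum R 2 _ (A.decSnd a * A.decFst b) = a ⊗ₜ b := by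
  rw [rowSum_apply, Fin.sum_univ_two, Matrix.mul_apply, Matrix.mul_apply, Fin.sum_univ_two,
    Fin.sum_univ_two]
  simp only [decSnd, decFst, matCorner_apply]
  simp [mul_add]

/-- The deconcatenation is built from `star`, which is natural in the comonoid, and vanishing
products pull back because augmentations are preserved. -/
theorem dec_mapHom (k : A ⟶ B) (x : A.carrier) :
    B.dec (mapHom k x) = TensorProduct.map (mapHom k).toLinearMap (mapHom k).toLinearMap
      (A.dec x) := by
  have h : MulZero (B.decFst.comp (mapHom k)) (B.decSnd.comp (mapHom k)) := fun a b ha hb =>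
    B.mulZero_decFst_decSnd _ _ ((aug_mapHom k a).trans ha) ((aug_mapHom k b).trans hb)
  have h1 : B.decHom (mapHom k x) =
      star (B.decFst.comp (mapHom k)) (B.decSnd.comp (mapHom k)) x :=
    DFunLike.congr_fun (star_comp k B.decFst B.decSnd) x
  rw [dec, LinearMap.comp_apply, AlgHom.toLinearMap_apply, h1, star_eq_dec h]
  generalize A.dec x = d
  induction d with
  | zero => simp
  | add a b ha hb => simp only [map_add, ha, hb]
  | tmul a b =>
    rw [TensorProduct.map_tmul, LinearMap.mul'_apply]
    exact rowSum_decSnd_mul_decFst _ _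

theorem mapHom_mem_prim (k : A ⟶ B) {x : A.carrier} (hx : x ∈ A.prim) : mapHom k x ∈ B.prim := by
  apply mem_prim_of_dec
  rw [dec_mapHom, dec_of_mem_prim hx, aug_mapHom]
  simp

theorem tcomul_mapHom (k : A ⟶ B) (x : A.carrier) :
    B.tcomul (mapHom k x) = TensorProduct.map (mapHom k).toLinearMap (mapHom k).toLinearMap
      (A.tcomul x) := by
  have h1 : B.tcomul.comp (mapHom k) =
      (Algebra.TensorProduct.map (mapHom k) (mapHom k)).comp A.tcomul := by
    refine (star_comp k _ _).trans ?_
    rw [tcomul, comp_star]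
    congr 1
    · ext; simp [mapHom]
    · ext; simp [mapHom]
  exact DFunLike.congr_fun h1 x

end AlgComon

/-! ### Recovering a coalgebra from its tensor algebra -/

namespace ConnCoalg

open ConnAlg AlgComon

variable (C : ConnCoalg R) {Q : Type u} [Ring Q] [Algebra R Q]

/-- The canonical map from a coalgebra to the comonoid `T_CM(C)`. -/
def tgen : C.carrier →ₗ[R] C.tensorComon.carrier := C.gen

theorem aug_tgen (x : C.carrier) : C.tensorComon.aug (C.tgen x) = Coalgebra.counit (R := R) x :=
  C.tensor.algebraMap_injective (DFunLike.congr_fun (C.triv_gen C.tensor) x)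

theorem tgen_mem (n : ℕ) (x : C.carrier) (hx : x ∈ C.grading n) :
    C.tgen x ∈ C.tensorComon.grading n := C.isG_gen.map_mem n x hx

/-- The unit of a connected coalgebra. -/
def unitElt : C.carrier := ((C.connected.2 1).choose : C.grading 0)

theorem unitElt_mem : C.unitElt ∈ C.grading 0 := (C.connected.2 1).choose.2

theorem counit_unitElt : Coalgebra.counit (R := R) C.unitElt = 1 := (C.connected.2 1).choose_spec

theorem projZero_eq (x : C.carrier) : C.projZero x = Coalgebra.counit (R := R) x • C.unitElt := by
  have h0 := C.counit_pos (C.projPos x)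
  rw [coe_projPos, map_sub, sub_eq_zero] at h0
  have := @C.connected.1 ⟨_, C.projZero_mem x⟩
    ⟨Coalgebra.counit (R := R) x • C.unitElt, Submodule.smul_mem _ _ C.unitElt_mem⟩
    (by simp [counit_unitElt, h0])
  exact congrArg Subtype.val this

theorem tgen_unitElt : C.tgen C.unitElt = 1 := by
  refine (C.isG_gen.map_zero _ C.unitElt_mem).trans ?_
  rw [counit_unitElt, map_one]
  rfl

/-- A retraction of the canonical map from a coalgebra to its tensor algebra. -/
def tgenInv : C.tensorComon.carrier →ₗ[R] C.carrier :=
  (LinearMap.toSpanSingleton R C.carrier C.unitElt ∘ₗ TensorAlgebra.algebraMapInv.toLinearMap +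
    C.pos.subtype ∘ₗ TensorAlgebra.ιInv : TensorAlgebra R C.pos →ₗ[R] C.carrier)

theorem tgenInv_tgen (x : C.carrier) : C.tgenInv (C.tgen x) = x := by
  have h1 : TensorAlgebra.algebraMapInv (algebraMap R (TensorAlgebra R C.pos)
      (Coalgebra.counit (R := R) x) + TensorAlgebra.ι R (C.projPos x)) =
      Coalgebra.counit (R := R) x := by
    simp [TensorAlgebra.algebraMapInv]
  have h2 : TensorAlgebra.ιInv (algebraMap R (TensorAlgebra R C.pos)
      (Coalgebra.counit (R := R) x) + TensorAlgebra.ι R (C.projPos x)) = C.projPos x := by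
    rw [map_add, TensorAlgebra.ι_leftInverse]
    simp [TensorAlgebra.ιInv, TensorAlgebra.toTrivSqZeroExt, TrivSqZeroExt.algebraMap_eq_inl]
  refine (congrArg₂ (fun r y => r • C.unitElt + (y : C.pos)) h1 h2 :).trans ?_
  rw [coe_projPos, projZero_eq]
  abel

theorem tgen_injective : Function.Injective C.tgen := Function.LeftInverse.injective C.tgenInv_tgen

theorem tgenInv_comp_tgen : C.tgenInv ∘ₗ C.tgen = LinearMap.id := LinearMap.ext C.tgenInv_tgen

theorem map_tgen_injective : Function.Injective (TensorProduct.map C.tgen C.tgen) := by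
  refine Function.LeftInverse.injective (g := TensorProduct.map C.tgenInv C.tgenInv) fun d => ?_
  rw [← LinearMap.comp_apply, ← TensorProduct.map_comp, tgenInv_comp_tgen, TensorProduct.map_id,
    LinearMap.id_apply]

variable {C}

/-- The comultiplication of the tensor algebra was defined as the convolution of the two inclusions,
so on generators `star` is convolution over `C`. -/
theorem star_tgen (f g : C.tensorComon.carrier →ₐ[R] Q) :
    (star f g).toLinearMap ∘ₗ C.tgen =
      conv (f.toLinearMap ∘ₗ C.tgen) (g.toLinearMap ∘ₗ C.tgen) := by
  have h := extend_gen (conv ((Hom.toAlgHom (inl C.tensor C.tensor)).toLinearMap ∘ₗ C.gen)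
      ((Hom.toAlgHom (inr C.tensor C.tensor)).toLinearMap ∘ₗ C.gen))
    ((C.isG_gen.comp _).conv (C.isG_gen.comp _))
  have h2 := congrArg (fun k => (coprodLift (A := C.tensor) (B := C.tensor) f g).toLinearMap ∘ₗ k) h
  simp only [algHom_comp_conv] at h2
  refine Eq.trans h2 ?_
  congr 1
  · ext x; exact coprodLift_inl (A := C.tensor) (B := C.tensor) f g (C.gen x)
  · ext x; exact coprodLift_inr (A := C.tensor) (B := C.tensor) f g (C.gen x)

theorem tcomul_tgen (x : C.carrier) : C.tensorComon.tcomul (C.tgen x) =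
    TensorProduct.map C.tgen C.tgen (Coalgebra.comul (R := R) x) := by
  refine (DFunLike.congr_fun (star_tgen _ _) x).trans ?_
  rw [conv, LinearMap.comp_apply, LinearMap.comp_apply]
  generalize Coalgebra.comul (R := R) x = d
  induction d with
  | zero => simp
  | add a b ha hb => simp only [map_add, ha, hb]
  | tmul a b => simp

/-- Only the parts of the coproduct with a scalar on one side survive, and these are given by the
counit laws. -/
theorem star_tgen_of_mulZero {f g : C.tensorComon.carrier →ₐ[R] Q} (h : MulZero f g)
    (x : C.carrier) : star f g (C.tgen x) =
      f (C.tgen x) + g (C.tgen x) - algebraMap R Q (Coalgebra.counit (R := R) x) := by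
  refine (DFunLike.congr_fun (star_tgen f g) x).trans ?_
  have key : ∀ d : C.carrier ⊗[R] C.carrier,
      LinearMap.mul' R Q (TensorProduct.map (f.toLinearMap ∘ₗ C.tgen) (g.toLinearMap ∘ₗ C.tgen) d) =
        f (C.tgen (TensorProduct.rid R _ (Coalgebra.counit.lTensor C.carrier d))) +
        g (C.tgen (TensorProduct.lid R _ (Coalgebra.counit.rTensor C.carrier d))) -
        algebraMap R Q (Coalgebra.counit (R := R) (TensorProduct.lid R _
          (Coalgebra.counit.rTensor C.carrier d))) := by
    intro d
    induction d with
    | zero => simp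
    | add a b ha hb => simp only [map_add, ha, hb]; abel
    | tmul a b =>
      have := h.mul (C.tgen a) (C.tgen b)
      rw [aug_tgen, aug_tgen] at this
      simp [this, Algebra.smul_def]
  rw [conv, LinearMap.comp_apply, LinearMap.comp_apply, key, Coalgebra.rTensor_counit_comul,
    Coalgebra.lTensor_counit_comul]
  simp

theorem tgen_mem_prim (x : C.carrier) : C.tgen x ∈ C.tensorComon.prim := by
  apply mem_prim_of_dec
  rw [dec, LinearMap.comp_apply, AlgHom.toLinearMap_apply, decHom,
    star_tgen_of_mulZero C.tensorComon.mulZero_decFst_decSnd, map_sub, map_add, rowSum_decFst,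
    rowSum_decSnd, rowSum_algebraMap, aug_tgen, add_comm (1 ⊗ₜ _)]

theorem tensorComon_mem_of_mul_mem {S : Submodule R C.tensorComon.carrier}
    (h1 : 1 ∈ S) (h : ∀ c, Coalgebra.counit (R := R) c = 0 → ∀ t ∈ S, C.tgen c * t ∈ S)
    (t : C.tensorComon.carrier) : t ∈ S := tensor_mem_of_mul_mem h1 h t

theorem tensorComon_mem_of_homogeneous_mul_mem {S : Submodule R C.tensorComon.carrier}
    (h1 : 1 ∈ S) (h : ∀ n, n ≠ 0 → ∀ c ∈ C.grading n, ∀ t ∈ S, C.tgen c * t ∈ S)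
    (t : C.tensorComon.carrier) : t ∈ S := by
  refine tensorComon_mem_of_mul_mem h1 (fun c hc t ht => ?_) t
  clear hc
  induction c using DirectSum.Decomposition.inductionOn C.grading with
  | zero => rw [map_zero, zero_mul]; exact zero_mem _
  | add a b ha hb => rw [map_add, add_mul]; exact add_mem ha hb
  | @homogeneous i m =>
    by_cases hi : i = 0
    · subst hi
      have e : C.tgen m = algebraMap R C.tensorComon.carrier (Coalgebra.counit (R := R) (m : C.carrier)) :=
        C.isG_gen.map_zero _ m.2
      rw [e, ← Algebra.smul_def]
      exact Submodule.smul_mem _ _ ht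
    · exact h i hi m m.2 t ht

/-- By `antip_mul`, a word beginning with the generator `c` is sent to a multiple of `c`, so it
suffices to treat `1` and words with a first letter. -/
theorem antip_mem_range_tgen (t : C.tensorComon.carrier) :
    C.tensorComon.antip t ∈ LinearMap.range C.tgen := by
  refine tensorComon_mem_of_mul_mem
    (S := (LinearMap.range C.tgen).comap C.tensorComon.antip) ?_ ?_ t
  · exact ⟨C.unitElt, C.tgen_unitElt.trans antip_one.symm⟩
  · intro c hc t _
    rw [Submodule.mem_comap, antip_mul (tgen_mem_prim c) ((C.aug_tgen c).trans hc)]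
    exact neg_mem (Submodule.smul_mem _ _ ⟨c, rfl⟩)

/-- A primitive element is fixed by `primProj`, which is a scalar minus a value of `antip`. With
`tgen_mem_prim` this identifies the primitive elements with `C`. -/
theorem mem_range_tgen {x : C.tensorComon.carrier} (hx : x ∈ C.tensorComon.prim) :
    x ∈ LinearMap.range C.tgen := by
  rw [← primProj_of_mem hx]
  refine sub_mem (Submodule.smul_mem _ _ (LinearMap.mem_range.2
    ⟨C.tensorComon.aug x • C.unitElt, ?_⟩)) (antip_mem_range_tgen x)
  rw [map_smul, tgen_unitElt, AlgHom.toLinearMap_apply, unitHom_apply,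
    Algebra.algebraMap_eq_smul_one]

variable {D : ConnCoalg R}

/-- The map of coalgebras underlying a homomorphism of tensor algebras. -/
def untensor (k : C.tensorComon ⟶ D.tensorComon) : C.carrier →ₗ[R] D.carrier :=
  D.tgenInv ∘ₗ (mapHom k).toLinearMap ∘ₗ C.tgen

theorem tgen_untensor (k : C.tensorComon ⟶ D.tensorComon) (x : C.carrier) :
    D.tgen (untensor k x) = mapHom k (C.tgen x) := by
  obtain ⟨y, hy⟩ := mem_range_tgen (mapHom_mem_prim k (tgen_mem_prim x))
  have : untensor k x = D.tgenInv (mapHom k (C.tgen x)) := rfl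
  rw [this, ← hy, tgenInv_tgen]

theorem tgen_comp_untensor (k : C.tensorComon ⟶ D.tensorComon) :
    D.tgen ∘ₗ untensor k = (mapHom k).toLinearMap ∘ₗ C.tgen := LinearMap.ext (tgen_untensor k)

/-- The homomorphism of coalgebras underlying a homomorphism of tensor algebras. -/
def untensorHom (k : C.tensorComon ⟶ D.tensorComon) : C ⟶ D where
  toCoalgHom :=
    { untensor k with
      counit_comp := LinearMap.ext fun x => by
        rw [LinearMap.comp_apply, ← aug_tgen, tgen_untensor, aug_mapHom, aug_tgen]
      map_comp_comul := LinearMap.ext fun x => D.map_tgen_injective (by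
        rw [LinearMap.comp_apply, LinearMap.comp_apply, ← tcomul_tgen, tgen_untensor,
          tcomul_mapHom, tcomul_tgen, TensorProduct.map_map, TensorProduct.map_map,
          tgen_comp_untensor]) }
  map_mem n x hx := mem_of_map_mem D.grading D.tensorComon.grading D.tgen D.tgen_mem
    D.tgen_injective (by
      change D.tgen (untensor k x) ∈ _
      rw [tgen_untensor]
      exact mapHom_mem k n _ (C.tgen_mem n x hx))

theorem tensorComon_hom_ext {B : AlgComon R} {f g : C.tensorComon ⟶ B}
    (h : ∀ x, mapHom f (C.tgen x) = mapHom g (C.tgen x)) : f = g :=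
  AlgComon.hom_ext (tensor_hom_ext (LinearMap.ext h))

theorem mapHom_map_tgen (f : C ⟶ D) (x : C.carrier) :
    mapHom ((tensorFunctor R).map f) (C.tgen x) = D.tgen (Hom.toCoalgHom f x) :=
  DFunLike.congr_fun (tensorMap_gen f) x

end ConnCoalg

instance : (tensorFunctor R).Full where
  map_surjective k := ⟨ConnCoalg.untensorHom k, ConnCoalg.tensorComon_hom_ext fun x =>
    (ConnCoalg.mapHom_map_tgen _ x).trans (ConnCoalg.tgen_untensor k x)⟩

instance : (tensorFunctor R).Faithful where
  map_injective {C D f g} h := ConnCoalg.hom_ext (CoalgHom.ext fun x => D.tgen_injective (by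
    rw [← ConnCoalg.mapHom_map_tgen, ← ConnCoalg.mapHom_map_tgen, h]))

end CogroupAlg

end

noncomputable section
namespace CogroupAlg

/-! ## Cocommutativity -/

variable {R : Type u} [CommRing R]

theorem neg_one_zpow_smul_smul {M : Type u} [AddCommGroup M] (n : ℕ) (x : M) :
    (-1 : ℤ) ^ n • (-1 : ℤ) ^ n • x = x := by
  rw [smul_smul, ← mul_pow]; simp

theorem neg_one_units_smul {M : Type u} [AddCommGroup M] (n : ℕ) (x : M) :
    (-1 : ℤˣ) ^ n • x = (-1 : ℤ) ^ n • x := by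
  rcases Nat.even_or_odd n with e | e
  · rw [e.neg_one_pow, e.neg_one_pow, one_smul, one_smul]
  · rw [e.neg_one_pow, e.neg_one_pow, Units.smul_def]; rfl

/-- Two homomorphisms whose values commute in the graded sense. -/
def ConnAlg.SuperCommute {A : ConnAlg R} {Q : Type u} [Ring Q] [Algebra R Q]
    (f g : A.carrier →ₐ[R] Q) : Prop :=
  ∀ p q, ∀ a ∈ A.grading p, ∀ b ∈ A.grading q, f a * g b = (-1 : ℤ) ^ (p * q) • (g b * f a)

theorem ConnAlg.SuperCommute.symm {A : ConnAlg R} {Q : Type u} [Ring Q] [Algebra R Q]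
    {f g : A.carrier →ₐ[R] Q} (h : SuperCommute f g) : SuperCommute g f := by
  intro p q a ha b hb
  rw [h q p b hb a ha, mul_comm q p, neg_one_zpow_smul_smul]

theorem gradedSwap_eq_comm (A : ConnAlg R) (d : A.carrier ⊗[R] A.carrier) :
    gradedSwap A.grading d = (GradedTensorProduct.of R A.grading A.grading).symm
      (GradedTensorProduct.comm A.grading A.grading
        (GradedTensorProduct.of R A.grading A.grading d)) := rfl

theorem superCommute_include (A : ConnAlg R) :
    ConnAlg.SuperCommute (GradedTensorProduct.includeLeft A.grading A.grading)
      (GradedTensorProduct.includeRight A.grading A.grading) := by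
  intro p q a ha b hb
  lift a to A.grading p using ha
  lift b to A.grading q using hb
  have h := GradedTensorProduct.tmul_coe_mul_coe_tmul (R := R) A.grading A.grading 1 b a 1
  rw [one_mul, mul_one, neg_one_units_smul, mul_comm q p] at h
  have h2 := GradedTensorProduct.tmul_one_mul_one_tmul (R := R) A.grading A.grading a b
  refine h2.trans ?_
  refine Eq.trans ?_ (congrArg (fun z => (-1 : ℤ) ^ (p * q) • z) h.symm)
  rw [neg_one_zpow_smul_smul]

theorem comm_comp_includeLeft (A : ConnAlg R) :
    (GradedTensorProduct.comm A.grading A.grading).toAlgHom.comp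
      (GradedTensorProduct.includeLeft A.grading A.grading) =
      GradedTensorProduct.includeRight A.grading A.grading := by
  refine AlgHom.toLinearMap_injective ?_
  refine LinearMap.ext fun x => ?_
  induction x using DirectSum.Decomposition.inductionOn A.grading with
  | zero => rw [map_zero, map_zero]
  | add a b ha hb => rw [map_add, map_add, ha, hb]
  | @homogeneous i a =>
    have h := GradedTensorProduct.comm_coe_tmul_coe (R := R) A.grading A.grading a
      (⟨1, SetLike.GradedOne.one_mem⟩ : A.grading 0)
    rw [zero_mul] at h
    refine h.trans ?_
    simp

theorem comm_comp_includeRight (A : ConnAlg R) :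
    (GradedTensorProduct.comm A.grading A.grading).toAlgHom.comp
      (GradedTensorProduct.includeRight A.grading A.grading) =
      GradedTensorProduct.includeLeft A.grading A.grading := by
  refine AlgHom.toLinearMap_injective ?_
  refine LinearMap.ext fun x => ?_
  induction x using DirectSum.Decomposition.inductionOn A.grading with
  | zero => rw [map_zero, map_zero]
  | add a b ha hb => rw [map_add, map_add, ha, hb]
  | @homogeneous i a =>
    have h := GradedTensorProduct.comm_coe_tmul_coe (R := R) A.grading A.grading
      (⟨1, SetLike.GradedOne.one_mem⟩ : A.grading 0) a
    rw [mul_zero] at h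
    refine h.trans ?_
    simp

/-! ### Cocommutativity as commutativity of products of homomorphisms -/

namespace AlgComon

open ConnAlg

variable {A B : AlgComon R}

theorem tensorComul_apply (x : A.carrier) : A.tensorComul x =
    (GradedTensorProduct.of R A.grading A.grading).symm
      (star (GradedTensorProduct.includeLeft A.grading A.grading)
        (GradedTensorProduct.includeRight A.grading A.grading) x) := rfl

theorem gradedSwap_tensorComul (x : A.carrier) : gradedSwap A.grading (A.tensorComul x) =
    (GradedTensorProduct.of R A.grading A.grading).symm
      (star (GradedTensorProduct.includeRight A.grading A.grading)
        (GradedTensorProduct.includeLeft A.grading A.grading) x) := by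
  have h := comp_star (A := A) (GradedTensorProduct.comm A.grading A.grading).toAlgHom
    (GradedTensorProduct.includeLeft A.grading A.grading)
    (GradedTensorProduct.includeRight A.grading A.grading)
  rw [comm_comp_includeLeft, comm_comp_includeRight] at h
  rw [← h, gradedSwap_eq_comm]
  rfl

/-- The graded tensor product with its two inclusions is the universal pair of homomorphisms which
commute up to sign, so the condition need only be tested there. -/
theorem coalgCocomm_iff : gradedSwap A.grading ∘ₗ A.tensorComul = A.tensorComul ↔
    ∀ (Q : Type u) [Ring Q] [Algebra R Q] (f g : A.carrier →ₐ[R] Q), SuperCommute f g →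
      star f g = star g f := by
  constructor
  · intro h Q _ _ f g hfg
    have h0 : star (GradedTensorProduct.includeLeft A.grading A.grading)
        (GradedTensorProduct.includeRight A.grading A.grading) =
        star (GradedTensorProduct.includeRight A.grading A.grading)
        (GradedTensorProduct.includeLeft A.grading A.grading) := by
      refine AlgHom.ext fun x => (GradedTensorProduct.of R A.grading A.grading).symm.injective ?_
      rw [← tensorComul_apply, ← gradedSwap_tensorComul]
      exact (DFunLike.congr_fun h x).symm
    have h1 := congrArg (fun k => AlgHom.comp (GradedTensorProduct.lift A.grading A.grading f g
      (fun i j a b => by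
        rw [neg_one_units_smul, mul_comm j i]
        exact hfg i j a a.2 b b.2)) k) h0
    simp only [comp_star] at h1
    have e1 : (GradedTensorProduct.lift A.grading A.grading f g
      (fun i j a b => by
        rw [neg_one_units_smul, mul_comm j i]
        exact hfg i j a a.2 b b.2)).comp (GradedTensorProduct.includeLeft A.grading A.grading) =
        f := by
      refine AlgHom.ext fun x => ?_
      exact (mul_one _).symm.trans (congrArg (f x * ·) (map_one g).symm) |>.symm
    have e2 : (GradedTensorProduct.lift A.grading A.grading f g
      (fun i j a b => by
        rw [neg_one_units_smul, mul_comm j i]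
        exact hfg i j a a.2 b b.2)).comp (GradedTensorProduct.includeRight A.grading A.grading) =
        g := by
      refine AlgHom.ext fun x => ?_
      exact (one_mul _).symm.trans (congrArg (· * g x) (map_one f).symm) |>.symm
    rwa [e1, e2] at h1
  · intro h
    refine LinearMap.ext fun x => ?_
    rw [LinearMap.comp_apply, gradedSwap_tensorComul, tensorComul_apply,
      h _ _ _ (superCommute_include A.toConnAlg)]

/-- The same principle for `A ∗ A`, where the two inclusions are universal among all pairs. -/
theorem cocomm_iff : A.comul ≫ coprodSwap A.toConnAlg = A.comul ↔
    ∀ (Q : Type u) [Ring Q] [Algebra R Q] (f g : A.carrier →ₐ[R] Q), star f g = star g f := by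
  have h1 : ∀ (Q : Type u) [Ring Q] [Algebra R Q] (f g : A.carrier →ₐ[R] Q),
      (coprodLift f g).comp (Hom.toAlgHom (A.comul ≫ coprodSwap A.toConnAlg)) = star g f := by
    intro Q _ _ f g
    rw [comp_toAlgHom, coprodSwap, toAlgHom_desc, ← AlgHom.comp_assoc, comp_coprodLift,
      coprodLift_comp_inl, coprodLift_comp_inr]
    rfl
  constructor
  · intro h Q _ _ f g
    rw [← h1, h]
    rfl
  · intro h
    have h2 := h1 _ (Hom.toAlgHom (inl A.toConnAlg A.toConnAlg))
      (Hom.toAlgHom (inr A.toConnAlg A.toConnAlg))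
    rw [← h, star_inl_inr] at h2
    have h3 : coprodLift (Hom.toAlgHom (inl A.toConnAlg A.toConnAlg))
        (Hom.toAlgHom (inr A.toConnAlg A.toConnAlg)) = AlgHom.id R _ :=
      coprod_algHom_ext (by simp) (by simp)
    rw [h3, AlgHom.id_comp] at h2
    exact ConnAlg.hom_ext h2

theorem cocommCogroup_le : cocommCogroup R ≤ coalgCocommCogroup R :=
  fun _ h => ⟨h.1, coalgCocomm_iff.2 fun Q _ _ f g _ => cocomm_iff.1 h.2 Q f g⟩

theorem mapHom_bijective (k : A ≅ B) : Function.Bijective (mapHom k.hom) := by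
  have h1 : ∀ x, mapHom k.inv (mapHom k.hom x) = x := fun x =>
    DFunLike.congr_fun (congrArg mapHom k.hom_inv_id) x
  have h2 : ∀ x, mapHom k.hom (mapHom k.inv x) = x := fun x =>
    DFunLike.congr_fun (congrArg mapHom k.inv_hom_id) x
  exact ⟨Function.LeftInverse.injective h1, Function.RightInverse.surjective h2⟩

theorem star_eq_of_iso (k : A ≅ B) {Q : Type u} [Ring Q] [Algebra R Q] {f g : B.carrier →ₐ[R] Q}
    (h : star (f.comp (mapHom k.hom)) (g.comp (mapHom k.hom)) =
      star (g.comp (mapHom k.hom)) (f.comp (mapHom k.hom))) : star f g = star g f := by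
  rw [mapHom, ← star_comp, ← star_comp] at h
  refine AlgHom.ext fun y => ?_
  obtain ⟨x, rfl⟩ := (mapHom_bijective k).2 y
  exact DFunLike.congr_fun h x

theorem coalgCocomm_of_iso (k : A ≅ B)
    (h : gradedSwap A.grading ∘ₗ A.tensorComul = A.tensorComul) :
    gradedSwap B.grading ∘ₗ B.tensorComul = B.tensorComul := by
  rw [coalgCocomm_iff] at h ⊢
  intro Q _ _ f g hfg
  exact star_eq_of_iso k (h Q _ _ fun p q a ha b hb =>
    hfg p q _ (mapHom_mem _ p a ha) _ (mapHom_mem _ q b hb))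

theorem cocomm_of_iso (k : A ≅ B) (h : A.comul ≫ coprodSwap A.toConnAlg = A.comul) :
    B.comul ≫ coprodSwap B.toConnAlg = B.comul := by
  rw [cocomm_iff] at h ⊢
  intro Q _ _ f g
  exact star_eq_of_iso k (h Q _ _)

end AlgComon

/-! ### Cocommutativity of tensor algebras -/

namespace ConnCoalg

open ConnAlg AlgComon

variable {C : ConnCoalg R}

theorem mul'_map_gradedSwap {Q : Type u} [Ring Q] [Algebra R Q]
    {f g : C.tensorComon.carrier →ₐ[R] Q} (h : SuperCommute f g) (d : C.carrier ⊗[R] C.carrier) :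
    LinearMap.mul' R Q (TensorProduct.map (g.toLinearMap ∘ₗ C.tgen) (f.toLinearMap ∘ₗ C.tgen)
      (gradedSwap C.grading d)) =
    LinearMap.mul' R Q (TensorProduct.map (f.toLinearMap ∘ₗ C.tgen) (g.toLinearMap ∘ₗ C.tgen) d) := by
  induction d with
  | zero => simp
  | add a b ha hb => simp only [map_add, ha, hb]
  | tmul a b =>
    induction a using DirectSum.Decomposition.inductionOn C.grading with
    | zero => simp
    | add a b ha hb => rw [add_tmul]; simp only [map_add, ha, hb]
    | @homogeneous p a =>
      induction b using DirectSum.Decomposition.inductionOn C.grading with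
      | zero => simp
      | add a b ha hb => rw [tmul_add]; simp only [map_add, ha, hb]
      | @homogeneous q b =>
        rw [gradedSwap_tmul _ a.2 b.2, map_zsmul, map_zsmul, TensorProduct.map_tmul,
          TensorProduct.map_tmul, LinearMap.mul'_apply, LinearMap.mul'_apply]
        exact (h p q _ (C.tgen_mem p a a.2) _ (C.tgen_mem q b b.2)).symm

theorem tensorComon_algHom_ext {Q : Type u} [Ring Q] [Algebra R Q]
    {f g : C.tensorComon.carrier →ₐ[R] Q} (h : ∀ x, f (C.tgen x) = g (C.tgen x)) : f = g := by
  refine TensorAlgebra.hom_ext (LinearMap.ext fun x => ?_)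
  exact (congrArg f (C.gen_coe x)).symm.trans ((h x).trans (congrArg g (C.gen_coe x)))

theorem star_tgen_apply {Q : Type u} [Ring Q] [Algebra R Q] (f g : C.tensorComon.carrier →ₐ[R] Q)
    (x : C.carrier) : star f g (C.tgen x) = LinearMap.mul' R Q (TensorProduct.map
      (f.toLinearMap ∘ₗ C.tgen) (g.toLinearMap ∘ₗ C.tgen) (Coalgebra.comul (R := R) x)) :=
  DFunLike.congr_fun (star_tgen f g) x

/-- The coalgebra underlying `T_CM(C)` is graded cocommutative if and only if `C` is. -/
theorem coalgCocomm_tensorComon_iff :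
    gradedSwap C.tensorComon.grading ∘ₗ C.tensorComon.tensorComul = C.tensorComon.tensorComul ↔
      cocomm R C := by
  constructor
  · intro h
    refine LinearMap.ext fun x => C.map_tgen_injective ?_
    have h1 := coalgCocomm_iff.1 h _ _ _ (superCommute_include C.tensorComon.toConnAlg)
    have h2 := DFunLike.congr_fun h1 (C.tgen x)
    rw [star_tgen_apply, star_tgen_apply] at h2
    have h3 := mul'_map_gradedSwap (superCommute_include C.tensorComon.toConnAlg).symm
      (Coalgebra.comul (R := R) x)
    have key : ∀ d : C.carrier ⊗[R] C.carrier, LinearMap.mul' R _ (TensorProduct.map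
        ((GradedTensorProduct.includeLeft C.tensorComon.grading C.tensorComon.grading).toLinearMap
          ∘ₗ C.tgen)
        ((GradedTensorProduct.includeRight C.tensorComon.grading C.tensorComon.grading).toLinearMap
          ∘ₗ C.tgen) d) = GradedTensorProduct.of R C.tensorComon.grading C.tensorComon.grading
            (TensorProduct.map C.tgen C.tgen d) := by
      intro d
      induction d with
      | zero => simp
      | add a b ha hb => simp only [map_add, ha, hb]
      | tmul a b => exact GradedTensorProduct.tmul_one_mul_one_tmul _ _ _ _
    rw [← h2, key, key] at h3
    exact h3
  · intro h
    refine coalgCocomm_iff.2 fun Q _ _ f g hfg => tensorComon_algHom_ext fun x => ?_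
    rw [star_tgen_apply, star_tgen_apply, ← mul'_map_gradedSwap hfg]
    have hx : gradedSwap C.grading (Coalgebra.comul (R := R) x) = Coalgebra.comul (R := R) x :=
      DFunLike.congr_fun h x
    rw [hx]

/-- With the two homomorphisms interchanged, a word `y' z''` is no longer killed but read as `y ⊗
z`. -/
theorem rowSum_star_decSnd_decFst (x : C.carrier) :
    rowSum R 2 _ (star C.tensorComon.decSnd C.tensorComon.decFst (C.tgen x)) =
      TensorProduct.map C.tgen C.tgen (Coalgebra.comul (R := R) x) := by
  rw [star_tgen_apply]
  generalize Coalgebra.comul (R := R) x = d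
  induction d with
  | zero => simp
  | add a b ha hb => simp only [map_add, ha, hb]
  | tmul a b => exact rowSum_decSnd_mul_decFst _ _

/-- If `T_CM(C)` is cocommutative, then the reduced comultiplication of `C` vanishes. -/
theorem comul_eq_of_cocomm (h : C.tensorComon.comul ≫ coprodSwap C.tensorComon.toConnAlg =
    C.tensorComon.comul) (x : C.carrier) : Coalgebra.comul (R := R) x =
      x ⊗ₜ C.unitElt + C.unitElt ⊗ₜ x -
        Coalgebra.counit (R := R) x • (C.unitElt ⊗ₜ[R] C.unitElt) := by
  apply C.map_tgen_injective
  -- One order of the factors reads off the whole comultiplication, the other only its linear terms.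
  rw [← rowSum_star_decSnd_decFst, cocomm_iff.1 h,
    star_tgen_of_mulZero C.tensorComon.mulZero_decFst_decSnd, map_sub, map_add, rowSum_decFst,
    rowSum_decSnd, rowSum_algebraMap]
  simp [tgen_unitElt, add_comm]

theorem cocomm_tensorComon_of_comul (h : ∀ x : C.carrier, Coalgebra.comul (R := R) x =
      x ⊗ₜ C.unitElt + C.unitElt ⊗ₜ x -
        Coalgebra.counit (R := R) x • (C.unitElt ⊗ₜ[R] C.unitElt)) :
    C.tensorComon.comul ≫ coprodSwap C.tensorComon.toConnAlg = C.tensorComon.comul := by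
  refine cocomm_iff.2 fun Q _ _ f g => tensorComon_algHom_ext fun x => ?_
  rw [star_tgen_apply, star_tgen_apply, h]
  simp [tgen_unitElt, add_comm]

/-! ### Coalgebras with trivial reduced comultiplication -/

variable (C)

/-- The positive part of a coalgebra as a positively graded module. -/
def posMod : PosGrMod R where
  carrier := C.pos
  grading n := (C.grading n).comap C.pos.subtype
  decomposition := retractDecomposition C.grading C.pos.subtype C.projPos C.projPos_coe
    (fun n x hx => by
      rw [Submodule.subtype_apply, coe_projPos]
      refine sub_mem hx ?_
      by_cases h : n = 0
      · subst h; exact C.projZero_mem x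
      · rw [C.projZero_of_mem h hx]; exact zero_mem _)
  grading_zero := by
    refine eq_bot_iff.2 fun x hx => ?_
    have h1 : C.projZero x = 0 := x.2
    have h2 : C.projZero x = x := C.projZero_zero hx
    exact Subtype.ext (h2.symm.trans h1)

variable {C}

/-- The linear map from `R ⊕ C̄` to `C`. -/
def ofTrivial : R × C.pos →ₗ[R] C.carrier :=
  LinearMap.coprod (LinearMap.toSpanSingleton R C.carrier C.unitElt) C.pos.subtype

theorem ofTrivial_apply (x : R × C.pos) : ofTrivial x = x.1 • C.unitElt + (x.2 : C.carrier) := rfl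

theorem ofTrivial_bijective : Function.Bijective (ofTrivial (C := C)) := by
  have hu : C.projPos C.unitElt = 0 := C.projPos_zero C.unitElt_mem
  constructor
  · refine Function.LeftInverse.injective
      (g := fun x => (Coalgebra.counit (R := R) x, C.projPos x)) fun x => ?_
    rw [ofTrivial_apply]
    refine Prod.ext ?_ ?_
    · simp [counit_unitElt, counit_pos]
    · simp [hu, projPos_coe]
  · intro x
    refine ⟨(Coalgebra.counit (R := R) x, C.projPos x), ?_⟩
    rw [ofTrivial_apply, coe_projPos, projZero_eq]
    abel

theorem counit_ofTrivial (x : R × C.pos) : Coalgebra.counit (R := R) (ofTrivial x) = x.1 := by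
  rw [ofTrivial_apply]
  simp [counit_unitElt, counit_pos]

theorem map_ofTrivial (r : R) (y : C.pos) :
    TensorProduct.map (ofTrivial (C := C)) ofTrivial
      (r • ((1, 0) ⊗ₜ[R] (1, 0)) + ((0, y) ⊗ₜ[R] (1, 0) + (1, 0) ⊗ₜ[R] (0, y))) =
      r • (C.unitElt ⊗ₜ C.unitElt) + ((y : C.carrier) ⊗ₜ C.unitElt + C.unitElt ⊗ₜ (y : C.carrier)) := by
  simp [ofTrivial_apply]

theorem comul_ofTrivial (h : ∀ x : C.carrier, Coalgebra.comul (R := R) x =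
      x ⊗ₜ C.unitElt + C.unitElt ⊗ₜ x -
        Coalgebra.counit (R := R) x • (C.unitElt ⊗ₜ[R] C.unitElt)) (x : R × C.pos) :
    Coalgebra.comul (R := R) (ofTrivial x) = x.1 • (C.unitElt ⊗ₜ C.unitElt) +
      ((x.2 : C.carrier) ⊗ₜ C.unitElt + C.unitElt ⊗ₜ (x.2 : C.carrier)) := by
  rw [h, counit_ofTrivial, ofTrivial_apply, add_tmul, tmul_add, tmul_smul, ← smul_tmul']
  abel

/-- The homomorphism from `C(N)` to a coalgebra with trivial reduced comultiplication and positive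
part `N`. -/
def trivialHom (h : ∀ x : C.carrier, Coalgebra.comul (R := R) x =
      x ⊗ₜ C.unitElt + C.unitElt ⊗ₜ x -
        Coalgebra.counit (R := R) x • (C.unitElt ⊗ₜ[R] C.unitElt)) :
    (trivialFunctor R).obj C.posMod ⟶ C where
  toCoalgHom :=
    { (ofTrivial : R × C.pos →ₗ[R] C.carrier) with
      counit_comp := LinearMap.ext fun x => counit_ofTrivial x
      map_comp_comul := LinearMap.ext fun x =>
        (congrArg (TensorProduct.map ofTrivial ofTrivial)
          (C.posMod.trivialCoalgebra_comul x)).trans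
          ((map_ofTrivial (C := C) x.1 x.2).trans (comul_ofTrivial h x).symm) }
  map_mem n x hx := by
    obtain ⟨h1, h2⟩ := Submodule.mem_prod.1 hx
    refine add_mem ?_ h2
    by_cases hn : n = 0
    · subst hn; exact Submodule.smul_mem _ _ C.unitElt_mem
    · rw [if_neg hn, Submodule.mem_bot] at h1
      have : (LinearMap.toSpanSingleton R C.carrier C.unitElt) x.1 = 0 := by rw [h1, map_zero]
      exact this ▸ zero_mem _

/-- A coalgebra with trivial reduced comultiplication is isomorphic to `C(N)`. -/
def trivialIso (h : ∀ x : C.carrier, Coalgebra.comul (R := R) x =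
      x ⊗ₜ C.unitElt + C.unitElt ⊗ₜ x -
        Coalgebra.counit (R := R) x • (C.unitElt ⊗ₜ[R] C.unitElt)) :
    (trivialFunctor R).obj C.posMod ≅ C := isoOfBijective (trivialHom h) ofTrivial_bijective

end ConnCoalg

/-! ### Full faithfulness of the functor `C` -/

namespace PosGrMod

variable (N : PosGrMod R)

theorem trivialCoalg_unitElt : N.trivialCoalg.unitElt = ((1, 0) : R × N.carrier) := by
  have h := N.trivialCoalg.projZero_eq ((1, 0) : R × N.carrier)
  have h1 : ((1, 0) : R × N.carrier) ∈ N.trivialCoalg.grading 0 := by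
    refine Submodule.mem_prod.2 ⟨?_, zero_mem _⟩
    simp
  rw [N.trivialCoalg.projZero_zero h1] at h
  refine Eq.trans ?_ h.symm
  exact (one_smul R N.trivialCoalg.unitElt).symm

theorem tmul_unit_add_unit_tmul {M : Type u} [AddCommGroup M] [Module R M] (x : R × M) :
    x.1 • (((1, 0) : R × M) ⊗ₜ[R] ((1, 0) : R × M)) +
      (((0, x.2) : R × M) ⊗ₜ[R] ((1, 0) : R × M) + ((1, 0) : R × M) ⊗ₜ[R] ((0, x.2) : R × M)) =
    x ⊗ₜ[R] ((1, 0) : R × M) + ((1, 0) : R × M) ⊗ₜ[R] x -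
      x.1 • (((1, 0) : R × M) ⊗ₜ[R] ((1, 0) : R × M)) := by
  obtain ⟨r, y⟩ := x
  have hx : ((r, y) : R × M) = r • ((1, 0) : R × M) + ((0, y) : R × M) := by simp
  rw [hx, add_tmul, tmul_add, tmul_smul, ← smul_tmul']
  simp only [Prod.smul_mk, Prod.mk_add_mk, smul_zero, zero_add, add_zero, smul_eq_mul, mul_one]
  abel

theorem trivialCoalg_comul (x : N.trivialCoalg.carrier) : Coalgebra.comul (R := R) x =
      x ⊗ₜ N.trivialCoalg.unitElt + N.trivialCoalg.unitElt ⊗ₜ x -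
        Coalgebra.counit (R := R) x • (N.trivialCoalg.unitElt ⊗ₜ[R] N.trivialCoalg.unitElt) := by
  rw [trivialCoalg_unitElt]
  exact (N.trivialCoalgebra_comul x).trans (tmul_unit_add_unit_tmul (M := N.carrier) x)

theorem trivialCoalg_cocomm : ConnCoalg.cocomm R N.trivialCoalg := by
  refine LinearMap.ext fun x => ?_
  have h1 : ∀ b, gradedSwap N.trivialCoalg.grading (N.trivialCoalg.unitElt ⊗ₜ[R] b) =
      b ⊗ₜ N.trivialCoalg.unitElt := by
    intro b
    induction b using DirectSum.Decomposition.inductionOn N.trivialCoalg.grading with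
    | zero => simp
    | add a b ha hb => rw [tmul_add, map_add, ha, hb, add_tmul]
    | @homogeneous i m =>
      rw [gradedSwap_tmul _ N.trivialCoalg.unitElt_mem m.2, zero_mul, pow_zero, one_smul]
  have h2 : ∀ b, gradedSwap N.trivialCoalg.grading (b ⊗ₜ[R] N.trivialCoalg.unitElt) =
      N.trivialCoalg.unitElt ⊗ₜ b := by
    intro b
    induction b using DirectSum.Decomposition.inductionOn N.trivialCoalg.grading with
    | zero => simp
    | add a b ha hb => rw [add_tmul, map_add, ha, hb, tmul_add]
    | @homogeneous i m =>
      rw [gradedSwap_tmul _ m.2 N.trivialCoalg.unitElt_mem, mul_zero, pow_zero, one_smul]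
  rw [LinearMap.comp_apply, trivialCoalg_comul, map_sub, map_add, map_smul, h1, h2, h1, add_comm]

theorem trivialCoalg_tensorComon_cocomm : AlgComon.cocommCogroup R N.trivialCoalg.tensorComon :=
  ⟨N.trivialCoalg.tensorComon_cogroup,
    ConnCoalg.cocomm_tensorComon_of_comul N.trivialCoalg_comul⟩

variable {N} {M : PosGrMod R}

/-- The homomorphism of modules underlying a homomorphism of coalgebras with trivial coproduct. -/
def untrivial (k : M.trivialCoalg ⟶ N.trivialCoalg) : M ⟶ N where
  toLinearMap := LinearMap.snd R R N.carrier ∘ₗ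
    ((ConnCoalg.Hom.toCoalgHom k).toLinearMap : R × M.carrier →ₗ[R] R × N.carrier) ∘ₗ
      LinearMap.inr R R M.carrier
  map_mem n x hx := (Submodule.mem_prod.1 (k.map_mem n ((0, x) : R × M.carrier)
    (Submodule.mem_prod.2 ⟨zero_mem _, hx⟩))).2

/-- The counit fixes the scalar component, and the module component of the image of `1` lies in
degree zero, where the module vanishes. -/
theorem trivialFunctor_map_untrivial (k : M.trivialCoalg ⟶ N.trivialCoalg) :
    (trivialFunctor R).map (untrivial k) = k := by
  let K : R × M.carrier →ₗ[R] R × N.carrier := (ConnCoalg.Hom.toCoalgHom k).toLinearMap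
  have hc : ∀ x : R × M.carrier, (K x).1 = x.1 := fun x =>
    DFunLike.congr_fun (ConnCoalg.Hom.toCoalgHom k).counit_comp x
  have h0 : (K (1, 0)).2 = 0 := by
    have h1 : ((1, 0) : R × M.carrier) ∈ M.trivialCoalg.grading 0 :=
      Submodule.mem_prod.2 ⟨by simp, zero_mem _⟩
    have h : (K (1, 0)).2 ∈ N.grading 0 := (Submodule.mem_prod.1 (k.map_mem 0 _ h1)).2
    rwa [N.grading_zero, Submodule.mem_bot] at h
  have h2 : ∀ x : R × M.carrier, (K (0, x.2)).2 = (K x).2 := by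
    rintro ⟨r, y⟩
    have hx : ((r, y) : R × M.carrier) = r • ((1, 0) : R × M.carrier) + (0, y) := by simp
    have h3 : (K (r, y)).2 = r • (K (1, 0)).2 + (K (0, y)).2 := by rw [hx, map_add, map_smul]; rfl
    rw [h3, h0, smul_zero, zero_add]
  exact ConnCoalg.hom_ext (CoalgHom.ext fun x => Prod.ext (hc x).symm (h2 x))

end PosGrMod

instance : (trivialFunctor R).Full where
  map_surjective k := ⟨PosGrMod.untrivial k, PosGrMod.trivialFunctor_map_untrivial k⟩

instance : (trivialFunctor R).Faithful where
  map_injective {M N f g} h := PosGrMod.hom_ext (LinearMap.ext fun x => by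
    exact congrArg Prod.snd (DFunLike.congr_fun (congrArg (fun k : M.trivialCoalg ⟶ N.trivialCoalg =>
      ((ConnCoalg.Hom.toCoalgHom k).toLinearMap : R × M.carrier →ₗ[R] R × N.carrier)) h) (0, x)))

end CogroupAlg

end

noncomputable section
namespace CogroupAlg

/-! ## Modules whose tensor square is graded symmetric -/

section CommAlg

variable {R : Type u} [CommRing R] {M : Type u} [AddCommGroup M] [Module R M]

/-- Linear forms separate the points of the vector space `M / mM`. -/
theorem exists_functional_ne_zero {m : Ideal R} [m.IsMaximal] {z : M}
    (hz : z ∉ m • (⊤ : Submodule R M)) : ∃ φ : M →ₗ[R] R ⧸ m, φ z ≠ 0 := by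
  let _ := Ideal.Quotient.field m
  have h : (Submodule.mkQ (m • (⊤ : Submodule R M)) z) ≠ 0 := by
    rwa [Submodule.mkQ_apply, Ne, Submodule.Quotient.mk_eq_zero]
  have h2 : ¬ ∀ φ : Module.Dual (R ⧸ m) (M ⧸ m • (⊤ : Submodule R M)),
      φ (Submodule.mkQ (m • (⊤ : Submodule R M)) z) = 0 := fun h3 =>
    h ((Module.forall_dual_apply_eq_zero_iff (R ⧸ m) _).1 h3)
  push Not at h2
  obtain ⟨φ, hφ⟩ := h2
  exact ⟨φ.restrictScalars R ∘ₗ Submodule.mkQ _, hφ⟩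

/-- By Nakayama, `M = mM` would give an annihilating element congruent to `1` modulo `m`, against
the hypothesis. -/
theorem exists_functional_eq_one [Module.Finite R M] {m : Ideal R} [m.IsMaximal]
    (h : Module.annihilator R M ≤ m) : ∃ (φ : M →ₗ[R] R ⧸ m) (x : M), φ x = 1 := by
  let _ := Ideal.Quotient.field m
  have h1 : ∃ z : M, z ∉ m • (⊤ : Submodule R M) := by
    by_contra! hc
    obtain ⟨r, hr, hr'⟩ := Submodule.exists_sub_one_mem_and_smul_eq_zero_of_fg_of_le_smul m
      (⊤ : Submodule R M) Module.Finite.fg_top (fun z _ => hc z)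
    have h2 : r ∈ m := h (Module.mem_annihilator.2 fun z => hr' z trivial)
    have h3 := sub_mem h2 hr
    rw [sub_sub_cancel] at h3
    exact (Ideal.IsMaximal.ne_top ‹m.IsMaximal›) ((Ideal.eq_top_iff_one m).2 h3)
  obtain ⟨z, hz⟩ := h1
  obtain ⟨φ, hφ⟩ := exists_functional_ne_zero hz
  obtain ⟨r, hr⟩ := Ideal.Quotient.mk_surjective (I := m) (φ z)⁻¹
  refine ⟨φ, r • z, ?_⟩
  rw [map_smul, Algebra.smul_def, Ideal.Quotient.algebraMap_eq, hr, inv_mul_cancel₀ hφ]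

/-- The projection to a homogeneous component. -/
def compProj (ℳ : ℕ → Submodule R M) [DirectSum.Decomposition ℳ] (n : ℕ) : M →ₗ[R] ℳ n :=
  DirectSum.component R ℕ (fun n => ℳ n) n ∘ₗ (DirectSum.decomposeLinearEquiv ℳ).toLinearMap

variable {ℳ : ℕ → Submodule R M}

theorem compProj_of_mem [DirectSum.Decomposition ℳ] {n : ℕ} {x : M} (hx : x ∈ ℳ n) :
    compProj ℳ n x = ⟨x, hx⟩ :=
  Subtype.ext (DirectSum.decompose_of_mem_same _ hx)

theorem compProj_of_mem_ne [DirectSum.Decomposition ℳ] {n k : ℕ} (h : k ≠ n) {x : M}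
    (hx : x ∈ ℳ k) : compProj ℳ n x = 0 :=
  Subtype.ext (DirectSum.decompose_of_mem_ne _ hx h)

/-- The relation `x ⊗ y = (-1)^{pq} y ⊗ x` for elements of degrees `p` and `q`. -/
def SymmTensor (ℳ : ℕ → Submodule R M) (p q : ℕ) : Prop :=
  ∀ x ∈ ℳ p, ∀ y ∈ ℳ q, x ⊗ₜ[R] y = (-1 : ℤ) ^ (p * q) • (y ⊗ₜ[R] x)

theorem SymmTensor.mul_eq {p q : ℕ} (h : SymmTensor ℳ p q) {B : Type u} [CommRing B] [Algebra R B]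
    (φ ψ : M →ₗ[R] B) {x y : M} (hx : x ∈ ℳ p) (hy : y ∈ ℳ q) :
    φ x * ψ y = (-1) ^ (p * q) * (φ y * ψ x) := by
  have := congrArg (LinearMap.mul' R B ∘ₗ TensorProduct.map φ ψ) (h x hx y hy)
  rw [map_zsmul] at this
  simpa using this

/-- In odd degree the sign is `-1`, so `1 = φ x * φ x` equals its own negative. -/
theorem SymmTensor.two_eq_zero {n : ℕ} (h : SymmTensor ℳ n n) (hn : Odd n) {B : Type u}
    [CommRing B] [Algebra R B] (φ : M →ₗ[R] B) {x : M} (hx : x ∈ ℳ n) (h1 : φ x = 1) :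
    (2 : B) = 0 := by
  have h2 := h.mul_eq φ φ hx hx
  rw [h1, (hn.mul hn).neg_one_pow] at h2
  linear_combination h2

/-- At a maximal ideal containing both annihilators there are functionals with value `1` in degrees
`p` and `q`. Extended by zero to the other degrees, they give `1` on one side of the symmetry
relation and `0` on the other. -/
theorem annihilator_sup_eq_top [DirectSum.Decomposition ℳ] {p q : ℕ} (hpq : p ≠ q) (h : SymmTensor ℳ p q)
    (hp : (ℳ p).FG) (hq : (ℳ q).FG) : Module.annihilator R (ℳ p) ⊔ Module.annihilator R (ℳ q) = ⊤ := by
  by_contra hc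
  obtain ⟨m, hm, hle⟩ := Ideal.exists_le_maximal _ hc
  have : Module.Finite R (ℳ p) := Module.Finite.iff_fg.2 hp
  have : Module.Finite R (ℳ q) := Module.Finite.iff_fg.2 hq
  obtain ⟨φ, x, hx⟩ := exists_functional_eq_one (le_sup_left.trans hle)
  obtain ⟨ψ, y, hy⟩ := exists_functional_eq_one (le_sup_right.trans hle)
  have h1 := h.mul_eq (φ ∘ₗ compProj ℳ p) (ψ ∘ₗ compProj ℳ q) x.2 y.2
  simp only [LinearMap.comp_apply] at h1
  rw [compProj_of_mem x.2, compProj_of_mem y.2, compProj_of_mem_ne hpq x.2, map_zero, mul_zero,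
    mul_zero] at h1
  have h2 : φ x * ψ y = 0 := h1
  rw [hx, hy, mul_one] at h2
  have := Ideal.Quotient.nontrivial_iff.2 hm.ne_top
  exact one_ne_zero h2

theorem subsingleton_localizedModule_of_annihilator {m : Ideal R} [m.IsPrime] {s : R}
    (hs : s ∈ Module.annihilator R M) (hm : s ∉ m) :
    Subsingleton (LocalizedModule m.primeCompl M) :=
  LocalizedModule.subsingleton_iff.2 fun x => ⟨s, hm, Module.mem_annihilator.1 hs x⟩

/-- A module which is locally generated by an element `x` at `m` becomes cyclic after
localization. -/
theorem exists_localized_equiv (m : Ideal R) [m.IsPrime] (x : M)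
    (hx : ∀ y : M, ∃ s ∉ m, ∃ r : R, s • y = r • x) :
    ∃ e : LocalizedModule m.primeCompl M ≃ₗ[Localization.AtPrime m] (Localization.AtPrime m ⧸
      Ideal.map
        (algebraMap R (Localization.AtPrime m)) (LinearMap.ker (LinearMap.toSpanSingleton R M x))),
      e (LocalizedModule.mk x 1) = 1 := by
  set f : Localization.AtPrime m →ₗ[Localization.AtPrime m] LocalizedModule m.primeCompl M :=
    LinearMap.toSpanSingleton _ _ (LocalizedModule.mk x 1) with hf
  have hsurj : Function.Surjective f := by
    intro y
    induction y using LocalizedModule.induction_on with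
    | h y t =>
      obtain ⟨s, hs, r, hr⟩ := hx y
      refine ⟨Localization.mk r (⟨s, hs⟩ * t), ?_⟩
      rw [hf, LinearMap.toSpanSingleton_apply, LocalizedModule.mk_smul_mk, mul_one,
        LocalizedModule.mk_eq]
      refine ⟨1, ?_⟩
      simp only [one_smul]
      rw [← hr, Submonoid.smul_def, Submonoid.smul_def, smul_smul]
      simp [mul_comm]
  -- Localization is exact: the annihilator of the image of `x` is the localized annihilator of `x`.
  -- It is checked on fractions.
  have hker : LinearMap.ker f = Ideal.map (algebraMap R (Localization.AtPrime m))
      (LinearMap.ker (LinearMap.toSpanSingleton R M x)) := by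
    ext a
    rw [IsLocalization.mem_map_algebraMap_iff m.primeCompl]
    induction a using Localization.induction_on with
    | H a =>
      obtain ⟨r, t⟩ := a
      rw [LinearMap.mem_ker, hf, LinearMap.toSpanSingleton_apply, LocalizedModule.mk_smul_mk,
        mul_one, ← LocalizedModule.zero_mk (1 : m.primeCompl), LocalizedModule.mk_eq]
      simp only [smul_zero, one_smul]
      constructor
      · rintro ⟨u, hu⟩
        refine ⟨(⟨u * r, ?_⟩, u * t), ?_⟩
        · rw [LinearMap.mem_ker, LinearMap.toSpanSingleton_apply, mul_smul]
          exact hu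
        · rw [← Localization.mk_one_eq_algebraMap, ← Localization.mk_one_eq_algebraMap,
            Localization.mk_mul, Localization.mk_eq_mk_iff, Localization.r_iff_exists]
          exact ⟨1, by simp; ring⟩
      · rintro ⟨⟨⟨b, hb⟩, u⟩, h⟩
        rw [← Localization.mk_one_eq_algebraMap, ← Localization.mk_one_eq_algebraMap,
          Localization.mk_mul, Localization.mk_eq_mk_iff, Localization.r_iff_exists] at h
        obtain ⟨c, hc⟩ := h
        rw [LinearMap.mem_ker, LinearMap.toSpanSingleton_apply] at hb
        refine ⟨c * u, ?_⟩
        have h1 : (c * u * r : R) = c * t * b := by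
          simp only [Submonoid.coe_one, mul_one, one_mul] at hc
          linear_combination hc
        rw [Submonoid.smul_def, smul_smul, Submonoid.coe_mul, h1, mul_smul, hb, smul_zero]
  refine ⟨((Submodule.quotEquivOfEq _ _ hker.symm).trans
    (f.quotKerEquivOfSurjective hsurj)).symm, ?_⟩
  rw [LinearEquiv.symm_apply_eq]
  change _ = f.quotKerEquivOfSurjective hsurj (Submodule.quotEquivOfEq _ _ hker.symm
    (Submodule.Quotient.mk 1))
  rw [Submodule.quotEquivOfEq_mk]
  change _ = f 1
  rw [hf, LinearMap.toSpanSingleton_apply, one_smul]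

/-- If the tensor square of `M` is symmetric for functionals, then `M` is locally generated by
one element. -/
theorem exists_local_generator [Module.Finite R M] (m : Ideal R) [m.IsMaximal]
    (h : Module.annihilator R M ≤ m) (ε : R ⧸ m)
    (hsymm : ∀ (φ ψ : M →ₗ[R] R ⧸ m) (x y : M), φ x * ψ y = ε * (φ y * ψ x)) :
    ∃ x : M, LinearMap.ker (LinearMap.toSpanSingleton R M x) ≤ m ∧
      ∀ y : M, ∃ s ∉ m, ∃ r : R, s • y = r • x := by
  obtain ⟨φ, x, hx⟩ := exists_functional_eq_one h
  refine ⟨x, ?_, ?_⟩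
  · intro r hr
    have hr : r • x = 0 := hr
    have h1 := congrArg φ hr
    rw [map_smul, hx, map_zero, Algebra.smul_def, mul_one, Ideal.Quotient.algebraMap_eq,
      Ideal.Quotient.eq_zero_iff_mem] at h1
    exact h1
  · have hle : (⊤ : Submodule R M) ≤ Submodule.span R {x} ⊔ m • ⊤ := by
      intro y _
      obtain ⟨r, hr⟩ := Ideal.Quotient.mk_surjective (I := m) (φ y)
      have hz : y - r • x ∈ m • (⊤ : Submodule R M) := by
        by_contra hc
        obtain ⟨ψ, hψ⟩ := exists_functional_ne_zero hc
        apply hψ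
        -- As `φ x = 1` and `φ` vanishes on `y - r x`, the relation leaves `ψ (y - r x) = 0` for
        -- every `ψ`, so `x` spans `M` modulo `m`.
        have h1 := hsymm φ ψ x (y - r • x)
        have h2 : φ (y - r • x) = 0 := by
          rw [map_sub, map_smul, hx, Algebra.smul_def, mul_one, Ideal.Quotient.algebraMap_eq, hr,
            sub_self]
        rwa [h2, hx, zero_mul, mul_zero, one_mul] at h1
      have h3 : r • x + (y - r • x) ∈ Submodule.span R {x} ⊔ m • ⊤ :=
        Submodule.add_mem_sup (Submodule.smul_mem _ _ (Submodule.mem_span_singleton_self x)) hz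
      rwa [add_sub_cancel] at h3
    -- Nakayama's lemma, with a denominator `s` congruent to `1` modulo `m`.
    obtain ⟨s, hs, hs'⟩ := Submodule.exists_sub_one_mem_and_smul_le_of_fg_of_le_sup
      (N' := (⊤ : Submodule R M)) (P := ⊤) Module.Finite.fg_top le_rfl hle
    intro y
    refine ⟨s, fun hm => ?_, ?_⟩
    · have h3 := sub_mem hm hs
      rw [sub_sub_cancel] at h3
      exact (Ideal.IsMaximal.ne_top ‹m.IsMaximal›) ((Ideal.eq_top_iff_one m).2 h3)
    · obtain ⟨r, hr⟩ := Submodule.mem_span_singleton.1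
        (hs' (Submodule.smul_mem_pointwise_smul y s ⊤ trivial))
      exact ⟨r, hr.symm⟩

end CommAlg

/-! ### The local structure of locally singly generated modules -/

namespace PosGrMod

variable {R : Type u} [CommRing R]

/-- Modules with graded symmetric tensor square which are finitely generated in every degree are
locally singly generated. -/
theorem locallySinglyGenerated_of_symm (N : PosGrMod R) (hfg : ∀ n, (N.grading n).FG)
    (hsymm : ∀ p q, SymmTensor N.grading p q) : locallySinglyGenerated R N := by
  intro m hm
  by_cases h : ∀ k, ¬ Module.annihilator R (N.grading k) ≤ m
  · left
    intro k
    obtain ⟨s, hs, hsm⟩ := SetLike.not_le_iff_exists.1 (h k)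
    exact subsingleton_localizedModule_of_annihilator hs hsm
  · right
    push Not at h
    obtain ⟨n, hn⟩ := h
    have _ : Module.Finite R (N.grading n) := Module.Finite.iff_fg.2 (hfg n)
    obtain ⟨x, hx, hgen⟩ := exists_local_generator m hn ((-1) ^ (n * n)) (fun φ ψ x y => by
      have h1 := (hsymm n n).mul_eq (φ ∘ₗ compProj N.grading n) (ψ ∘ₗ compProj N.grading n) x.2 y.2
      simp only [LinearMap.comp_apply] at h1
      rw [compProj_of_mem x.2, compProj_of_mem y.2] at h1
      exact h1)
    set I := Ideal.map (algebraMap R (Localization.AtPrime m))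
      (LinearMap.ker (LinearMap.toSpanSingleton R _ x)) with hI
    obtain ⟨e, he⟩ : ∃ e : LocalizedModule m.primeCompl (N.grading n)
      ≃ₗ[Localization.AtPrime m] (Localization.AtPrime m ⧸ I), e (LocalizedModule.mk x 1) = 1 :=
      exists_localized_equiv m x hgen
    refine ⟨LinearMap.ker (LinearMap.toSpanSingleton R _ x), n, hx, ?_, ⟨e⟩, ?_⟩
    · intro hchar
      by_contra hodd
      rw [Nat.not_even_iff_odd] at hodd
      apply hchar
      -- The annihilator of the generator lies in `m`, so the local quotient is nonzero; hence `2 =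
      -- 0` forces its characteristic to be exactly `2`.
      have hne : I ≠ ⊤ := by
        have h1 : I ≤ Ideal.map (algebraMap R (Localization.AtPrime m)) m := Ideal.map_mono hx
        rw [Localization.AtPrime.map_eq_maximalIdeal] at h1
        exact fun h2 => (IsLocalRing.maximalIdeal.isMaximal _).ne_top (eq_top_iff.2 (h2 ▸ h1))
      have _ : Nontrivial (Localization.AtPrime m ⧸ I) := Ideal.Quotient.nontrivial_iff.2 hne
      have h2 : ((2 : ℕ) : Localization.AtPrime m ⧸ I) = 0 := by
        -- Localization followed by `e` is a functional with value `1` on the generator, to which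
        -- the symmetry in odd degree applies.
        let θ : N.carrier →ₗ[R] Localization.AtPrime m ⧸ I :=
          (e.toLinearMap.restrictScalars R) ∘ₗ LocalizedModule.mkLinearMap m.primeCompl _ ∘ₗ
            compProj N.grading n
        have hθ : θ x = 1 := by
          have : θ x = e (LocalizedModule.mk (compProj N.grading n x) 1) := rfl
          rw [this, compProj_of_mem x.2]
          exact he
        push_cast
        exact (hsymm n n).two_eq_zero hodd θ x.2 hθ
      exact CharP.ringChar_of_prime_eq_zero Nat.prime_two h2
    · intro k hk
      have h1 := annihilator_sup_eq_top hk (hsymm k n) (hfg k) (hfg n)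
      have h2 : ¬ Module.annihilator R (N.grading k) ≤ m := fun h2 =>
        hm.ne_top (eq_top_iff.2 (h1 ▸ sup_le h2 hn))
      obtain ⟨s, hs, hsm⟩ := SetLike.not_le_iff_exists.1 h2
      exact subsingleton_localizedModule_of_annihilator hs hsm

/-- The local structure of locally singly generated modules in terms of elements. -/
theorem locallySinglyGenerated.exists_generator {N : PosGrMod R} (h : locallySinglyGenerated R N)
    (m : Ideal R) [m.IsMaximal] : (∀ k, ∀ v ∈ N.grading k, ∃ s ∉ m, s • v = 0) ∨
      ∃ n, ∃ x ∈ N.grading n, (∀ v ∈ N.grading n, ∃ s ∉ m, ∃ r : R, s • v = r • x) ∧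
        (Odd n → ∃ s ∉ m, s • (2 : R) • x = 0) ∧
        ∀ k, k ≠ n → ∀ v ∈ N.grading k, ∃ s ∉ m, s • v = 0 := by
  have hsub : ∀ k, Subsingleton (LocalizedModule m.primeCompl (N.grading k)) →
      ∀ v ∈ N.grading k, ∃ s ∉ m, s • v = 0 := by
    intro k hk v hv
    obtain ⟨s, hs, h⟩ := LocalizedModule.subsingleton_iff.1 hk ⟨v, hv⟩
    exact ⟨s, hs, congrArg Subtype.val h⟩
  rcases h m with h | ⟨a, n, ha, hchar, ⟨e⟩, h⟩
  · exact Or.inl fun k => hsub k (h k)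
  · right
    obtain ⟨⟨x, t⟩, hx⟩ : ∃ y : N.grading n × m.primeCompl, LocalizedModule.mk y.1 y.2 = e.symm 1 :=
      LocalizedModule.induction_on (fun x t => ⟨(x, t), rfl⟩) (e.symm 1)
    refine ⟨n, x, x.2, ?_, ?_, fun k hk => hsub k (h k hk)⟩
    · intro v hv
      obtain ⟨a, ha⟩ := Ideal.Quotient.mk_surjective (e (LocalizedModule.mk ⟨v, hv⟩ 1))
      have h1 : LocalizedModule.mk ⟨v, hv⟩ 1 = a • e.symm 1 := by
        rw [← map_smul, LinearEquiv.eq_symm_apply, ← ha]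
        exact congrArg (Ideal.Quotient.mk _) (mul_one a).symm
      induction a using Localization.induction_on with
      | H b =>
        obtain ⟨r, s⟩ := b
        rw [← hx, LocalizedModule.mk_smul_mk, LocalizedModule.mk_eq] at h1
        obtain ⟨u, hu⟩ := h1
        refine ⟨u * (s * t), (u * (s * t)).2, u * r, ?_⟩
        have h2 := congrArg Subtype.val hu
        rw [one_smul] at h2
        exact (mul_smul _ _ _).trans (h2.trans (mul_smul _ _ _).symm)
    · intro hodd
      have h2 : ((2 : ℕ) : Localization.AtPrime m ⧸ a.map (algebraMap R (Localization.AtPrime m))) =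
          0 := by
        have h3 : ringChar (Localization.AtPrime m ⧸ a.map (algebraMap R (Localization.AtPrime m))) =
            2 := by
          by_contra hc
          exact (Nat.not_even_iff_odd.2 hodd) (hchar hc)
        rw [← h3]
        exact ringChar.Nat.cast_ringChar
      have h4 : (2 : R) • e.symm 1 = 0 := by
        rw [two_smul, ← map_add, one_add_one_eq_two]
        push_cast at h2
        rw [h2, map_zero]
      rw [← hx, LocalizedModule.smul'_mk, ← LocalizedModule.zero_mk (1 : m.primeCompl),
        LocalizedModule.mk_eq] at h4
      obtain ⟨u, hu⟩ := h4
      rw [smul_zero, smul_zero, one_smul] at hu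
      exact ⟨u, u.2, congrArg Subtype.val hu⟩

end PosGrMod

end CogroupAlg

end

noncomputable section
namespace CogroupAlg

/-! ## Graded commutative tensor algebras -/

variable {R : Type u} [CommRing R]

theorem neg_one_pow_mul_eq_smul (R : Type u) [CommRing R] {A : Type u} [Ring A] [Algebra R A]
    (n : ℕ) (x : A) : (-1) ^ n * x = ((-1 : R) ^ n) • x := by
  rw [Algebra.smul_def, map_pow, map_neg, map_one]

theorem neg_one_zpow_smul_eq (R : Type u) [CommRing R] {M : Type u} [AddCommGroup M] [Module R M]
    (n : ℕ) (x : M) : (-1 : ℤ) ^ n • x = ((-1 : R) ^ n) • x := by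
  rcases Nat.even_or_odd n with e | e
  · rw [e.neg_one_pow, e.neg_one_pow, one_smul, one_smul]
  · rw [e.neg_one_pow, e.neg_one_pow, neg_smul, neg_smul, one_smul, one_smul]

namespace AlgComon

open ConnAlg

variable {A B : AlgComon R}

theorem mapHom_inv_hom (k : A ≅ B) (x : B.carrier) : mapHom k.hom (mapHom k.inv x) = x :=
  DFunLike.congr_fun (congrArg mapHom k.inv_hom_id) x

theorem isGradedCommutative_of_iso (k : A ≅ B) (h : A.IsGradedCommutative) :
    B.IsGradedCommutative := by
  intro p q a b ha hb
  have h1 := congrArg (mapHom k.hom)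
    (h p q _ _ (mapHom_mem k.inv p a ha) (mapHom_mem k.inv q b hb))
  simpa only [map_mul, map_pow, map_neg, map_one, mapHom_inv_hom] using h1

theorem isFiniteType_of_iso (k : A ≅ B) (h : A.IsFiniteType) : B.IsFiniteType := by
  intro n
  have e : B.grading n = (A.grading n).map (mapHom k.hom).toLinearMap := by
    ext x
    constructor
    · intro hx
      exact ⟨mapHom k.inv x, mapHom_mem k.inv n x hx, mapHom_inv_hom k x⟩
    · rintro ⟨y, hy, rfl⟩
      exact mapHom_mem k.hom n y hy
  rw [e]
  exact (h n).map _

/-- The only proper cut of a word of two generators is between them; thus relations between products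
become relations between tensors. -/
theorem decBar_mul_of_mem_prim {c d : A.carrier} (hc : c ∈ A.prim) (hd : d ∈ A.prim)
    (hc0 : A.aug c = 0) (hd0 : A.aug d = 0) : A.decBar (c * d) = c ⊗ₜ d := by
  rw [decBar_apply, dec_mul hc hc0, dec_of_mem_prim hd, hd0, map_mul, hc0]
  simp [mul_add]
  abel

end AlgComon

/-! ### Finiteness and commutativity of tensor algebras -/

namespace ConnCoalg

open ConnAlg AlgComon

variable {C : ConnCoalg R}

/-- Induction over words with control of the degree: the first letter has positive degree and the
rest of the word is homogeneous. -/
theorem tensorComon_grading_le {W : ℕ → Submodule R C.tensorComon.carrier} (h1 : 1 ∈ W 0)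
    (h : ∀ k, k ≠ 0 → ∀ c ∈ C.grading k, ∀ n, ∀ t ∈ C.tensorComon.grading n, t ∈ W n →
      C.tgen c * t ∈ W (k + n)) (n : ℕ) : C.tensorComon.grading n ≤ W n := by
  have key : ∀ t : C.tensorComon.carrier,
      ∀ n, (DirectSum.decompose C.tensorComon.grading t n : C.tensorComon.carrier) ∈ W n := by
    -- All homogeneous components are treated at once, since the induction over words passes through
    -- inhomogeneous elements.
    let S : Submodule R C.tensorComon.carrier := ⨅ n, (W n).comap
      ((C.tensorComon.grading n).subtype ∘ₗ compProj C.tensorComon.grading n)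
    have hS : ∀ t, t ∈ S ↔ ∀ n,
        (DirectSum.decompose C.tensorComon.grading t n : C.tensorComon.carrier) ∈ W n :=
      fun t => Submodule.mem_iInf _
    intro t
    rw [← hS]
    refine tensorComon_mem_of_homogeneous_mul_mem ?_ ?_ t
    · rw [hS]
      intro n
      have h0 : (1 : C.tensorComon.carrier) ∈ C.tensorComon.grading 0 := SetLike.GradedOne.one_mem
      by_cases hn : 0 = n
      · subst hn
        rwa [DirectSum.decompose_of_mem_same _ h0]
      · rw [DirectSum.decompose_of_mem_ne _ h0 hn]
        exact zero_mem _
    · intro k hk c hc t ht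
      rw [hS] at ht ⊢
      intro n
      by_cases hkn : k ≤ n
      · rw [DirectSum.coe_decompose_mul_of_left_mem_of_le _ (C.tgen_mem k c hc) hkn]
        have := h k hk c hc (n - k) _ (SetLike.coe_mem _) (ht (n - k))
        rwa [Nat.add_sub_cancel' hkn] at this
      · rw [DirectSum.coe_decompose_mul_of_left_mem_of_not_le _ (C.tgen_mem k c hc) hkn]
        exact zero_mem _
  intro t ht
  have := key t n
  rwa [DirectSum.decompose_of_mem_same _ ht] at this

/-- Splitting off the first letter gives `Tₙ = ∑ Cₖ Tₙ₋ₖ` over `1 ≤ k ≤ n`, a finite sum of products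
with lower degrees. -/
theorem isFiniteType_tensorComon (h : ∀ k, (C.grading k).FG) : C.tensorComon.IsFiniteType := by
  let W : ℕ → Submodule R C.tensorComon.carrier := fun n =>
    if n = 0 then Submodule.span R {1} else
      ⨆ k ∈ Finset.Icc 1 n, (C.grading k).map C.tgen * C.tensorComon.grading (n - k)
  have hle : ∀ n, C.tensorComon.grading n ≤ W n := by
    refine tensorComon_grading_le ?_ ?_
    · simp only [W, if_true]
      exact Submodule.mem_span_singleton_self _
    · intro k hk c hc n t ht _
      simp only [W]
      rw [if_neg (by omega)]
      refine Submodule.mem_iSup_of_mem k (Submodule.mem_iSup_of_mem (by simp; omega) ?_)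
      rw [Nat.add_sub_cancel_left]
      exact Submodule.mul_mem_mul ⟨c, hc, rfl⟩ ht
  have hge : ∀ n, W n ≤ C.tensorComon.grading n := by
    intro n
    simp only [W]
    split_ifs with hn
    · subst hn
      rw [Submodule.span_singleton_le_iff_mem]
      exact SetLike.GradedOne.one_mem
    · refine iSup₂_le fun k hk => Submodule.mul_le.2 ?_
      rintro _ ⟨c, hc, rfl⟩ t ht
      have := SetLike.mul_mem_graded (C.tgen_mem k c hc) ht
      rwa [Nat.add_sub_cancel' (Finset.mem_Icc.1 hk).2] at this
  intro n
  induction n using Nat.strong_induction_on with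
  | _ n ih =>
    rw [le_antisymm (hle n) (hge n)]
    simp only [W]
    split_ifs with hn
    · exact Submodule.fg_span_singleton _
    · refine Submodule.fg_biSup _ _ fun k hk => ?_
      have hk' := Finset.mem_Icc.1 hk
      exact ((h k).map _).mul (ih (n - k) (by omega))

/-- The degree `n` part of `C` is a quotient of that of its tensor algebra, by a retraction followed
by a projection. -/
theorem grading_fg_of_isFiniteType (h : C.tensorComon.IsFiniteType) (n : ℕ) :
    (C.grading n).FG := by
  have e : C.grading n = (C.tensorComon.grading n).map
      ((C.grading n).subtype ∘ₗ compProj C.grading n ∘ₗ C.tgenInv) := by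
    ext x
    constructor
    · intro hx
      refine ⟨C.tgen x, C.tgen_mem n x hx, ?_⟩
      rw [LinearMap.comp_apply, LinearMap.comp_apply, tgenInv_tgen, compProj_of_mem hx]
      rfl
    · rintro ⟨y, _, rfl⟩
      exact SetLike.coe_mem _
  rw [e]
  exact (h n).map _

/-- Two inductions over words: a generator first commutes past all words, then words commute past an
arbitrary element; the exponents of the signs add up. -/
theorem isGradedCommutative_tensorComon
    (h : ∀ p q, p ≠ 0 → q ≠ 0 → ∀ v ∈ C.grading p, ∀ w ∈ C.grading q,
      C.tgen v * C.tgen w = ((-1 : R) ^ (p * q)) • (C.tgen w * C.tgen v)) :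
    C.tensorComon.IsGradedCommutative := by
  have h1 : ∀ k, k ≠ 0 → ∀ c ∈ C.grading k, ∀ n, ∀ t ∈ C.tensorComon.grading n,
      C.tgen c * t = ((-1 : R) ^ (k * n)) • (t * C.tgen c) := by
    intro k hk c hc
    refine tensorComon_grading_le (W := fun n => LinearMap.eqLocus
      (LinearMap.mulLeft R (C.tgen c)) (((-1 : R) ^ (k * n)) • LinearMap.mulRight R (C.tgen c))) ?_ ?_
    · simp [LinearMap.mem_eqLocus]
    · intro j hj d hd n t _ ht
      have ht : C.tgen c * t = ((-1 : R) ^ (k * n)) • (t * C.tgen c) := ht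
      change C.tgen c * (C.tgen d * t) = ((-1 : R) ^ (k * (j + n))) • (C.tgen d * t * C.tgen c)
      rw [← mul_assoc, h k j hk hj c hc d hd, smul_mul_assoc, mul_assoc, ht, mul_smul_comm, smul_smul,
        mul_add, pow_add, mul_assoc]
  intro p q a b ha hb
  rw [neg_one_pow_mul_eq_smul R]
  have h2 : ∀ n, ∀ t ∈ C.tensorComon.grading n, t * b = ((-1 : R) ^ (n * q)) • (b * t) := by
    refine tensorComon_grading_le (W := fun n => LinearMap.eqLocus
      (LinearMap.mulRight R b) (((-1 : R) ^ (n * q)) • LinearMap.mulLeft R b)) ?_ ?_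
    · simp [LinearMap.mem_eqLocus]
    · intro j hj d hd n t _ ht
      have ht : t * b = ((-1 : R) ^ (n * q)) • (b * t) := ht
      change C.tgen d * t * b = ((-1 : R) ^ ((j + n) * q)) • (b * (C.tgen d * t))
      rw [mul_assoc, ht, mul_smul_comm, ← mul_assoc, h1 j hj d hd q b hb, smul_mul_assoc, smul_smul,
        add_mul, pow_add, mul_assoc, mul_comm]
  exact h2 p a ha

/-- Apply `decBar` to the commutation relation of two generators. -/
theorem symmTensor_of_isGradedCommutative (h : C.tensorComon.IsGradedCommutative) {p q : ℕ}
    (hp : p ≠ 0) (hq : q ≠ 0) : SymmTensor C.grading p q := by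
  intro x hx y hy
  apply C.map_tgen_injective
  have h1 := h p q _ _ (C.tgen_mem p x hx) (C.tgen_mem q y hy)
  rw [neg_one_pow_mul_eq_smul R] at h1
  have hx0 : C.tensorComon.aug (C.tgen x) = 0 := C.tensorComon.aug_of_mem hp (C.tgen_mem p x hx)
  have hy0 : C.tensorComon.aug (C.tgen y) = 0 := C.tensorComon.aug_of_mem hq (C.tgen_mem q y hy)
  have h2 := congrArg C.tensorComon.decBar h1
  rw [map_smul, decBar_mul_of_mem_prim (tgen_mem_prim x) (tgen_mem_prim y) hx0 hy0,
    decBar_mul_of_mem_prim (tgen_mem_prim y) (tgen_mem_prim x) hy0 hx0] at h2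
  rw [neg_one_zpow_smul_eq R, map_smul]
  exact h2

/-! ### Vanishing of the reduced comultiplication -/

variable (C)

/-- The reduced comultiplication. -/
def redComul : C.carrier →ₗ[R] C.carrier ⊗[R] C.carrier :=
  TensorProduct.map (LinearMap.id - C.projZero) (LinearMap.id - C.projZero) ∘ₗ Coalgebra.comul

variable {C}

theorem redComul_apply (x : C.carrier) : C.redComul x = Coalgebra.comul (R := R) x -
    x ⊗ₜ C.unitElt - C.unitElt ⊗ₜ x +
      Coalgebra.counit (R := R) x • (C.unitElt ⊗ₜ[R] C.unitElt) := by
  have key : ∀ d : C.carrier ⊗[R] C.carrier,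
      TensorProduct.map (LinearMap.id - C.projZero) (LinearMap.id - C.projZero) d = d -
      (TensorProduct.rid R _ (Coalgebra.counit.lTensor C.carrier d)) ⊗ₜ C.unitElt -
      C.unitElt ⊗ₜ (TensorProduct.lid R _ (Coalgebra.counit.rTensor C.carrier d)) +
      Coalgebra.counit (R := R) (TensorProduct.lid R _ (Coalgebra.counit.rTensor C.carrier d)) •
        (C.unitElt ⊗ₜ[R] C.unitElt) := by
    intro d
    induction d with
    | zero => simp
    | add a b ha hb =>
      simp only [map_add, ha, hb, add_tmul, tmul_add, add_smul]
      abel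
    | tmul a b =>
      simp only [TensorProduct.map_tmul, LinearMap.sub_apply, LinearMap.id_apply, projZero_eq,
        sub_tmul, tmul_sub, tmul_smul, ← smul_tmul', LinearMap.lTensor_tmul, LinearMap.rTensor_tmul,
        TensorProduct.rid_tmul, TensorProduct.lid_tmul, map_smul, smul_eq_mul, smul_smul, smul_sub]
      module
  rw [redComul, LinearMap.comp_apply, key, Coalgebra.rTensor_counit_comul,
    Coalgebra.lTensor_counit_comul]
  simp

/-- Removing the degree zero parts discards every term with a factor of degree zero, so both factors
of each remaining term have degree strictly between `0` and `n`. -/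
theorem redComul_mem {n : ℕ} {x : C.carrier} (hx : x ∈ C.grading n) : C.redComul x ∈
    Submodule.span R {t | ∃ p q, p ≠ 0 ∧ q ≠ 0 ∧ p + q = n ∧ ∃ y ∈ C.grading p,
      ∃ z ∈ C.grading q, t = y ⊗ₜ[R] z} := by
  have h := C.comul_mem n x hx
  rw [redComul, LinearMap.comp_apply]
  generalize Coalgebra.comul (R := R) x = d at h ⊢
  induction h using Submodule.span_induction with
  | mem t ht =>
    obtain ⟨p, q, hpq, y, hy, z, hz, rfl⟩ := ht
    rw [TensorProduct.map_tmul, LinearMap.sub_apply, LinearMap.sub_apply, LinearMap.id_apply,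
      LinearMap.id_apply]
    by_cases hp : p = 0
    · subst hp
      rw [C.projZero_zero hy, sub_self, zero_tmul]
      exact zero_mem _
    · by_cases hq : q = 0
      · subst hq
        rw [C.projZero_zero hz, sub_self, tmul_zero]
        exact zero_mem _
      · rw [C.projZero_of_mem hp hy, C.projZero_of_mem hq hz, sub_zero, sub_zero]
        exact Submodule.subset_span ⟨p, q, hp, hq, hpq, y, hy, z, hz, rfl⟩
  | zero => rw [map_zero]; exact zero_mem _
  | add a b _ _ ha hb => rw [map_add]; exact add_mem ha hb
  | smul r a _ ha => rw [map_smul]; exact Submodule.smul_mem _ _ ha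

/-- If `C` is finitely generated in every degree and its tensor square is graded symmetric in
positive degrees, then the reduced comultiplication vanishes. -/
theorem redComul_eq_zero (hfg : ∀ n, (C.grading n).FG)
    (hsymm : ∀ p q, p ≠ 0 → q ≠ 0 → SymmTensor C.grading p q) : C.redComul = 0 := by
  refine hom_ext_grading fun n x hx => ?_
  rw [LinearMap.zero_apply]
  -- Write `1 = i + j`, where `i` kills degree `n` and `j` kills all degrees strictly between `0`
  -- and `n`. Then `i` kills `x`, and `j` kills the first tensor factors of its reduced coproduct.
  have hco : IsCoprime (Module.annihilator R (C.grading n))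
      (∏ p ∈ Finset.Ioo 0 n, Module.annihilator R (C.grading p)) := by
    refine IsCoprime.prod_right fun p hp => ?_
    have hp := Finset.mem_Ioo.1 hp
    rw [Ideal.isCoprime_iff_sup_eq]
    exact annihilator_sup_eq_top (by omega) (hsymm n p (by omega) (by omega)) (hfg n) (hfg p)
  obtain ⟨i, hi, j, hj, hij⟩ := Ideal.isCoprime_iff_exists.1 hco
  have h1 : i • C.redComul x = 0 := by
    have h2 : i • x = 0 := congrArg Subtype.val (Module.mem_annihilator.1 hi ⟨x, hx⟩)
    rw [← map_smul, h2, map_zero]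
  have h2 : j • C.redComul x = 0 := by
    have h := redComul_mem hx
    generalize C.redComul x = d at h
    induction h using Submodule.span_induction with
    | mem t ht =>
      obtain ⟨p, q, hp, hq, hpq, y, hy, z, hz, rfl⟩ := ht
      have hjp : j ∈ Module.annihilator R (C.grading p) := by
        have := Ideal.prod_le_inf hj
        exact (Finset.inf_le (Finset.mem_Ioo.2 ⟨by omega, by omega⟩) :
          (Finset.Ioo 0 n).inf (fun p => Module.annihilator R (C.grading p)) ≤ _) this
      have h2 : j • y = 0 := congrArg Subtype.val (Module.mem_annihilator.1 hjp ⟨y, hy⟩)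
      rw [smul_tmul', h2, zero_tmul]
    | zero => rw [smul_zero]
    | add a b _ _ ha hb => rw [smul_add, ha, hb, add_zero]
    | smul r a _ ha => rw [smul_comm, ha, smul_zero]
  rw [← one_smul R (C.redComul x), ← hij, add_smul, h1, h2, add_zero]

theorem comul_eq_of_commutative (hfg : C.tensorComon.IsFiniteType)
    (h : C.tensorComon.IsGradedCommutative) (x : C.carrier) : Coalgebra.comul (R := R) x =
      x ⊗ₜ C.unitElt + C.unitElt ⊗ₜ x -
        Coalgebra.counit (R := R) x • (C.unitElt ⊗ₜ[R] C.unitElt) := by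
  have h1 := redComul_apply x
  rw [redComul_eq_zero (grading_fg_of_isFiniteType hfg)
    (fun p q hp hq => symmTensor_of_isGradedCommutative h hp hq), LinearMap.zero_apply] at h1
  rw [← sub_eq_zero, h1]
  abel

theorem posMod_symmTensor (h : C.tensorComon.IsGradedCommutative) (p q : ℕ) :
    SymmTensor C.posMod.grading p q := by
  intro x hx y hy
  by_cases hp : p = 0
  · subst hp
    rw [C.posMod.grading_zero, Submodule.mem_bot] at hx
    rw [hx, zero_tmul, tmul_zero, smul_zero]
  · by_cases hq : q = 0
    · subst hq
      rw [C.posMod.grading_zero, Submodule.mem_bot] at hy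
      rw [hy, zero_tmul, tmul_zero, smul_zero]
    · have h1 := symmTensor_of_isGradedCommutative h hp hq (C.pos.subtype x) hx (C.pos.subtype y) hy
      have h2 := congrArg (TensorProduct.map C.projPos C.projPos) h1
      rw [map_zsmul, TensorProduct.map_tmul, TensorProduct.map_tmul] at h2
      have ex : C.projPos (C.pos.subtype x) = x := C.projPos_coe x
      have ey : C.projPos (C.pos.subtype y) = y := C.projPos_coe y
      rw [ex, ey] at h2
      exact h2

theorem posMod_grading_fg (h : ∀ n, (C.grading n).FG) (n : ℕ) : (C.posMod.grading n).FG := by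
  have e : (C.grading n).comap C.pos.subtype = (C.grading n).map C.projPos := by
    ext x
    constructor
    · intro hx
      exact ⟨x, hx, C.projPos_coe x⟩
    · rintro ⟨y, hy, rfl⟩
      change (C.projPos y : C.carrier) ∈ C.grading n
      rw [coe_projPos]
      refine sub_mem hy ?_
      by_cases h : n = 0
      · subst h; exact C.projZero_mem y
      · rw [C.projZero_of_mem h hy]; exact zero_mem _
  change ((C.grading n).comap C.pos.subtype).FG
  rw [e]
  exact (h n).map _

end ConnCoalg

end CogroupAlg

end

noncomputable section
namespace CogroupAlg

/-! ## The restricted functors -/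

variable {R : Type u} [CommRing R]

/-- The annihilator of `z` lies in no maximal ideal. -/
theorem eq_zero_of_forall_maximal {M : Type u} [AddCommGroup M] [Module R M] (z : M)
    (h : ∀ m : Ideal R, m.IsMaximal → ∃ s ∉ m, s • z = 0) : z = 0 := by
  by_contra hz
  have hne : LinearMap.ker (LinearMap.toSpanSingleton R M z) ≠ ⊤ := by
    intro ht
    have h1 : (1 : R) ∈ LinearMap.ker (LinearMap.toSpanSingleton R M z) := ht ▸ trivial
    rw [LinearMap.mem_ker, LinearMap.toSpanSingleton_apply, one_smul] at h1
    exact hz h1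
  obtain ⟨m, hm, hle⟩ := Ideal.exists_le_maximal _ hne
  obtain ⟨s, hs, hsz⟩ := h m hm
  exact hs (hle (by rwa [LinearMap.mem_ker, LinearMap.toSpanSingleton_apply]))

/-! ### Graded commutativity for locally singly generated modules -/

namespace PosGrMod

variable {N : PosGrMod R}

/-- At each maximal ideal either one of the two elements vanishes, or both become multiples of a
single generator `x`. Then the two products agree, and in odd degree the sign is harmless because `2
x` vanishes locally. -/
theorem locallySinglyGenerated.super_commute (h : locallySinglyGenerated R N) {T : Type u} [Ring T]
    [Algebra R T] (g : N.carrier →ₗ[R] T) {p q : ℕ} {v w : N.carrier} (hv : v ∈ N.grading p)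
    (hw : w ∈ N.grading q) : g v * g w = ((-1 : R) ^ (p * q)) • (g w * g v) := by
  rw [← sub_eq_zero]
  refine eq_zero_of_forall_maximal (R := R) _ fun m hm => ?_
  have kill : ∀ v w : N.carrier, ∀ s : R, s • v = 0 ∨ s • w = 0 →
      s • (g v * g w - ((-1 : R) ^ (p * q)) • (g w * g v)) = 0 := by
    rintro v w s (hs | hs)
    · rw [smul_sub, smul_comm s ((-1 : R) ^ (p * q)), ← smul_mul_assoc s (g v),
        ← mul_smul_comm s (g w), ← map_smul, hs]
      simp
    · rw [smul_sub, smul_comm s ((-1 : R) ^ (p * q)), ← mul_smul_comm s (g v),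
        ← smul_mul_assoc s (g w), ← map_smul, hs]
      simp
  rcases h.exists_generator m with h0 | ⟨n, x, -, hgen, hodd, hne⟩
  · obtain ⟨s, hs, hsv⟩ := h0 p v hv
    exact ⟨s, hs, kill v w s (Or.inl hsv)⟩
  · by_cases hp : p = n
    · by_cases hq : q = n
      · subst hp hq
        obtain ⟨s, hs, r, hsr⟩ := hgen v hv
        obtain ⟨s', hs', r', hsr'⟩ := hgen w hw
        have e : (s * s') • (g v * g w - ((-1 : R) ^ (q * q)) • (g w * g v)) =
            (r * r') • (g x * g x - ((-1 : R) ^ (q * q)) • (g x * g x)) := by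
          have e1 : (s * s') • (g v * g w) = (r * r') • (g x * g x) := by
            rw [← smul_mul_smul_comm, ← map_smul, ← map_smul, hsr, hsr', map_smul, map_smul,
              smul_mul_smul_comm]
          have e2 : (s * s') • (g w * g v) = (r * r') • (g x * g x) := by
            rw [mul_comm s s', ← smul_mul_smul_comm, ← map_smul, ← map_smul, hsr, hsr', map_smul,
              map_smul, smul_mul_smul_comm, mul_comm r' r]
          rw [smul_sub, smul_sub, e1, smul_comm, e2, smul_comm (r * r')]
        have hmul : s * s' ∉ m := fun hc => (hm.isPrime.mem_or_mem hc).elim hs hs'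
        rcases Nat.even_or_odd q with hq | hq
        · refine ⟨s * s', hmul, ?_⟩
          rw [e, (hq.mul_right q).neg_one_pow, one_smul, sub_self, smul_zero]
        · obtain ⟨t, ht, ht2⟩ := hodd hq
          refine ⟨t * (s * s'), fun hc => (hm.isPrime.mem_or_mem hc).elim ht hmul, ?_⟩
          rw [mul_smul, e, (hq.mul hq).neg_one_pow, smul_comm, neg_one_smul, sub_neg_eq_add,
            ← two_smul R (g x * g x), ← smul_mul_assoc, ← smul_mul_assoc, ← map_smul, ← map_smul,
            ht2, map_zero, zero_mul, smul_zero]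
      · obtain ⟨s, hs, hsw⟩ := hne q hq w hw
        exact ⟨s, hs, kill v w s (Or.inr hsw)⟩
    · obtain ⟨s, hs, hsv⟩ := hne p hp v hv
      exact ⟨s, hs, kill v w s (Or.inl hsv)⟩

theorem locallySinglyGenerated.isGradedCommutative (h : locallySinglyGenerated R N) :
    N.trivialCoalg.tensorComon.IsGradedCommutative := by
  refine ConnCoalg.isGradedCommutative_tensorComon fun p q hp hq v hv w hw => ?_
  let g : N.carrier →ₗ[R] N.trivialCoalg.tensorComon.carrier :=
    N.trivialCoalg.tgen ∘ₗ LinearMap.inr R R N.carrier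
  have key : ∀ n, n ≠ 0 → ∀ y ∈ N.trivialCoalg.grading n,
      ∃ y' ∈ N.grading n, N.trivialCoalg.tgen y = g y' := by
    intro n hn y hy
    obtain ⟨h1, h2⟩ := Submodule.mem_prod.1 hy
    rw [if_neg hn, Submodule.mem_bot] at h1
    refine ⟨y.2, h2, congrArg N.trivialCoalg.tgen ?_⟩
    exact Prod.ext h1 rfl
  obtain ⟨v', hv', ev⟩ := key p hp v hv
  obtain ⟨w', hw', ew⟩ := key q hq w hw
  rw [ev, ew]
  exact h.super_commute g hv' hw'

theorem isFiniteType_tensorComon (h : ∀ n, (N.grading n).FG) :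
    N.trivialCoalg.tensorComon.IsFiniteType := by
  refine ConnCoalg.isFiniteType_tensorComon fun n => ?_
  refine Submodule.FG.prod ?_ (h n)
  split_ifs
  · exact Module.Finite.fg_top
  · exact Submodule.fg_bot

theorem locallySinglyGenerated.tensorComon (h : locallySinglyGenerated R N) :
    AlgComon.commCocommCogroup R N.trivialCoalg.tensorComon :=
  ⟨⟨N.trivialCoalg.tensorComon_cogroup, h.isGradedCommutative⟩, N.trivialCoalg_tensorComon_cocomm⟩

theorem locallySinglyGeneratedFT.tensorComon (h : locallySinglyGeneratedFT R N) :
    AlgComon.commCogroupFT R N.trivialCoalg.tensorComon :=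
  ⟨⟨N.trivialCoalg.tensorComon_cogroup, h.1.isGradedCommutative⟩, isFiniteType_tensorComon h.2⟩

end PosGrMod

/-! ### Commutative and cocommutative cogroups in terms of their primitive elements -/

namespace AlgComon

variable {A : AlgComon R}

theorem commCogroupFT.isFiniteType_primCoalg (h : commCogroupFT R A) :
    A.primCoalg.tensorComon.IsFiniteType := isFiniteType_of_iso A.ofPrimIso.symm h.2

theorem commCogroup.isGradedCommutative_primCoalg (h : commCogroup R A) :
    A.primCoalg.tensorComon.IsGradedCommutative := isGradedCommutative_of_iso A.ofPrimIso.symm h.2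

theorem commCogroupFT.comul_primCoalg (h : commCogroupFT R A) (x : A.primCoalg.carrier) :
    Coalgebra.comul (R := R) x = x ⊗ₜ A.primCoalg.unitElt + A.primCoalg.unitElt ⊗ₜ x -
      Coalgebra.counit (R := R) x • (A.primCoalg.unitElt ⊗ₜ[R] A.primCoalg.unitElt) :=
  ConnCoalg.comul_eq_of_commutative h.isFiniteType_primCoalg
    (commCogroup.isGradedCommutative_primCoalg h.1) x

/-- Under these conditions the reduced comultiplication of the primitive elements vanishes, which
makes their tensor algebra, and hence the cogroup, cocommutative. -/
theorem commCogroupFT_le : commCogroupFT R ≤ commCocommCogroup R := fun A h =>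
  ⟨h.1, h.1.1, cocomm_of_iso A.ofPrimIso (ConnCoalg.cocomm_tensorComon_of_comul h.comul_primCoalg)⟩

theorem commCogroupFT.posMod_primCoalg (h : commCogroupFT R A) :
    PosGrMod.locallySinglyGeneratedFT R A.primCoalg.posMod := by
  have hfg := ConnCoalg.posMod_grading_fg
    (ConnCoalg.grading_fg_of_isFiniteType h.isFiniteType_primCoalg)
  exact ⟨PosGrMod.locallySinglyGenerated_of_symm _ hfg
    (ConnCoalg.posMod_symmTensor (commCogroup.isGradedCommutative_primCoalg h.1)), hfg⟩

theorem cocommCogroup.comul_primCoalg (h : cocommCogroup R A) (x : A.primCoalg.carrier) :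
    Coalgebra.comul (R := R) x = x ⊗ₜ A.primCoalg.unitElt + A.primCoalg.unitElt ⊗ₜ x -
      Coalgebra.counit (R := R) x • (A.primCoalg.unitElt ⊗ₜ[R] A.primCoalg.unitElt) :=
  ConnCoalg.comul_eq_of_cocomm (cocomm_of_iso A.ofPrimIso.symm h.2) x

theorem coalgCocommCogroup.cocomm_primCoalg (h : coalgCocommCogroup R A) :
    ConnCoalg.cocomm R A.primCoalg :=
  ConnCoalg.coalgCocomm_tensorComon_iff.1 (coalgCocomm_of_iso A.ofPrimIso.symm h.2)

end AlgComon

/-- A functor to a full subcategory is essentially surjective if every object of the subcategory is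
isomorphic, in the ambient category, to an object in its image. -/
theorem essSurj_lift {C D : Type*} [Category* C] [Category* D] (P : ObjectProperty D) (F : C ⥤ D)
    (hF : ∀ X, P (F.obj X)) (h : ∀ Y, P Y → ∃ X, Nonempty (F.obj X ≅ Y)) :
    (P.lift F hF).EssSurj where
  mem_essImage Y := by
    obtain ⟨X, ⟨e⟩⟩ := h Y.obj Y.property
    exact ⟨X, ⟨P.fullyFaithfulι.preimageIso (X := (P.lift F hF).obj X) e⟩⟩

theorem full_faithful_lift {C D : Type*} [Category* C] [Category* D] (P : ObjectProperty D)
    (F : C ⥤ D) [F.Full] [F.Faithful] (hF : ∀ X, P (F.obj X)) :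
    (P.lift F hF).Full ∧ (P.lift F hF).Faithful := ⟨inferInstance, inferInstance⟩

theorem isEquivalence_lift {C D : Type*} [Category* C] [Category* D] (P : ObjectProperty D)
    (F : C ⥤ D) [F.Full] [F.Faithful] (hF : ∀ X, P (F.obj X))
    (h : ∀ Y, P Y → ∃ X, Nonempty (F.obj X ≅ Y)) : (P.lift F hF).IsEquivalence where
  essSurj := essSurj_lift P F hF h

/-! ## Coefficients in a field -/

section Field

variable {K : Type u} [Field K] {M : Type u} [AddCommGroup M] [Module K M] {ℳ : ℕ → Submodule K M}

/-- Contracting `x ⊗ y = ± y ⊗ x` with a functional that is nonzero on `x` shows that `y` is a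
multiple of `x`, so one nonzero element spans the component. -/
theorem SymmTensor.fg [DirectSum.Decomposition ℳ] {n : ℕ} (h : SymmTensor ℳ n n) : (ℳ n).FG := by
  by_cases h0 : ℳ n = ⊥
  · rw [h0]; exact Submodule.fg_bot
  obtain ⟨x, hx, hx0⟩ := Submodule.exists_mem_ne_zero_of_ne_bot h0
  obtain ⟨φ, hφ⟩ := Module.Projective.exists_dual_ne_zero K hx0
  refine ⟨{x}, le_antisymm ?_ ?_⟩
  · simpa using hx
  · intro y hy
    have h1 := congrArg ((TensorProduct.lid K M).toLinearMap ∘ₗ φ.rTensor M) (h x hx y hy)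
    rw [map_zsmul] at h1
    simp only [LinearMap.comp_apply, LinearMap.rTensor_tmul, LinearEquiv.coe_coe,
      TensorProduct.lid_tmul] at h1
    rw [Finset.coe_singleton, ← Submodule.smul_mem_iff _ hφ, h1]
    exact zsmul_mem (Submodule.smul_mem _ _ (Submodule.mem_span_singleton_self x)) _

end Field

theorem ConnCoalg.grading_zero_fg (C : ConnCoalg R) : (C.grading 0).FG := by
  refine ⟨{C.unitElt}, le_antisymm ?_ fun x hx => ?_⟩
  · simpa using C.unitElt_mem
  · rw [Finset.coe_singleton, ← C.projZero_zero hx, C.projZero_eq]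
    exact Submodule.smul_mem _ _ (Submodule.mem_span_singleton_self _)

/-- Commutativity makes the tensor square of the primitive elements symmetric; over a field this
already bounds every component. -/
theorem AlgComon.commCogroup_le_of_isField (hR : IsField R) : commCogroup R ≤ commCogroupFT R := by
  intro A h
  refine ⟨h, isFiniteType_of_iso A.ofPrimIso (ConnCoalg.isFiniteType_tensorComon fun n => ?_)⟩
  by_cases hn : n = 0
  · subst hn
    exact ConnCoalg.grading_zero_fg _
  · let _ := hR.toField
    exact SymmTensor.fg (K := R) (ConnCoalg.symmTensor_of_isGradedCommutative
      (commCogroup.isGradedCommutative_primCoalg h) hn hn)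

/-! ### Locally singly generated modules over a field -/

namespace PosGrMod

variable {M N : PosGrMod R}

/-- A bijective homomorphism of graded modules is an isomorphism. -/
def isoOfBijective (f : M ⟶ N) (h : Function.Bijective (Hom.toLinearMap f)) : M ≅ N where
  hom := f
  inv := ⟨(LinearEquiv.ofBijective (Hom.toLinearMap f) h).symm, fun n y hy =>
    mem_of_map_mem M.grading N.grading (Hom.toLinearMap f) f.map_mem h.1 (by
      change (LinearEquiv.ofBijective (Hom.toLinearMap f) h)
        ((LinearEquiv.ofBijective (Hom.toLinearMap f) h).symm y) ∈ _
      rwa [LinearEquiv.apply_symm_apply])⟩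
  hom_inv_id := hom_ext (LinearMap.ext fun x =>
    (LinearEquiv.ofBijective (Hom.toLinearMap f) h).symm_apply_apply x)
  inv_hom_id := hom_ext (LinearMap.ext fun x =>
    (LinearEquiv.ofBijective (Hom.toLinearMap f) h).apply_symm_apply x)

theorem eq_zero_of_forall_homogeneous (h : ∀ n, ∀ x ∈ N.grading n, x = 0) (x : N.carrier) :
    x = 0 := by
  induction x using DirectSum.Decomposition.inductionOn N.grading with
  | zero => rfl
  | homogeneous m => exact h _ _ m.2
  | add a b ha hb => rw [ha, hb, add_zero]

/-- The homomorphism from `R[n]` given by an element of degree `n`. -/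
def ofShift {n : ℕ} (hn : 0 < n) (x : N.carrier) (hx : x ∈ N.grading n) : shift R n hn ⟶ N where
  toLinearMap := LinearMap.toSpanSingleton R N.carrier x
  map_mem k (r : R) hr := by
    change r • x ∈ N.grading k
    by_cases hk : k = n
    · subst hk; exact Submodule.smul_mem _ _ hx
    · have hr : r ∈ (if k = n then ⊤ else ⊥ : Submodule R R) := hr
      rw [if_neg hk, Submodule.mem_bot] at hr
      rw [hr, zero_smul]
      exact zero_mem _

theorem locallySinglyGenerated_le_basic (hR : IsField R) :
    locallySinglyGenerated R ≤ basic R := by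
  intro N h
  let _ := hR.toField
  -- The zero ideal is maximal and elements outside it are invertible, so the local description
  -- holds globally.
  have hm : (⊥ : Ideal R).IsMaximal := Ideal.bot_isMaximal
  have cancel : ∀ s ∉ (⊥ : Ideal R), ∀ v : N.carrier, s • v = 0 → v = 0 := fun s hs v hv =>
    (smul_eq_zero.1 hv).resolve_left fun h0 => hs (Ideal.mem_bot.2 h0)
  rcases h.exists_generator ⊥ with h0 | ⟨n, x, hx, hgen, hodd, hne⟩
  · left
    refine subsingleton_of_forall_eq 0 (eq_zero_of_forall_homogeneous fun n x hx => ?_)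
    obtain ⟨s, hs, hsx⟩ := h0 n x hx
    exact cancel s hs x hsx
  · have hne' : ∀ k, k ≠ n → ∀ v ∈ N.grading k, v = 0 := fun k hk v hv => by
      obtain ⟨s, hs, hsv⟩ := hne k hk v hv
      exact cancel s hs v hsv
    have hgen' : ∀ v ∈ N.grading n, ∃ r : R, r • x = v := fun v hv => by
      obtain ⟨s, hs, r, hr⟩ := hgen v hv
      refine ⟨s⁻¹ * r, ?_⟩
      rw [mul_smul, ← hr, inv_smul_smul₀ fun h0 => hs (Ideal.mem_bot.2 h0)]
    by_cases hx0 : x = 0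
    · left
      refine subsingleton_of_forall_eq 0 (eq_zero_of_forall_homogeneous fun k v hv => ?_)
      by_cases hk : k = n
      · subst hk
        obtain ⟨r, rfl⟩ := hgen' v hv
        rw [hx0, smul_zero]
      · exact hne' k hk v hv
    · right
      have hn : 0 < n := by
        refine Nat.pos_of_ne_zero fun h0 => hx0 ?_
        subst h0
        rwa [N.grading_zero, Submodule.mem_bot] at hx
      refine ⟨n, hn, fun hc => ?_, ⟨(isoOfBijective (ofShift hn x hx) ⟨?_, ?_⟩).symm⟩⟩
      · rw [← Nat.not_odd_iff_even]
        intro ho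
        obtain ⟨s, hs, h2⟩ := hodd ho
        have h2 : (2 : R) = 0 := (smul_eq_zero.1 (cancel s hs _ h2)).resolve_right hx0
        exact hc (CharP.ringChar_of_prime_eq_zero Nat.prime_two (by exact_mod_cast h2))
      · intro r r' h
        exact smul_left_injective R hx0 h
      · intro v
        change v ∈ LinearMap.range (LinearMap.toSpanSingleton R N.carrier x)
        induction v using DirectSum.Decomposition.inductionOn N.grading with
        | zero => exact zero_mem _
        | @homogeneous k m =>
          by_cases hk : k = n
          · subst hk
            exact hgen' _ m.2
          · rw [hne' k hk _ m.2]; exact zero_mem _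
        | add a b ha hb => exact add_mem ha hb

/-- A module concentrated in one degree and generated by one element has a symmetric tensor square,
so the criterion by symmetric tensors applies over any ring. -/
theorem basic_le_locallySinglyGeneratedFT : basic R ≤ locallySinglyGeneratedFT R := by
  rintro N (h | ⟨n, hn, hchar, ⟨e⟩⟩)
  · have hfg : ∀ n, (N.grading n).FG := fun n => by
      rw [Subsingleton.elim (N.grading n) ⊥]
      exact Submodule.fg_bot
    refine ⟨locallySinglyGenerated_of_symm N hfg fun p q x _ y _ => ?_, hfg⟩
    rw [Subsingleton.elim x 0, zero_tmul, tmul_zero, smul_zero]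
  · let f : R →ₗ[R] N.carrier := Hom.toLinearMap e.inv
    let g : N.carrier →ₗ[R] R := Hom.toLinearMap e.hom
    have hfg' : ∀ x, f (g x) = x := fun x =>
      DFunLike.congr_fun (congrArg Hom.toLinearMap e.hom_inv_id) x
    have hx : ∀ x, g x • f 1 = x := fun x => by
      rw [← map_smul, smul_eq_mul, mul_one, hfg']
    have hk : ∀ k, k ≠ n → ∀ x ∈ N.grading k, x = 0 := fun k hk x hx => by
      have h1 : g x ∈ (if k = n then ⊤ else ⊥ : Submodule R R) := e.hom.map_mem k x hx
      rw [if_neg hk, Submodule.mem_bot] at h1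
      rw [← hfg' x, h1, map_zero]
    have hfg : ∀ k, (N.grading k).FG := fun k => by
      by_cases hkn : k = n
      · subst hkn
        refine ⟨{f 1}, le_antisymm ?_ fun x _ => ?_⟩
        · rw [Finset.coe_singleton, Submodule.span_singleton_le_iff_mem]
          refine e.inv.map_mem k (1 : R) ?_
          change (1 : R) ∈ (if k = k then ⊤ else ⊥ : Submodule R R)
          simp
        · rw [Finset.coe_singleton, ← hx x]
          exact Submodule.smul_mem _ _ (Submodule.mem_span_singleton_self _)
      · rw [(Submodule.eq_bot_iff _).2 (hk k hkn)]
        exact Submodule.fg_bot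
    refine ⟨locallySinglyGenerated_of_symm N hfg fun p q x hxp y hyq => ?_, hfg⟩
    by_cases hp : p = n
    · by_cases hq : q = n
      · subst hp hq
        -- Either the degree is even, or `2 = 0` in `R`.
        have h1 : (-1 : R) ^ (q * q) = 1 := by
          by_cases h2 : ringChar R = 2
          · have h3 : ((2 : ℕ) : R) = 0 := h2 ▸ ringChar.Nat.cast_ringChar
            have h4 : (-1 : R) = 1 := by
              rw [neg_eq_iff_add_eq_zero, one_add_one_eq_two]
              exact_mod_cast h3
            rw [h4, one_pow]
          · exact ((hchar h2).mul_right q).neg_one_pow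
        rw [neg_one_zpow_smul_eq R, h1, one_smul, ← hx x, ← hx y, smul_tmul_smul, smul_tmul_smul,
          mul_comm]
      · rw [hk q hq y hyq, zero_tmul, tmul_zero, smul_zero]
    · rw [hk p hp x hxp, zero_tmul, tmul_zero, smul_zero]

end PosGrMod

end CogroupAlg

end

/-! ### The diagram of categories -/

theorem corollary1p7 (R : Type u) [CommRing R] :
    -- the functor `C` takes values in `ᶜᵒ𝒞`, and `T_CM` and `T_CM ∘ C` restrict as in the diagram
    ∃ (hC : ∀ N : PosGrMod R, ConnCoalg.cocomm R ((trivialFunctor R).obj N))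
      (h₁ : ∀ N : (PosGrMod.locallySinglyGeneratedFT R).FullSubcategory,
        AlgComon.commCogroupFT R ((tensorFunctor R).obj ((trivialFunctor R).obj N.obj)))
      (h₂ : ∀ N : (PosGrMod.locallySinglyGenerated R).FullSubcategory,
        AlgComon.commCocommCogroup R ((tensorFunctor R).obj ((trivialFunctor R).obj N.obj)))
      (h₃ : ∀ N : PosGrMod R,
        AlgComon.cocommCogroup R ((tensorFunctor R).obj ((trivialFunctor R).obj N)))
      (h₄ : ∀ C : (ConnCoalg.cocomm R).FullSubcategory,
        AlgComon.coalgCocommCogroup R ((tensorFunctor R).obj C.obj))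
      (h₅ : ∀ C : ConnCoalg R, AlgComon.cogroup R ((tensorFunctor R).obj C))
      -- the inclusions of full subcategories in the two rows
      (i₁ : PosGrMod.locallySinglyGeneratedFT R ≤ PosGrMod.locallySinglyGenerated R)
      (j₁ : AlgComon.commCogroupFT R ≤ AlgComon.commCocommCogroup R)
      (j₂ : AlgComon.commCocommCogroup R ≤ AlgComon.cocommCogroup R)
      (j₃ : AlgComon.cocommCogroup R ≤ AlgComon.coalgCocommCogroup R)
      (j₄ : AlgComon.coalgCocommCogroup R ≤ AlgComon.cogroup R),
      -- the top row `𝒮^ft → 𝒮 → ℳ → ᶜᵒ𝒞 → 𝒞`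
      let t₁ := ObjectProperty.ιOfLE i₁
      let t₂ := (PosGrMod.locallySinglyGenerated R).ι
      let t₃ := (ConnCoalg.cocomm R).lift (trivialFunctor R) hC
      let t₄ := (ConnCoalg.cocomm R).ι
      -- the bottom row `𝒜_CG^{co ft} → 𝒜_coCG^co → 𝒜_coCG → ᶜᵒ𝒜_CG → 𝒜_CG`
      let b₁ := ObjectProperty.ιOfLE j₁
      let b₂ := ObjectProperty.ιOfLE j₂
      let b₃ := ObjectProperty.ιOfLE j₃
      let b₄ := ObjectProperty.ιOfLE j₄
      -- the vertical functors
      let v₁ := (AlgComon.commCogroupFT R).lift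
        ((PosGrMod.locallySinglyGeneratedFT R).ι ⋙ trivialFunctor R ⋙ tensorFunctor R) h₁
      let v₂ := (AlgComon.commCocommCogroup R).lift
        ((PosGrMod.locallySinglyGenerated R).ι ⋙ trivialFunctor R ⋙ tensorFunctor R) h₂
      let v₃ := (AlgComon.cocommCogroup R).lift (trivialFunctor R ⋙ tensorFunctor R) h₃
      let v₄ := (AlgComon.coalgCocommCogroup R).lift
        ((ConnCoalg.cocomm R).ι ⋙ tensorFunctor R) h₄
      let v₅ := (AlgComon.cogroup R).lift (tensorFunctor R) h₅
      -- the four squares commute up to natural isomorphism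
      (Nonempty (t₁ ⋙ v₂ ≅ v₁ ⋙ b₁) ∧ Nonempty (t₂ ⋙ v₃ ≅ v₂ ⋙ b₂) ∧
        Nonempty (t₃ ⋙ v₄ ≅ v₃ ⋙ b₃) ∧ Nonempty (t₄ ⋙ v₅ ≅ v₄ ⋙ b₄)) ∧
      -- all the functors are fully faithful
      ((t₁.Full ∧ t₁.Faithful) ∧ (t₂.Full ∧ t₂.Faithful) ∧ (t₃.Full ∧ t₃.Faithful) ∧
        (t₄.Full ∧ t₄.Faithful)) ∧
      ((b₁.Full ∧ b₁.Faithful) ∧ (b₂.Full ∧ b₂.Faithful) ∧ (b₃.Full ∧ b₃.Faithful) ∧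
        (b₄.Full ∧ b₄.Faithful)) ∧
      ((v₁.Full ∧ v₁.Faithful) ∧ (v₂.Full ∧ v₂.Faithful) ∧ (v₃.Full ∧ v₃.Faithful) ∧
        (v₄.Full ∧ v₄.Faithful) ∧ (v₅.Full ∧ v₅.Faithful)) ∧
      -- the vertical functors other than the one with source `𝒮` are equivalences
      (v₁.IsEquivalence ∧ v₃.IsEquivalence ∧ v₄.IsEquivalence ∧ v₅.IsEquivalence) ∧
      -- the case of a field
      (IsField R →
        (PosGrMod.basic R = PosGrMod.locallySinglyGeneratedFT R ∧
          PosGrMod.locallySinglyGeneratedFT R = PosGrMod.locallySinglyGenerated R) ∧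
        (AlgComon.commCogroupFT R = AlgComon.commCocommCogroup R ∧
          AlgComon.commCocommCogroup R = AlgComon.commCogroup R)) := by
  refine ⟨fun N => N.trivialCoalg_cocomm, fun N => N.property.tensorComon,
    fun N => N.property.tensorComon, fun N => N.trivialCoalg_tensorComon_cocomm,
    fun C => ⟨C.obj.tensorComon_cogroup, ConnCoalg.coalgCocomm_tensorComon_iff.2 C.property⟩,
    fun C => C.tensorComon_cogroup, fun _ h => h.1, AlgComon.commCogroupFT_le, fun _ h => h.2,
    AlgComon.cocommCogroup_le, fun _ h => h.1, ?_⟩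
  intro t₁ t₂ t₃ t₄ b₁ b₂ b₃ b₄ v₁ v₂ v₃ v₄ v₅
  -- All squares commute on the nose, since the vertical functors are restrictions of the same
  -- functors.
  refine ⟨⟨⟨Iso.refl _⟩, ⟨Iso.refl _⟩, ⟨Iso.refl _⟩, ⟨Iso.refl _⟩⟩,
    ⟨⟨inferInstance, inferInstance⟩, ⟨inferInstance, inferInstance⟩,
      full_faithful_lift _ _ _, ⟨inferInstance, inferInstance⟩⟩,
    ⟨⟨inferInstance, inferInstance⟩, ⟨inferInstance, inferInstance⟩,
      ⟨inferInstance, inferInstance⟩, ⟨inferInstance, inferInstance⟩⟩,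
    ⟨full_faithful_lift _ _ _, full_faithful_lift _ _ _, full_faithful_lift _ _ _,
      full_faithful_lift _ _ _, full_faithful_lift _ _ _⟩,
    -- Full faithfulness is known, so only essential surjectivity remains: the preimage of `A` is
    -- its coalgebra of primitive elements, or the positive part of that coalgebra when the reduced
    -- comultiplication is trivial.
    ⟨isEquivalence_lift _ _ _ fun A h => ⟨⟨_, h.posMod_primCoalg⟩,
        ⟨(tensorFunctor R).mapIso (ConnCoalg.trivialIso h.comul_primCoalg) ≪≫ A.ofPrimIso⟩⟩,
      isEquivalence_lift _ _ _ fun A h => ⟨A.primCoalg.posMod,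
        ⟨(tensorFunctor R).mapIso (ConnCoalg.trivialIso h.comul_primCoalg) ≪≫ A.ofPrimIso⟩⟩,
      isEquivalence_lift _ _ _ fun A h => ⟨⟨_, h.cocomm_primCoalg⟩, ⟨A.ofPrimIso⟩⟩,
      isEquivalence_lift _ _ _ fun A _ => ⟨A.primCoalg, ⟨A.ofPrimIso⟩⟩⟩, fun hR => ?_⟩
  have h₁ := PosGrMod.locallySinglyGenerated_le_basic hR
  have h₂ := PosGrMod.basic_le_locallySinglyGeneratedFT (R := R)
  have h₃ : PosGrMod.locallySinglyGeneratedFT R ≤ PosGrMod.locallySinglyGenerated R := fun _ h => h.1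
  have h₄ := AlgComon.commCogroup_le_of_isField hR
  have h₅ : AlgComon.commCocommCogroup R ≤ AlgComon.commCogroup R := fun _ h => h.1
  exact ⟨⟨le_antisymm h₂ (h₃.trans h₁), le_antisymm h₃ (h₁.trans h₂)⟩,
    le_antisymm AlgComon.commCogroupFT_le (h₅.trans h₄),
    le_antisymm h₅ (h₄.trans AlgComon.commCogroupFT_le)⟩
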